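/- **Conventions.** Manifolds are smooth, nonempty, Hausdorff and second countable; closed means compact without boundary. The classes $\mathcal D_k$ (resolution blowups) and $\mathcal Q_k$ (quasi-asymptotically conic, QAC, spaces) of depth $k\ge 0$, with a single link type along the singular stratum of each depth $j$, are defined recursively together with their radial and weight functions. Throughout, $m_{j-1}$ is the dimension of the QAC space $Z^{(j-1)}\in\mathcal Q_{j-1}$ that resolves the cone fibres along the stratum of depth $j$. *From $\mathcal D_k$ to $\mathcal Q_k$.* Let $(Y,h_\epsilon)_{0<\epsilon\le1}\in\mathcal D_k$, with resolved radial functions $\sigma_{1,\epsilon},\dots,\sigma_{k,\epsilon}$. An element $(Z,g)\in\mathcal Q_k$ with cross-section $(Y,h_\epsilon)$ is a connected Riemannian manifold $Z=K\sqcup\big((1,\infty)\times Y\big)$ with $K$ compact with boundary $\{1\}\times Y$ and with $g=d\rho^2+\rho^2h_{1/\rho}+O(\rho^{-\nu})$ on the end $[1,\infty)\times Y$ for some $\nu>0$. Its radial function is $\rho(t,y)=t$ on the end and $\rho=1$ on $K$. Its weight functions are the measurable functions $w_j(t,y)=\sigma_{j,1/t}(y)$ on the end $t>1$ and $w_j=1$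 on $K$, $1\le j\le k$. *$\mathcal D_0$* consists of the closed manifolds with a fixed metric. *From $\mathcal D_{k},\mathcal Q_{k}$ to $\mathcal D_{k+1}$.* An element of $\mathcal D_{k+1}$ is a closed manifold $Y$ with a family of metrics $h_\epsilon$, $0<\epsilon\le1$, smooth in $\epsilon$, and with functions $\sigma_{1,\epsilon},\dots,\sigma_{k+1,\epsilon}$, such that $Y=Y'\cup Y''$ is a union of two closed regions with common boundary, where: (i) $Y''$ is one of the two halves of a closed manifold $D$ with a smooth involution that exchanges the halves and fixes exactly their common boundary; $D$ carries the structure of an element of $\mathcal D_k$, whose metrics agree with $h_\epsilon$ on $Y''$, and whose resolved radial functions agree with $\sigma_{j,\epsilon}$, $j\le k$, on $Y\setminus Y'$, where also $\sigma_{k+1,\epsilon}=1$; (ii) for some $(Z^{(k)},g^{(k)})\in\mathcal Q_k$, with functions $\rho_k,w^{(k)}_j$, and for each $\epsilon$, $Y'$ is a smooth bundle over a closed manifold $S$ (by a projection independent of $\epsilon$) with fibre the truncation $\{\rho_k\le1/\epsilon\}$ of $Z^{(k)}$. In local trivializations $y\mapsto(q,u_\epsilon(y))$, over neighbourhoods in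 $S$ independent of $\epsilon$ and with constants uniform in $\epsilon$ and in the neighbourhood, $h_\epsilon$ is uniformly equivalent to $\kappa_S+\epsilon^2g^{(k)}$, where $\kappa_S$ is a metric on $S$; it differs from it by $O\big((\epsilon\rho_k(u_\epsilon))^{\nu}\big)$ for some $\nu>0$; and $\mathrm{dist}_{g^{(k)}}(u_\epsilon(y),u_{\epsilon'}(y))\le C\,|1/\epsilon-1/\epsilon'|$. Finally $\sigma_{k+1,\epsilon}=\epsilon\rho_k(u_\epsilon)$ and $\sigma_{j,\epsilon}=\epsilon\rho_k(u_\epsilon)\,w^{(k)}_j(u_\epsilon)$ for $j\le k$ on $Y'$. **Proposition 4.7.** Let $(Z,g)\in\mathcal Q_k$ be a QAC space of dimension $n$, with radial function $\rho$ and weight functions $w_1,\dots,w_k$. Let $a\in\mathbb R$ and $b\in\mathbb R^k$ satisfy $$a+n>0\qquad\text{and}\qquad b_1+\dots+b_j+m_{j-1}>0\quad\text{for all }1\le j\le k,$$ let $d\mu_{a,b}=\rho^a w_1^{b_1}\cdots w_k^{b_k}\,dV_g$, and let $c\in(0,1)$. Then there are constants $C_1,C_2>0$ such that, for every $p\in Z$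 and every $r\ge c\,\rho(p)$, the geodesic ball $B(p,r)$ satisfies $$C_1\,r^{a+n}\le\mu_{a,b}(B(p,r))\le C_2\,r^{a+n}.$$ -/

import Mathlib

open Set MeasureTheory
open scoped Manifold ContDiff Bundle ENNReal

universe u

noncomputable section

namespace QAC

/-! ### Smooth manifolds, Riemannian metrics, distance and volume -/

/-- A nonempty, Hausdorff, second countable smooth manifold of dimension `n`, without boundary. -/
structure Mfd (n : ℕ) : Type (u + 1) where
  carrier : Type u
  [top : TopologicalSpace carrier]
  [charted : ChartedSpace (EuclideanSpace ℝ (Fin n)) carrier]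
  [smooth : IsManifold (𝓡 n) ∞ carrier]
  [hausdorff : T2Space carrier]
  [secondCountable : SecondCountableTopology carrier]
  [nonempty : Nonempty carrier]

instance (n : ℕ) : CoeSort (Mfd.{u} n) (Type u) := ⟨Mfd.carrier⟩

attribute [instance] Mfd.top Mfd.charted Mfd.smooth Mfd.hausdorff Mfd.secondCountable Mfd.nonempty

instance {n : ℕ} (M : Mfd.{u} n) : MeasurableSpace M := borel M

instance {n : ℕ} (M : Mfd.{u} n) : BorelSpace M := ⟨rfl⟩

/-- Smooth Riemannian metrics on `M`. -/
abbrev Metric {n : ℕ} (M : Mfd.{u} n) : Type u :=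
  Bundle.ContMDiffRiemannianMetric (𝓡 n) ∞ (EuclideanSpace ℝ (Fin n))
    (fun x : M => TangentSpace (𝓡 n) x)

/-- The quadratic form `g_x(v, v)` of a metric. -/
def quad {n : ℕ} {M : Mfd.{u} n} (g : Metric M) (x : M) (v : TangentSpace (𝓡 n) x) : ℝ :=
  g.inner x v v

/-- The geodesic distance of `g`: the infimum of the `g`-lengths of `C¹` paths. -/
def gdist {n : ℕ} {M : Mfd.{u} n} (g : Metric M) (x y : M) : ℝ≥0∞ :=
  letI : Bundle.RiemannianBundle (fun x : M => TangentSpace (𝓡 n) x) := ⟨g.toRiemannianMetric⟩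
  Manifold.riemannianEDist (𝓡 n) x y

/-- The geodesic ball `B(p, r)` of `g`. -/
def gball {n : ℕ} {M : Mfd.{u} n} (g : Metric M) (p : M) (r : ℝ) : Set M :=
  {z | gdist g p z < ENNReal.ofReal r}

/-- The coordinate density `√det (g_ij)` of `g` at the point with coordinates `x` in the
preferred chart at `c`. -/
def chartDensity {n : ℕ} {M : Mfd.{u} n} (g : Metric M) (c : M)
    (x : EuclideanSpace ℝ (Fin n)) : ℝ :=
  let φ := chartAt (EuclideanSpace ℝ (Fin n)) c
  let e : Fin n → TangentSpace (𝓡 n) (φ.symm x) := fun i =>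
    mfderiv (𝓡 n) (𝓡 n) φ.symm x (EuclideanSpace.single i (1 : ℝ) : EuclideanSpace ℝ (Fin n))
  Real.sqrt (Matrix.det (Matrix.of fun i j : Fin n => g.inner (φ.symm x) (e i) (e j)))

/-- The measure `√det (g_ij) dx` of the preferred chart at `c`, carried over to its domain in
`M`. -/
def chartVolume {n : ℕ} {M : Mfd.{u} n} (g : Metric M) (c : M) : Measure M :=
  let φ := chartAt (EuclideanSpace ℝ (Fin n)) c
  ((volume.restrict φ.target).withDensity fun x => ENNReal.ofReal (chartDensity g c x)).map φ.symm

theorem exists_chart_cover {n : ℕ} (M : Mfd.{u} n) :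
    ∃ c : ℕ → M, ⋃ i, (chartAt (EuclideanSpace ℝ (Fin n)) (c i)).source = univ := by
  obtain ⟨s, hs, hs'⟩ := TopologicalSpace.countable_cover_nhds
    (fun x : M => (chartAt (EuclideanSpace ℝ (Fin n)) x).open_source.mem_nhds
      (mem_chart_source (EuclideanSpace ℝ (Fin n)) x))
  have hne : s.Nonempty := by
    by_contra h
    rw [not_nonempty_iff_eq_empty] at h
    subst h
    simp at hs'
    exact (empty_ne_univ hs')
  obtain ⟨c, hc⟩ := hs.exists_eq_range hne
  refine ⟨c, ?_⟩
  rw [hc, biUnion_range] at hs'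
  exact hs'

/-- The Riemannian volume measure `dV_g`: `M` is cut into countably many disjoint Borel pieces,
each contained in a chart, and the measures `√det (g_ij) dx` on these pieces are added. (The
result does not depend on the pieces, by the change of variables formula.) -/
def vol {n : ℕ} {M : Mfd.{u} n} (g : Metric M) : Measure M :=
  let c : ℕ → M := (exists_chart_cover M).choose
  Measure.sum fun i => (chartVolume g (c i)).restrict
    (disjointed (fun i => (chartAt (EuclideanSpace ℝ (Fin n)) (c i)).source) i)

/-! ### The data carried by resolution blowups and by QAC spaces -/

/-- The data of a resolution blowup: a closed manifold `Y` with a family of metrics `h ε` and a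
family of resolved radial functions `σ ε j`; only `0 < ε ≤ 1` is meaningful. The resolved radial
functions are numbered from zero, so that `σ ε j` is the one attached to the stratum of depth
`j + 1`, and at depth `k` only `j < k` is meaningful. -/
structure BlowupData (d : ℕ) : Type (u + 1) where
  Y : Mfd.{u} d
  h : ℝ → Metric Y
  σ : ℝ → ℕ → Y → ℝ

/-- The data of a QAC space: a manifold with a metric `g`, the radial function `ρ` and the weight
functions `w j`; again `w j` is attached to the stratum of depth `j + 1`, and at depth `k` only
`j < k` is meaningful. -/
structure QACData (n : ℕ) : Type (u + 1) where
  Z : Mfd.{u} n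
  g : Metric Z
  ρ : Z → ℝ
  w : ℕ → Z → ℝ

/-- `Z` is, outside a compact set `K`, the exterior cone over the family `(Y, h ε)`, with metric
`dρ² + ρ² h_{1/ρ} + O(ρ^{-ν})`, and its functions `ρ` and `w 0, …, w (k - 1)` are the ones that are
built from `Y`. The diffeomorphism `Φ` of the end `[1, ∞) × Y` is defined a little beyond `t = 1`, so
that `K` is a compact manifold with boundary `Y`. -/
def IsConicOver (k : ℕ) {n d : ℕ} (Z : QACData.{u} n) (Y : BlowupData.{u} d) : Prop :=
  ∃ Φ : PartialDiffeomorph (𝓘(ℝ, ℝ).prod (𝓡 d)) (𝓡 n) (ℝ × Y.Y) Z.Z ∞,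
  ∃ r₀ : ℝ, r₀ < 1 ∧ Φ.source = Ioi r₀ ×ˢ univ ∧
    -- the compact core
    IsCompact (Φ '' (Ioi 1 ×ˢ univ))ᶜ ∧
    (∀ z ∉ Φ '' (Ioi 1 ×ˢ univ), Z.ρ z = 1 ∧ ∀ j < k, Z.w j z = 1) ∧
    -- the end
    (∀ t : ℝ, 1 < t → ∀ y : Y.Y,
      Z.ρ (Φ (t, y)) = t ∧ ∀ j < k, Z.w j (Φ (t, y)) = Y.σ (1 / t) j y) ∧
    (∀ j < k, Measurable (Z.w j)) ∧
    -- the metric on the end, up to a decaying error, whose size is measured in the model metric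
    ∃ C ν : ℝ, 0 < ν ∧ ∀ t : ℝ, 1 ≤ t → ∀ (y : Y.Y) (s : ℝ) (v : TangentSpace (𝓡 d) y),
      let q : ℝ := s ^ 2 + t ^ 2 * quad (Y.h (1 / t)) y v
      |quad Z.g (Φ (t, y))
          (mfderiv (𝓘(ℝ, ℝ).prod (𝓡 d)) (𝓡 n) Φ (t, y)
            ((s, v) : ℝ × EuclideanSpace ℝ (Fin d))) - q|
        ≤ C * t ^ (-ν) * q

/-- The family `h ε`, `0 < ε ≤ 1`, depends smoothly on `ε`. -/
def SmoothFamily {d : ℕ} (Y : BlowupData.{u} d) : Prop :=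
  ContMDiffOn (𝓘(ℝ, ℝ).prod (𝓡 d).tangent) 𝓘(ℝ, ℝ) ∞
    (fun p : ℝ × TangentBundle (𝓡 d) Y.Y => quad (Y.h p.1) p.2.proj p.2.snd)
    (Ioc (0 : ℝ) 1 ×ˢ univ)

/-- The closed region `A` of `Y` (the piece `Y'`) is, for every `ε`, a smooth bundle over a closed
manifold `S` (the stratum of depth `k + 1`) whose fibre is the truncation `{ρ ≤ 1/ε}` of the QAC
space `Z` of depth `k`. In local trivializations `Φ ε = (pr, u ε)`, with uniform constants,

* `h ε` is the sum of the pullback of a metric `κ` of `S`, of `ε² g`, and of a perturbation that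
  decays (towards the stratum) like a positive power of the resolved radial function `ε ρ`;
* the identification of the fibre in the fixed manifold `Y` with the truncation at `R = 1/ε`
  moves points of `Z` at bounded speed as the truncation radius `R` grows;
* the resolved radial functions are `ε ρ` for the new stratum and `ε ρ w j` for the others. -/
def IsTruncatedBundle (k : ℕ) {d m : ℕ} (Y : BlowupData.{u} d) (A : Set Y.Y)
    (Z : QACData.{u} m) : Prop :=
  ∃ (s : ℕ) (S : Mfd.{u} s) (κ : Metric S) (pr : Y.Y → S) (N : Set Y.Y),
    CompactSpace S ∧ IsOpen N ∧ A ⊆ N ∧ ContMDiffOn (𝓡 d) (𝓡 s) ∞ pr N ∧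
    ∃ C ν : ℝ, 0 < ν ∧ ∀ s₀ : S, ∃ V : Set S, IsOpen V ∧ s₀ ∈ V ∧
    ∃ Φ : ℝ → PartialDiffeomorph (𝓡 d) ((𝓡 s).prod (𝓡 m)) Y.Y (S × Z.Z) ∞,
      (∀ ε ∈ Ioc (0 : ℝ) 1,
        -- `Φ ε` identifies the part of `A` over `V` with `V × {ρ ≤ 1/ε}`
        (Φ ε).source ⊆ N ∧ A ∩ pr ⁻¹' V ⊆ (Φ ε).source ∧
        V ×ˢ {z | Z.ρ z ≤ 1 / ε} ⊆ (Φ ε).target ∧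
        (∀ y ∈ (Φ ε).source, (Φ ε y).1 = pr y ∧ (y ∈ A ↔ Z.ρ (Φ ε y).2 ≤ 1 / ε)) ∧
        ∀ y ∈ A ∩ pr ⁻¹' V,
          -- the metric
          (∀ v : TangentSpace (𝓡 d) y,
            let dΦ : EuclideanSpace ℝ (Fin s) × EuclideanSpace ℝ (Fin m) :=
              mfderiv (𝓡 d) ((𝓡 s).prod (𝓡 m)) (Φ ε) y v
            let q : ℝ := quad κ (Φ ε y).1 dΦ.1 + ε ^ 2 * quad Z.g (Φ ε y).2 dΦ.2
            |quad (Y.h ε) y v - q| ≤ C * (ε * Z.ρ (Φ ε y).2) ^ ν * q ∧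
              q ≤ C * quad (Y.h ε) y v) ∧
          -- the resolved radial functions
          Y.σ ε k y = ε * Z.ρ (Φ ε y).2 ∧
          ∀ j < k, Y.σ ε j y = ε * Z.ρ (Φ ε y).2 * Z.w j (Φ ε y).2) ∧
      -- bounded speed in the truncation radius
      ∀ ε ∈ Ioc (0 : ℝ) 1, ∀ ε' ∈ Ioc (0 : ℝ) 1, ∀ y ∈ A ∩ pr ⁻¹' V,
        gdist Z.g (Φ ε y).2 (Φ ε' y).2 ≤ ENNReal.ofReal (C * |1 / ε - 1 / ε'|)

/-- The complement of the interior of the closed region `A` of `Y` (the piece `Y''`) is one half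
of the closed manifold `D`, which carries a family of metrics and a smooth involution `τ` that
interchanges the two halves and fixes their common boundary; the metrics `h ε` and the resolved
radial functions `σ ε j`, `j < k`, are those of `D`, and the remaining one, `σ ε k`, is `1`. -/
def IsHalfOfDouble (k : ℕ) {d : ℕ} (Y : BlowupData.{u} d) (A : Set Y.Y)
    (D : BlowupData.{u} d) : Prop :=
  ∃ (ι : PartialDiffeomorph (𝓡 d) (𝓡 d) Y.Y D.Y ∞) (τ : Diffeomorph (𝓡 d) (𝓡 d) D.Y D.Y ∞),
    (interior A)ᶜ ⊆ ι.source ∧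
    -- the involution and the two halves, which meet along its fixed set
    (∀ x, τ (τ x) = x) ∧
    ι '' (interior A)ᶜ ∪ τ '' (ι '' (interior A)ᶜ) = univ ∧
    ι '' (interior A)ᶜ ∩ τ '' (ι '' (interior A)ᶜ) = ι '' frontier A ∧
    (∀ x, τ x = x ↔ x ∈ ι '' frontier A) ∧
    -- the metrics and the resolved radial functions
    ∀ ε ∈ Ioc (0 : ℝ) 1,
      (∀ y ∈ (interior A)ᶜ, ∀ v : TangentSpace (𝓡 d) y,
        quad (Y.h ε) y v = quad (D.h ε) (ι y) (mfderiv (𝓡 d) (𝓡 d) ι y v)) ∧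
      ∀ y ∉ A, Y.σ ε k y = 1 ∧ ∀ j < k, Y.σ ε j y = D.σ ε j (ι y)

/-! ### The classes of resolution blowups and of QAC spaces -/

/-- `IsBlowup k m Y`: the family `Y = (Y, h ε)`, with its functions `σ ε j`, is a resolution blowup
of depth `k`, where `m j` is the dimension of the QAC space of depth `j` by which the stratum of
depth `j + 1` is resolved, for `j < k`.

In depth `0`, `Y` is a closed manifold with a fixed metric. In depth `k + 1`, `Y = Y' ∪ Y''`, where `Y''`
is half of a double `D` which is a resolution blowup of depth `k`, and `Y'` is a bundle over a
closed manifold whose fibres are truncations of a connected QAC space of depth `k`, that is of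
the exterior cone over a resolution blowup `L` of depth `k`, closed by a compact core. -/
def IsBlowup : ℕ → (ℕ → ℕ) → {d : ℕ} → BlowupData.{u} d → Prop
  | 0, _, _, Y => CompactSpace Y.Y ∧ ∀ ε ∈ Ioc (0 : ℝ) 1, Y.h ε = Y.h 1
  | k + 1, m, d, Y =>
    CompactSpace Y.Y ∧ SmoothFamily Y ∧
    ∃ A : Set Y.Y, IsClosed A ∧
      (∃ D : BlowupData.{u} d, IsBlowup k m D ∧ IsHalfOfDouble k Y A D) ∧
      ∃ Z : QACData.{u} (m k),
        (ConnectedSpace Z.Z ∧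
          ∃ (e : ℕ) (L : BlowupData.{u} e), IsBlowup k m L ∧ IsConicOver k Z L) ∧
        IsTruncatedBundle k Y A Z

/-- `IsQAC k m Z`: `Z` is a (connected) QAC space of depth `k`, i.e. a compact core together with the
exterior cone over a resolution blowup of depth `k`; `m j` is the dimension of the QAC space of
depth `j` that resolves the stratum of depth `j + 1`, for `j < k`. -/
def IsQAC (k : ℕ) (m : ℕ → ℕ) {n : ℕ} (Z : QACData.{u} n) : Prop :=
  ConnectedSpace Z.Z ∧ ∃ (d : ℕ) (Y : BlowupData.{u} d), IsBlowup k m Y ∧ IsConicOver k Z Y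

/-- The measure `dμ_{a,b} = ρ^a w^b dV_g`. -/
def weightedVol {n k : ℕ} (Z : QACData.{u} n) (a : ℝ) (b : Fin k → ℝ) : Measure Z.Z :=
  (vol Z.g).withDensity fun z => ENNReal.ofReal (Z.ρ z ^ a * ∏ j : Fin k, Z.w j z ^ b j)

end QAC

end

noncomputable section

set_option linter.unusedSectionVars false

namespace QAC

/-! ### Quadratic forms, path lengths and geodesic distance -/

section Basic

open Filter Topology

variable {n : ℕ} {M : Mfd.{u} n}

/-! On the end of a QAC space the metric is uniformly equivalent to `dt² + t² h_{1/t}`. For large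
`t` the error term is small, and on the remaining compact range continuity in `t` suffices. With `d
= n - 1`, the measure is therefore comparable to `t^(a+d) dt` times the measure `∏ σ_j^{b_j} dV` of
`(Y, h_{1/t})`. Growth of order `r^(a+n)` follows from two facts about the cross-section, both
uniform in `ε`: its total weighted volume is bounded, and every ball of fixed radius `δ` has
weighted volume bounded below. These facts form the structure `HasVolumeBounds`.

They are proved by induction on the depth (`IsBlowup.hasVolumeBounds`). Over a stratum, `Y'` is a
bundle with fibre the truncation `{ρ ≤ 1/ε}` of a QAC space of dimension `e` and smaller depth,
scaled by `ε`. There every `σ_j` carries the factor `ερ`, so the weight becomes `ε^A ρ^A w^b` with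
`A` the sum of all exponents, and the fibre volume carries `ε^e`. The total `ε^(A+e)` cancels the
growth `(1/ε)^(A+e)` of the weighted volume of the truncation (`ofReal_scaling`); the hypothesis on
the full partial sum says precisely that `A + e > 0`. The remaining part `Y''` is isometric to a
part of `D`, of smaller depth, with the same weights.

For the lower bounds, a point over the stratum is first moved inwards along its fibre. A base ball
times a fibre ball of radius `β/ε` around the new point then fits into the `δ`-ball, and the lower
bound of the fibre applies. A point of `Y''` either has such a point nearby, or a ball around its
image in `D` comes entirely from `Y''`. Lower bounds need no sign condition on the exponents; upper
bounds do.

For the QAC space itself the upper bound encloses `B(p, r)` in a sublevel set of `ρ`, because `ρ`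
grows at most linearly with distance (`IsCone.rho_le_add`). The lower bound goes radially outwards
from `p` for a time proportional to `r` and collects slice balls
(`exists_le_setLIntegral_weight_of_large`); small `r` is a matter of compactness.

Volumes are compared through `dens`, the inverse measure of the unit ball of a quadratic form, which
is visibly monotone in the form. Inequalities between metrics thus become inequalities between
volumes without any manipulation of determinants. -/

theorem quad_smul (g : Metric M) (x : M) (c : ℝ) (v : TangentSpace (𝓡 n) x) :
    quad g x (c • v) = c ^ 2 * quad g x v := by
  simp only [quad, map_smul, smul_apply, smul_eq_mul]; ring

theorem quad_pos (g : Metric M) (x : M) {v : TangentSpace (𝓡 n) x} (hv : v ≠ 0) :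
    0 < quad g x v := g.pos x v hv

theorem quad_zero (g : Metric M) (x : M) : quad g x (0 : TangentSpace (𝓡 n) x) = 0 := by
  simp [quad]

theorem quad_nonneg (g : Metric M) (x : M) (v : TangentSpace (𝓡 n) x) : 0 ≤ quad g x v := by
  by_cases hv : v = 0
  · rw [hv, quad_zero]
  · exact (quad_pos g x hv).le

theorem continuous_quad (g : Metric M) :
    Continuous fun p : TangentBundle (𝓡 n) M => quad g p.proj p.snd := by
  let : Bundle.RiemannianBundle (fun x : M => TangentSpace (𝓡 n) x) := ⟨g.toRiemannianMetric⟩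
  have : IsContinuousRiemannianBundle (EuclideanSpace ℝ (Fin n))
    (fun x : M => TangentSpace (𝓡 n) x) := ⟨g.inner, g.contMDiff.continuous, fun _ _ _ => rfl⟩
  have h1 : Continuous fun p : TangentBundle (𝓡 n) M => p := continuous_id
  exact Continuous.inner_bundle (F := EuclideanSpace ℝ (Fin n))
    (E := fun x : M => TangentSpace (𝓡 n) x) (b := fun p : TangentBundle (𝓡 n) M => p.proj)
    (v := fun p => p.snd) (w := fun p => p.snd) h1 h1

/-- The length of the path `γ` on `[a, b]` for the metric `g`. -/
def glen (g : Metric M) (γ : ℝ → M) (a b : ℝ) : ℝ≥0∞ :=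
  ∫⁻ t in Icc a b, ENNReal.ofReal (Real.sqrt (quad g (γ t) (mfderiv 𝓘(ℝ, ℝ) (𝓡 n) γ t (1 : ℝ))))

theorem glen_eq_pathELength (g : Metric M) (γ : ℝ → M) (a b : ℝ) :
    letI : Bundle.RiemannianBundle (fun x : M => TangentSpace (𝓡 n) x) := ⟨g.toRiemannianMetric⟩
    glen g γ a b = Manifold.pathELength (𝓡 n) γ a b := by
  let : Bundle.RiemannianBundle (fun x : M => TangentSpace (𝓡 n) x) := ⟨g.toRiemannianMetric⟩
  rw [Manifold.pathELength_eq_lintegral_mfderiv_Icc]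
  unfold glen
  congr 1; ext t
  rw [← ofReal_norm, norm_eq_sqrt_real_inner]
  rfl

theorem gdist_le_glen (g : Metric M) {γ : ℝ → M} {a b : ℝ} (hab : a ≤ b)
    (hγ : ContMDiffOn 𝓘(ℝ, ℝ) (𝓡 n) 1 γ (Icc a b)) :
    gdist g (γ a) (γ b) ≤ glen g γ a b := by
  let : Bundle.RiemannianBundle (fun x : M => TangentSpace (𝓡 n) x) := ⟨g.toRiemannianMetric⟩
  rw [glen_eq_pathELength]
  exact Manifold.riemannianEDist_le_pathELength hγ rfl rfl hab

theorem exists_glen_lt (g : Metric M) {x y : M} {r : ℝ≥0∞} (h : gdist g x y < r) :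
    ∃ γ : ℝ → M, γ 0 = x ∧ γ 1 = y ∧ ContMDiff 𝓘(ℝ, ℝ) (𝓡 n) 1 γ ∧ glen g γ 0 1 < r := by
  let : Bundle.RiemannianBundle (fun x : M => TangentSpace (𝓡 n) x) := ⟨g.toRiemannianMetric⟩
  obtain ⟨γ, h0, h1, h2, h3, -⟩ :=
    Manifold.exists_lt_locally_constant_of_riemannianEDist_lt h zero_lt_one
  exact ⟨γ, h0, h1, h2, by rwa [glen_eq_pathELength]⟩

theorem glen_mono (g : Metric M) (γ : ℝ → M) {a b a' b' : ℝ} (h : a' ≤ a) (h' : b ≤ b') :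
    glen g γ a b ≤ glen g γ a' b' :=
  lintegral_mono_set (Icc_subset_Icc h h')

theorem gdist_self (g : Metric M) (x : M) : gdist g x x = 0 := by
  let : Bundle.RiemannianBundle (fun x : M => TangentSpace (𝓡 n) x) := ⟨g.toRiemannianMetric⟩
  exact Manifold.riemannianEDist_self

theorem gdist_comm (g : Metric M) (x y : M) : gdist g x y = gdist g y x := by
  let : Bundle.RiemannianBundle (fun x : M => TangentSpace (𝓡 n) x) := ⟨g.toRiemannianMetric⟩
  exact Manifold.riemannianEDist_comm

theorem gdist_triangle (g : Metric M) (x y z : M) :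
    gdist g x z ≤ gdist g x y + gdist g y z := by
  let : Bundle.RiemannianBundle (fun x : M => TangentSpace (𝓡 n) x) := ⟨g.toRiemannianMetric⟩
  exact Manifold.riemannianEDist_triangle

theorem eventually_gdist_lt (g : Metric M) (x : M) {c : ℝ≥0∞} (hc : 0 < c) :
    ∀ᶠ y in 𝓝 x, gdist g x y < c := by
  let : Bundle.RiemannianBundle (fun x : M => TangentSpace (𝓡 n) x) := ⟨g.toRiemannianMetric⟩
  have : IsContinuousRiemannianBundle (EuclideanSpace ℝ (Fin n))
    (fun x : M => TangentSpace (𝓡 n) x) := ⟨g.inner, g.contMDiff.continuous, fun _ _ _ => rfl⟩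
  exact eventually_riemannianEDist_lt (𝓡 n) x hc

theorem exists_gdist_lt_subset (g : Metric M) {x : M} {s : Set M} (hs : s ∈ 𝓝 x) :
    ∃ c : ℝ≥0∞, 0 < c ∧ {y | gdist g x y < c} ⊆ s := by
  let : Bundle.RiemannianBundle (fun x : M => TangentSpace (𝓡 n) x) := ⟨g.toRiemannianMetric⟩
  have : IsContinuousRiemannianBundle (EuclideanSpace ℝ (Fin n))
    (fun x : M => TangentSpace (𝓡 n) x) := ⟨g.inner, g.contMDiff.continuous, fun _ _ _ => rfl⟩
  have : LocallyCompactSpace M :=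
    ChartedSpace.locallyCompactSpace (EuclideanSpace ℝ (Fin n)) M
  obtain ⟨c, hc, h⟩ := setOfPred_riemannianEDist_lt_subset_nhds' (𝓡 n) hs
  exact ⟨c, hc, h⟩

theorem isOpen_gdist_lt (g : Metric M) (x : M) (r : ℝ≥0∞) : IsOpen {y | gdist g x y < r} := by
  rw [isOpen_iff_mem_nhds]
  intro y hy
  have : 0 < r - gdist g x y := tsub_pos_of_lt hy
  filter_upwards [eventually_gdist_lt g y this] with z hz
  calc gdist g x z ≤ gdist g x y + gdist g y z := gdist_triangle g x y z
    _ < r := by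
      rw [add_comm]; exact lt_tsub_iff_right.1 hz

theorem isOpen_gball (g : Metric M) (x : M) (r : ℝ) : IsOpen (gball g x r) :=
  isOpen_gdist_lt g x _

theorem mem_gball_self (g : Metric M) (x : M) {r : ℝ} (hr : 0 < r) : x ∈ gball g x r := by
  simp [gball, gdist_self, hr]

theorem gball_mono (g : Metric M) (x : M) {r r' : ℝ} (h : r ≤ r') : gball g x r ⊆ gball g x r' :=
  fun _ hz => lt_of_lt_of_le hz (ENNReal.ofReal_le_ofReal h)

/-- A ball contains the balls around its points whose radii add up. -/
theorem gball_subset_gball (g : Metric M) {x y : M} {r s t : ℝ} (hr : 0 ≤ r) (hs : 0 ≤ s)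
    (hxy : gdist g x y ≤ ENNReal.ofReal r) (h : r + s ≤ t) : gball g y s ⊆ gball g x t := by
  intro z hz
  calc gdist g x z ≤ gdist g x y + gdist g y z := gdist_triangle g x y z
    _ < ENNReal.ofReal r + ENNReal.ofReal s :=
      ENNReal.add_lt_add_of_le_of_lt (ne_top_of_le_ne_top ENNReal.ofReal_ne_top hxy) hxy hz
    _ = ENNReal.ofReal (r + s) := (ENNReal.ofReal_add hr hs).symm
    _ ≤ _ := ENNReal.ofReal_le_ofReal h

/-- The points at finite distance from `x` form an open set, and so do those at infinite distance,
by the triangle inequality; connectedness excludes the latter. -/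
theorem gdist_lt_top [ConnectedSpace M] (g : Metric M) (x y : M) : gdist g x y < ⊤ := by
  have : {y | gdist g x y < ⊤} = univ := by
    apply IsClopen.eq_univ
    · refine ⟨⟨?_⟩, isOpen_gdist_lt g x _⟩
      rw [isOpen_iff_mem_nhds]
      intro y hy
      filter_upwards [eventually_gdist_lt g y ENNReal.zero_lt_top] with z hz hz'
      apply hy
      refine (gdist_triangle g x z y).trans_lt (ENNReal.add_lt_top.2 ⟨hz', ?_⟩)
      rwa [gdist_comm]
    · exact ⟨x, by simp [gdist_self]⟩
  exact (this ▸ mem_univ y : y ∈ {y | gdist g x y < ⊤})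

theorem exists_gdist_le_of_isCompact [ConnectedSpace M] (g : Metric M) (x : M) {K : Set M}
    (hK : IsCompact K) : ∃ l : ℝ, 0 < l ∧ ∀ y ∈ K, gdist g x y ≤ ENNReal.ofReal l := by
  obtain ⟨t, ht⟩ := hK.elim_finite_subcover (fun i : ℕ => {y | gdist g x y < (i : ℝ≥0∞)})
    (fun i => isOpen_gdist_lt g x _) (fun y _ => by
      obtain ⟨i, hi⟩ := ENNReal.exists_nat_gt (gdist_lt_top g x y).ne
      exact mem_iUnion.2 ⟨i, hi⟩)
  refine ⟨(t.sup id : ℕ) + 1, by positivity, fun y hy => ?_⟩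
  obtain ⟨i, hi, hyi⟩ := mem_iUnion₂.1 (ht hy)
  have h1 : (i : ℝ≥0∞) ≤ ENNReal.ofReal (((t.sup id : ℕ) : ℝ) + 1) := by
    rw [← ENNReal.ofReal_natCast]
    apply ENNReal.ofReal_le_ofReal
    have : i ≤ t.sup id := Finset.le_sup (f := id) hi
    have : (i : ℝ) ≤ (t.sup id : ℕ) := by exact_mod_cast this
    linarith
  exact (le_of_lt hyi).trans h1

/-- A map that stretches tangent vectors along a path at most by the factor `C` moves the end points
of the path apart by at most `C` times its length. -/
theorem gdist_comp_le {n' : ℕ} {N : Mfd.{u} n'} (g : Metric M) (g' : Metric N) {f : M → N}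
    {O : Set M} (hO : IsOpen O) (hf : ContMDiffOn (𝓡 n) (𝓡 n') 1 f O) {γ : ℝ → M} {a b C : ℝ}
    (hab : a ≤ b) (hC : 0 ≤ C) (hγ : ∀ t ∈ Icc a b, ContMDiffAt 𝓘(ℝ, ℝ) (𝓡 n) 1 γ t)
    (hγO : ∀ t ∈ Icc a b, γ t ∈ O)
    (h : ∀ t ∈ Icc a b, ∀ v : TangentSpace (𝓡 n) (γ t),
      quad g' (f (γ t)) (mfderiv (𝓡 n) (𝓡 n') f (γ t) v) ≤ C ^ 2 * quad g (γ t) v) :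
    gdist g' (f (γ a)) (f (γ b)) ≤ ENNReal.ofReal C * glen g γ a b := by
  have hfa : ∀ t ∈ Icc a b, ContMDiffAt (𝓡 n) (𝓡 n') 1 f (γ t) := fun t ht =>
    hf.contMDiffAt (hO.mem_nhds (hγO t ht))
  refine (gdist_le_glen g' (γ := f ∘ γ) hab fun t ht =>
    ((hfa t ht).comp t (hγ t ht)).contMDiffWithinAt).trans ?_
  unfold glen
  rw [← lintegral_const_mul' _ _ ENNReal.ofReal_ne_top]
  refine setLIntegral_mono' measurableSet_Icc fun t ht => ?_
  rw [mfderiv_comp t ((hfa t ht).mdifferentiableAt one_ne_zero)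
    ((hγ t ht).mdifferentiableAt one_ne_zero), ← ENNReal.ofReal_mul hC]
  apply ENNReal.ofReal_le_ofReal
  rw [← Real.sqrt_sq hC, ← Real.sqrt_mul (sq_nonneg C)]
  exact Real.sqrt_le_sqrt (h t ht _)

/-- The same estimate for real functions. -/
theorem abs_sub_le_glen (g : Metric M) {f : M → ℝ}
    {O : Set M} (hO : IsOpen O) (hf : ContMDiffOn (𝓡 n) 𝓘(ℝ, ℝ) 1 f O) {γ : ℝ → M} {a b C : ℝ}
    (hab : a ≤ b) (hC : 0 ≤ C) (hγ : ∀ t ∈ Icc a b, ContMDiffAt 𝓘(ℝ, ℝ) (𝓡 n) 1 γ t)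
    (hγO : ∀ t ∈ Icc a b, γ t ∈ O)
    (h : ∀ t ∈ Icc a b, ∀ v : TangentSpace (𝓡 n) (γ t),
      let w : ℝ := mfderiv (𝓡 n) 𝓘(ℝ, ℝ) f (γ t) v
      w ^ 2 ≤ C ^ 2 * quad g (γ t) v) :
    ENNReal.ofReal |f (γ b) - f (γ a)| ≤ ENNReal.ofReal C * glen g γ a b := by
  have hfa : ∀ t ∈ Icc a b, ContMDiffAt (𝓡 n) 𝓘(ℝ, ℝ) 1 f (γ t) := fun t ht =>
    hf.contMDiffAt (hO.mem_nhds (hγO t ht))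
  have hc : ContDiffOn ℝ 1 (f ∘ γ) (Icc a b) := by
    rw [← contMDiffOn_iff_contDiffOn]
    exact fun t ht => ((hfa t ht).comp t (hγ t ht)).contMDiffWithinAt
  have h1 := enorm_sub_le_lintegral_deriv_of_contDiffOn_Icc hc hab
  rw [← ofReal_norm, Real.norm_eq_abs] at h1
  refine h1.trans ?_
  unfold glen
  rw [← lintegral_const_mul' _ _ ENNReal.ofReal_ne_top]
  refine setLIntegral_mono' measurableSet_Icc fun t ht => ?_
  let w : ℝ := mfderiv (𝓡 n) 𝓘(ℝ, ℝ) f (γ t) (mfderiv 𝓘(ℝ, ℝ) (𝓡 n) γ t (1 : ℝ))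
  have h2 : deriv (f ∘ γ) t = w := by
    rw [← fderiv_apply_one_eq_deriv, ← mfderiv_eq_fderiv,
      mfderiv_comp t ((hfa t ht).mdifferentiableAt one_ne_zero)
        ((hγ t ht).mdifferentiableAt one_ne_zero)]
    rfl
  rw [← ofReal_norm, Real.norm_eq_abs, ← ENNReal.ofReal_mul hC, h2]
  apply ENNReal.ofReal_le_ofReal
  apply abs_le_of_sq_le_sq _ (by positivity)
  rw [mul_pow, Real.sq_sqrt (quad_nonneg g _ _)]
  exact h t ht _

end Basic

/-! ### Densities of quadratic forms -/

section Density

open Module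

variable {E : Type*} [NormedAddCommGroup E] [NormedSpace ℝ E]

/-- Continuous nonnegative functions that are homogeneous of degree two. -/
structure IsForm (Q : E → ℝ) : Prop where
  cont : Continuous Q
  nonneg : ∀ v, 0 ≤ Q v
  smul : ∀ (c : ℝ) (v : E), Q (c • v) = c ^ 2 * Q v

theorem IsForm.map_zero {Q : E → ℝ} (h : IsForm Q) : Q 0 = 0 := by
  simpa using h.smul 0 0

theorem IsForm.const_mul {Q : E → ℝ} (h : IsForm Q) {c : ℝ} (hc : 0 ≤ c) :
    IsForm fun v => c * Q v :=
  ⟨h.cont.const_mul c, fun v => mul_nonneg hc (h.nonneg v), fun a v => by rw [h.smul]; ring⟩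

theorem isForm_sq : IsForm fun s : ℝ => s ^ 2 :=
  ⟨by fun_prop, fun _ => sq_nonneg _, fun c v => by simp; ring⟩

theorem isForm_quad {n : ℕ} {M : Mfd.{u} n} (g : Metric M) (x : M)
    (L : E →L[ℝ] TangentSpace (𝓡 n) x) : IsForm fun v => quad g x (L v) := by
  refine ⟨?_, fun v => quad_nonneg g x _, fun c v => ?_⟩
  · let B : EuclideanSpace ℝ (Fin n) →L[ℝ] EuclideanSpace ℝ (Fin n) →L[ℝ] ℝ := g.inner x
    let L' : E →L[ℝ] EuclideanSpace ℝ (Fin n) := L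
    exact (B.continuous.comp L'.continuous).clm_apply L'.continuous
  · rw [map_smul, quad_smul]

variable [MeasurableSpace E]

/-- The density of the volume element of a quadratic form, up to a constant that depends on the
dimension only. -/
def dens (μ : Measure E) (Q : E → ℝ) : ℝ≥0∞ := (μ {v | Q v < 1})⁻¹

omit [NormedAddCommGroup E] [NormedSpace ℝ E] in
-- A larger form has a smaller unit ball. This is the reason for working with unit balls instead of
-- determinants.
theorem dens_mono {μ : Measure E} {Q Q' : E → ℝ} (h : ∀ v, Q v ≤ Q' v) :
    dens μ Q ≤ dens μ Q' :=
  ENNReal.inv_le_inv.2 (measure_mono fun v hv => (h v).trans_lt hv)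

variable [BorelSpace E] [FiniteDimensional ℝ E]

/-- The unit ball of the pulled back form is the preimage under `A` of the unit ball of `Q`, so its
measure is divided by `|det A|`. -/
theorem dens_comp (μ : Measure E) [μ.IsAddHaarMeasure] (Q : E → ℝ) {A : E →L[ℝ] E}
    (hA : A.det ≠ 0) :
    dens μ (fun v => Q (A v)) = ENNReal.ofReal |A.det| * dens μ Q := by
  have hA' : LinearMap.det (A : E →ₗ[ℝ] E) ≠ 0 := hA
  have h := Measure.addHaar_preimage_linearMap μ hA' {v | Q v < 1}
  have h2 : (A : E →ₗ[ℝ] E) ⁻¹' {v | Q v < 1} = {v | Q (A v) < 1} := rfl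
  rw [h2] at h
  unfold dens
  rw [h, ENNReal.mul_inv]
  · rw [abs_inv, ENNReal.ofReal_inv_of_pos (abs_pos.2 hA'), inv_inv]
  · left
    rw [Ne, ENNReal.ofReal_eq_zero, not_le]
    exact abs_pos.2 (inv_ne_zero hA')
  · left; exact ENNReal.ofReal_ne_top

/-- By homogeneity, `c² Q` is the pullback of `Q` under the homothety of ratio `c`. -/
theorem dens_const_mul (μ : Measure E) [μ.IsAddHaarMeasure] {Q : E → ℝ} (hQ : IsForm Q) {c : ℝ}
    (hc : 0 < c) :
    dens μ (fun v => c ^ 2 * Q v) = ENNReal.ofReal c ^ finrank ℝ E * dens μ Q := by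
  have h := dens_comp μ Q (A := c • ContinuousLinearMap.id ℝ E)
  have hd : (c • ContinuousLinearMap.id ℝ E).det = c ^ finrank ℝ E := by
    have : (c • ContinuousLinearMap.id ℝ E).det = LinearMap.det (c • (LinearMap.id : E →ₗ[ℝ] E)) :=
      rfl
    rw [this, LinearMap.det_smul, LinearMap.det_id, mul_one]
  rw [hd] at h
  specialize h (pow_ne_zero _ hc.ne')
  rw [abs_of_pos (pow_pos hc _), ENNReal.ofReal_pow hc.le] at h
  rw [← h]
  congr 1; ext v
  rw [← hQ.smul]; rfl

omit [BorelSpace E] [FiniteDimensional ℝ E] in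
theorem measure_form_ne_zero (μ : Measure E) [μ.IsAddHaarMeasure] {Q : E → ℝ} (hQ : IsForm Q) :
    μ {v | Q v < 1} ≠ 0 :=
  ((isOpen_lt hQ.cont continuous_const).measure_pos μ ⟨0, by simp [hQ.map_zero]⟩).ne'

variable {F : Type*} [NormedAddCommGroup F] [NormedSpace ℝ F] [MeasurableSpace F] [BorelSpace F]
  [FiniteDimensional ℝ F]

omit [BorelSpace E] [FiniteDimensional ℝ E] [BorelSpace F] in
-- The unit ball of a sum of nonnegative forms lies in the product of the unit balls.
theorem le_dens_prod (μ : Measure E) [μ.IsAddHaarMeasure] (ν : Measure F) [ν.IsAddHaarMeasure]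
    {P : E → ℝ} {Q : F → ℝ} (hP : IsForm P) (hQ : IsForm Q) :
    dens μ P * dens ν Q ≤ dens (μ.prod ν) fun p => P p.1 + Q p.2 := by
  unfold dens
  rw [← ENNReal.mul_inv (Or.inl (measure_form_ne_zero μ hP)) (Or.inr (measure_form_ne_zero ν hQ)),
    ← Measure.prod_prod]
  refine ENNReal.inv_le_inv.2 (measure_mono fun p hp => ⟨?_, ?_⟩)
  · have := hQ.nonneg p.2
    simp only [mem_ofPred_eq] at hp ⊢; linarith
  · have := hP.nonneg p.1
    simp only [mem_ofPred_eq] at hp ⊢; linarith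

/-- The product of the unit balls of `2P` and `2Q` lies in the unit ball of `P + Q`; doubling the
forms costs a factor `√2` per dimension. -/
theorem dens_prod_le (μ : Measure E) [μ.IsAddHaarMeasure] (ν : Measure F) [ν.IsAddHaarMeasure]
    {P : E → ℝ} {Q : F → ℝ} (hP : IsForm P) (hQ : IsForm Q) :
    dens (μ.prod ν) (fun p => P p.1 + Q p.2) ≤
      ENNReal.ofReal (√2) ^ (finrank ℝ E + finrank ℝ F) * (dens μ P * dens ν Q) := by
  have h2 : (0 : ℝ) < √2 := by positivity
  have e1 := dens_const_mul μ hP h2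
  have e2 := dens_const_mul ν hQ h2
  have : ENNReal.ofReal (√2) ^ (finrank ℝ E + finrank ℝ F) * (dens μ P * dens ν Q) =
      dens μ (fun v => √2 ^ 2 * P v) * dens ν (fun v => √2 ^ 2 * Q v) := by
    rw [e1, e2]; ring
  have hP' := hP.const_mul (c := √2 ^ 2) (by positivity)
  have hQ' := hQ.const_mul (c := √2 ^ 2) (by positivity)
  rw [this]
  unfold dens
  rw [← ENNReal.mul_inv (Or.inl (measure_form_ne_zero μ hP')) (Or.inr (measure_form_ne_zero ν hQ')),
    ← Measure.prod_prod]
  refine ENNReal.inv_le_inv.2 (measure_mono fun p hp => ?_)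
  simp only [mem_prod, mem_ofPred_eq, Real.sq_sqrt zero_le_two] at hp ⊢
  linarith

open scoped MatrixOrder in
/-- The density of a form is its Gram determinant, up to a constant. -/
theorem sqrt_det_eq_dens {n : ℕ} {G : Matrix (Fin n) (Fin n) ℝ} (hG : G.PosDef)
    {Q : EuclideanSpace ℝ (Fin n) → ℝ} (hQ : ∀ v, Q v = ∑ i, ∑ j, v i * v j * G i j) :
    ENNReal.ofReal √G.det =
      volume (Metric.ball (0 : EuclideanSpace ℝ (Fin n)) 1) * dens volume Q := by
  -- Writing `G = BᵀB` exhibits `Q` as the pullback of the Euclidean square norm under `B`, and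
  -- `√det G = |det B|`.
  obtain ⟨B, hB⟩ := CStarAlgebra.nonneg_iff_eq_star_mul_self.mp hG.posSemidef.nonneg
  have hdet : G.det = B.det ^ 2 := by
    rw [hB, Matrix.det_mul, Matrix.star_eq_conjTranspose, Matrix.det_conjTranspose, star_trivial, sq]
  have hB0 : B.det ≠ 0 := fun h => by
    have := hG.det_pos
    rw [hdet, h] at this; simp at this
  let A : EuclideanSpace ℝ (Fin n) →L[ℝ] EuclideanSpace ℝ (Fin n) :=
    LinearMap.toContinuousLinearMap (Matrix.toLpLin 2 2 B)
  have hAdet : A.det = B.det := by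
    change LinearMap.det (Matrix.toLpLin 2 2 B) = _
    rw [Matrix.toLpLin_eq_toLin, LinearMap.det_toLin]
  have hA : ∀ v i, A v i = ∑ j, B i j * v j := fun v i => rfl
  have hQA : ∀ v, Q v = ‖A v‖ ^ 2 := by
    intro v
    rw [hQ, EuclideanSpace.norm_sq_eq]
    simp only [hA, Real.norm_eq_abs, sq_abs]
    have hG' : ∀ i j, G i j = ∑ k, B k i * B k j := fun i j => by
      rw [hB, Matrix.star_eq_conjTranspose, Matrix.mul_apply]; simp
    simp only [hG', sq, Finset.mul_sum]
    rw [Finset.sum_congr rfl fun i _ => Finset.sum_comm, Finset.sum_comm]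
    refine Finset.sum_congr rfl fun k _ => Finset.sum_congr rfl fun i _ => ?_
    rw [Finset.sum_mul]
    exact Finset.sum_congr rfl fun j _ => by ring
  have hball : volume {v : EuclideanSpace ℝ (Fin n) | ‖v‖ ^ 2 < 1} =
      volume (Metric.ball (0 : EuclideanSpace ℝ (Fin n)) 1) := by
    congr 1; ext v
    simp
  have h := dens_comp volume (fun v : EuclideanSpace ℝ (Fin n) => ‖v‖ ^ 2) (A := A)
    (by rwa [hAdet])
  have hQ' : Q = fun v => ‖A v‖ ^ 2 := funext hQA
  rw [hQ', h, hAdet, hdet, Real.sqrt_sq_eq_abs, dens, hball, mul_left_comm,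
    ENNReal.mul_inv_cancel, mul_one]
  · exact (Metric.measure_ball_pos volume _ one_pos).ne'
  · exact measure_ball_lt_top.ne

end Density

/-! ### Parametrizations -/

section Emb

variable {E₁ : Type*} [NormedAddCommGroup E₁] [NormedSpace ℝ E₁]
  {E₂ : Type*} [NormedAddCommGroup E₂] [NormedSpace ℝ E₂]
  {E₃ : Type*} [NormedAddCommGroup E₃] [NormedSpace ℝ E₃]
  {E₄ : Type*} [NormedAddCommGroup E₄] [NormedSpace ℝ E₄]
  {H₁ : Type*} [TopologicalSpace H₁] {H₂ : Type*} [TopologicalSpace H₂]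
  {H₃ : Type*} [TopologicalSpace H₃] {H₄ : Type*} [TopologicalSpace H₄]
  {I₁ : ModelWithCorners ℝ E₁ H₁} {I₂ : ModelWithCorners ℝ E₂ H₂}
  {I₃ : ModelWithCorners ℝ E₃ H₃} {I₄ : ModelWithCorners ℝ E₄ H₄}
  {X₁ : Type*} [TopologicalSpace X₁] [ChartedSpace H₁ X₁]
  {X₂ : Type*} [TopologicalSpace X₂] [ChartedSpace H₂ X₂]
  {X₃ : Type*} [TopologicalSpace X₃] [ChartedSpace H₃ X₃]
  {X₄ : Type*} [TopologicalSpace X₄] [ChartedSpace H₄ X₄]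

variable (I₁ I₂) in
/-- Injective `C¹` immersions of open sets. -/
structure IsEmb (f : X₁ → X₂) (O : Set X₁) : Prop where
  isOpen : IsOpen O
  contMDiffOn : ContMDiffOn I₁ I₂ 1 f O
  injOn : InjOn f O
  mfderiv_eq_zero : ∀ x ∈ O, ∀ v, mfderiv I₁ I₂ f x v = 0 → v = 0

namespace IsEmb

theorem contMDiffAt {f : X₁ → X₂} {O : Set X₁} (h : IsEmb I₁ I₂ f O) {x : X₁} (hx : x ∈ O) :
    ContMDiffAt I₁ I₂ 1 f x := h.contMDiffOn.contMDiffAt (h.isOpen.mem_nhds hx)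

theorem mdifferentiableAt {f : X₁ → X₂} {O : Set X₁} (h : IsEmb I₁ I₂ f O) {x : X₁} (hx : x ∈ O) :
    MDifferentiableAt I₁ I₂ f x := (h.contMDiffAt hx).mdifferentiableAt one_ne_zero

theorem comp {f : X₁ → X₂} {g : X₂ → X₃} {O : Set X₁} {O' : Set X₂} (hg : IsEmb I₂ I₃ g O')
    (hf : IsEmb I₁ I₂ f O) (h : MapsTo f O O') : IsEmb I₁ I₃ (g ∘ f) O where
  isOpen := hf.isOpen
  contMDiffOn := hg.contMDiffOn.comp hf.contMDiffOn h
  injOn := hg.injOn.comp hf.injOn h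
  mfderiv_eq_zero x hx v hv := by
    rw [mfderiv_comp x (hg.mdifferentiableAt (h hx)) (hf.mdifferentiableAt hx)] at hv
    exact hf.mfderiv_eq_zero x hx v (hg.mfderiv_eq_zero _ (h hx) _ hv)

theorem mono {f : X₁ → X₂} {O O' : Set X₁} (h : IsEmb I₁ I₂ f O) (hO' : IsOpen O') (hs : O' ⊆ O) :
    IsEmb I₁ I₂ f O' :=
  ⟨hO', h.contMDiffOn.mono hs, h.injOn.mono hs, fun x hx => h.mfderiv_eq_zero x (hs hx)⟩

theorem prodMap {f : X₁ → X₂} {g : X₃ → X₄} {O : Set X₁} {O' : Set X₃} (hf : IsEmb I₁ I₂ f O)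
    (hg : IsEmb I₃ I₄ g O') :
    IsEmb (I₁.prod I₃) (I₂.prod I₄) (Prod.map f g) (O ×ˢ O') where
  isOpen := hf.isOpen.prod hg.isOpen
  contMDiffOn := hf.contMDiffOn.prodMap hg.contMDiffOn
  injOn := by
    rintro ⟨x, y⟩ h ⟨x', y'⟩ h' e
    simp only [Prod.map_apply, Prod.mk.injEq] at e
    exact Prod.ext (hf.injOn h.1 h'.1 e.1) (hg.injOn h.2 h'.2 e.2)
  mfderiv_eq_zero p hp v hv := by
    rw [mfderiv_prodMap (hf.mdifferentiableAt hp.1) (hg.mdifferentiableAt hp.2)] at hv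
    have hv1 := congrArg Prod.fst hv
    have hv2 := congrArg Prod.snd hv
    exact Prod.ext (hf.mfderiv_eq_zero _ hp.1 _ hv1) (hg.mfderiv_eq_zero _ hp.2 _ hv2)

theorem id : IsEmb I₁ I₁ (id : X₁ → X₁) univ :=
  ⟨isOpen_univ, contMDiff_id.contMDiffOn, injOn_id _, fun x _ v hv => by
    rw [mfderiv_id] at hv; exact hv⟩

end IsEmb

theorem mfderiv_leftInverse {f : X₁ → X₂} {g : X₂ → X₁} {O : Set X₁} (hO : IsOpen O) {x : X₁}
    (hx : x ∈ O) (h : ∀ y ∈ O, g (f y) = y) (hf : MDifferentiableAt I₁ I₂ f x)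
    (hg : MDifferentiableAt I₂ I₁ g (f x)) (v : TangentSpace I₁ x) :
    mfderiv I₂ I₁ g (f x) (mfderiv I₁ I₂ f x v) = v := by
  have h1 : g ∘ f =ᶠ[nhds x] _root_.id := Filter.eventuallyEq_of_mem (hO.mem_nhds hx) h
  have h2 := h1.mfderiv_eq (I := I₁) (I' := I₁)
  rw [mfderiv_comp x hg hf, mfderiv_id] at h2
  exact congrArg (fun L : E₁ →L[ℝ] E₁ => L v) h2

/-- A `C¹` left inverse forces injectivity of the map, and of its differential by the chain rule. -/
theorem isEmb_of_leftInverse {f : X₁ → X₂} {g : X₂ → X₁} {O : Set X₁} {O' : Set X₂}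
    (hO : IsOpen O) (hO' : IsOpen O') (hf : ContMDiffOn I₁ I₂ 1 f O)
    (hg : ContMDiffOn I₂ I₁ 1 g O') (hm : MapsTo f O O') (h : ∀ y ∈ O, g (f y) = y) :
    IsEmb I₁ I₂ f O := by
  refine ⟨hO, hf, fun x hx y hy e => by rw [← h x hx, e, h y hy], fun x hx v hv => ?_⟩
  have := mfderiv_leftInverse hO hx h ((hf.contMDiffAt (hO.mem_nhds hx)).mdifferentiableAt
    one_ne_zero) ((hg.contMDiffAt (hO'.mem_nhds (hm hx))).mdifferentiableAt one_ne_zero) v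
  rw [hv, map_zero] at this
  exact this.symm

theorem isEmb_partialDiffeomorph (Φ : PartialDiffeomorph I₁ I₂ X₁ X₂ ∞) :
    IsEmb I₁ I₂ Φ Φ.source :=
  isEmb_of_leftInverse Φ.open_source Φ.open_target
    (Φ.contMDiffOn_toFun.of_le (by exact_mod_cast le_top))
    (Φ.contMDiffOn_invFun.of_le (by exact_mod_cast le_top)) (fun _ hx => Φ.map_source hx)
    fun _ hx => Φ.left_inv hx

end Emb

/-! ### Pullbacks of metrics by parametrizations -/

section Param

variable {n : ℕ} {M : Mfd.{u} n}
  {E : Type*} [NormedAddCommGroup E] [NormedSpace ℝ E]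

theorem isEmb_chart_symm (c : M) : IsEmb (𝓡 n) (𝓡 n)
    (chartAt (EuclideanSpace ℝ (Fin n)) c).symm (chartAt (EuclideanSpace ℝ (Fin n)) c).target :=
  isEmb_of_leftInverse (chartAt _ c).open_target (chartAt _ c).open_source
    contMDiffOn_chart_symm contMDiffOn_chart
    (fun _ hx => (chartAt _ c).map_target hx) fun _ hx => (chartAt _ c).right_inv hx

theorem isEmb_chart (c : M) : IsEmb (𝓡 n) (𝓡 n)
    (chartAt (EuclideanSpace ℝ (Fin n)) c) (chartAt (EuclideanSpace ℝ (Fin n)) c).source :=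
  isEmb_of_leftInverse (chartAt _ c).open_source (chartAt _ c).open_target
    contMDiffOn_chart contMDiffOn_chart_symm
    (fun _ hx => (chartAt _ c).map_source hx) fun _ hx => (chartAt _ c).left_inv hx

/-- The pullback of the quadratic form of `g` by a parametrization `Ψ`. -/
def pq (g : Metric M) (Ψ : E → M) (x v : E) : ℝ :=
  quad g (Ψ x) (mfderiv 𝓘(ℝ, E) (𝓡 n) Ψ x v)

theorem isForm_pq (g : Metric M) (Ψ : E → M) (x : E) : IsForm (pq g Ψ x) := by
  let L : E →L[ℝ] TangentSpace (𝓡 n) (Ψ x) := mfderiv 𝓘(ℝ, E) (𝓡 n) Ψ x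
  exact isForm_quad g (Ψ x) L

theorem IsEmb.pq_pos {g : Metric M} {Ψ : E → M} {O : Set E} (h : IsEmb 𝓘(ℝ, E) (𝓡 n) Ψ O) {x : E}
    (hx : x ∈ O) {v : E} (hv : v ≠ 0) : 0 < pq g Ψ x v :=
  quad_pos g _ fun h' => hv (h.mfderiv_eq_zero x hx v h')

theorem IsEmb.continuousOn_tangent {Ψ : E → M} {O : Set E} (h : IsEmb 𝓘(ℝ, E) (𝓡 n) Ψ O) :
    ContinuousOn (fun p : E × E => (⟨Ψ p.1, mfderiv 𝓘(ℝ, E) (𝓡 n) Ψ p.1 p.2⟩ :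
      TangentBundle (𝓡 n) M)) (O ×ˢ univ) := by
  have h1 := h.contMDiffOn.continuousOn_tangentMapWithin le_rfl h.isOpen.uniqueMDiffOn
  have h2 : Continuous fun p : E × E => (tangentBundleModelSpaceHomeomorph 𝓘(ℝ, E)).symm p :=
    (tangentBundleModelSpaceHomeomorph 𝓘(ℝ, E)).symm.continuous
  refine (h1.comp h2.continuousOn (t := _) fun p hp => hp.1).congr fun p hp => ?_
  simp only [Function.comp_apply, tangentMapWithin]
  have : mfderivWithin 𝓘(ℝ, E) (𝓡 n) Ψ O p.1 = mfderiv 𝓘(ℝ, E) (𝓡 n) Ψ p.1 :=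
    mfderivWithin_of_isOpen h.isOpen hp.1
  exact congrArg (fun L : E →L[ℝ] EuclideanSpace ℝ (Fin n) =>
    (⟨Ψ p.1, L p.2⟩ : TangentBundle (𝓡 n) M)) this.symm

theorem IsEmb.continuousOn_pq (g : Metric M) {Ψ : E → M} {O : Set E}
    (h : IsEmb 𝓘(ℝ, E) (𝓡 n) Ψ O) :
    ContinuousOn (fun p : E × E => pq g Ψ p.1 p.2) (O ×ˢ univ) :=
  (continuous_quad g).comp_continuousOn h.continuousOn_tangent

theorem pq_comp (g : Metric M) {E' : Type*} [NormedAddCommGroup E'] [NormedSpace ℝ E']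
    {Ψ : E → M} {f : E' → E} {x : E'} {f' : E' →L[ℝ] E}
    (hΨ : MDifferentiableAt 𝓘(ℝ, E) (𝓡 n) Ψ (f x)) (hf : HasFDerivAt f f' x) (v : E') :
    pq g (Ψ ∘ f) x v = pq g Ψ (f x) (f' v) := by
  unfold pq
  rw [mfderiv_comp x hΨ hf.hasMFDerivAt.mdifferentiableAt, hf.hasMFDerivAt.mfderiv]
  rfl

/-- All tangent spaces are the same model space, so a vector needs no transport when the base point
is replaced by an equal one. -/
theorem quad_congr_point (g : Metric M) {x y : M} (h : x = y) (v : EuclideanSpace ℝ (Fin n)) :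
    quad g x v = quad g y v := by
  subst h; rfl

theorem pq_congr (g : Metric M) {Ψ Ψ' : E → M} {x : E} (h : Ψ =ᶠ[nhds x] Ψ') (v : E) :
    pq g Ψ x v = pq g Ψ' x v := by
  unfold pq
  rw [h.mfderiv_eq]
  exact quad_congr_point g h.eq_of_nhds _

theorem measurableSet_inter_preimage {X X' : Type*} [TopologicalSpace X] [MeasurableSpace X]
    [OpensMeasurableSpace X] [TopologicalSpace X'] [MeasurableSpace X'] [BorelSpace X'] {f : X → X'}
    {s : Set X} (hf : ContinuousOn f s) (hs : MeasurableSet s) {t : Set X'} (ht : MeasurableSet t) :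
    MeasurableSet (s ∩ f ⁻¹' t) := by
  have h1 := hs.subtype_image (hf.domRestrict.measurable ht)
  convert h1 using 1
  ext x; simp [and_comm]

variable [MeasurableSpace E] [BorelSpace E] [FiniteDimensional ℝ E]

/-- Up to inversion, the density is the measure of the section over `x` of the measurable set `{Q <
1}` in `X × E`, which is measurable in `x` as in Tonelli's theorem. -/
theorem measurable_dens {X : Type*} [TopologicalSpace X] [MeasurableSpace X]
    [BorelSpace X] [SecondCountableTopology X] (μ : Measure E) [SFinite μ] {Q : X → E → ℝ}
    {O : Set X} (hO : MeasurableSet O)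
    (hQ : ContinuousOn (fun p : X × E => Q p.1 p.2) (O ×ˢ univ)) :
    Measurable (O.indicator fun x => dens μ (Q x)) := by
  have h1 : MeasurableSet ((O ×ˢ univ) ∩ {p : X × E | Q p.1 p.2 < 1}) :=
    measurableSet_inter_preimage hQ (hO.prod MeasurableSet.univ) measurableSet_Iio
  have h2 := (measurable_measure_prodMk_left (ν := μ) h1).inv.indicator hO
  convert h2 using 1
  ext x
  by_cases hx : x ∈ O
  · simp only [hx, indicator_of_mem, dens, Pi.inv_apply]
    congr 2; ext v; simp [hx]
  · simp [hx]

theorem aemeasurable_dens {X : Type*} [TopologicalSpace X] [MeasurableSpace X]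
    [BorelSpace X] [SecondCountableTopology X] (ν : Measure X) (μ : Measure E) [SFinite μ]
    {Q : X → E → ℝ} {O : Set X} (hO : MeasurableSet O)
    (hQ : ContinuousOn (fun p : X × E => Q p.1 p.2) (O ×ˢ univ)) :
    AEMeasurable (fun x => dens μ (Q x)) (ν.restrict O) :=
  (aemeasurable_indicator_iff hO).1 (measurable_dens μ hO hQ).aemeasurable

end Param

/-! ### The Riemannian volume in parametrizations -/

section Volume

open Module

variable {n : ℕ} {M : Mfd.{u} n}

/-- The centers of the charts that are used to define the volume. -/
def center (M : Mfd.{u} n) : ℕ → M := (exists_chart_cover M).choose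

/-- The inverse charts that are used to define the volume. -/
def param (M : Mfd.{u} n) (i : ℕ) : EuclideanSpace ℝ (Fin n) → M :=
  (chartAt (EuclideanSpace ℝ (Fin n)) (center M i)).symm

/-- The domains of the maps `param M i`. -/
def paramDom (M : Mfd.{u} n) (i : ℕ) : Set (EuclideanSpace ℝ (Fin n)) :=
  (chartAt (EuclideanSpace ℝ (Fin n)) (center M i)).target

/-- The disjoint pieces of `M` that are used to define the volume. -/
def piece (M : Mfd.{u} n) (i : ℕ) : Set M :=
  disjointed (fun i => (chartAt (EuclideanSpace ℝ (Fin n)) (center M i)).source) i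

theorem isEmb_param (M : Mfd.{u} n) (i : ℕ) : IsEmb (𝓡 n) (𝓡 n) (param M i) (paramDom M i) :=
  isEmb_chart_symm _

theorem measurableSet_piece (M : Mfd.{u} n) (i : ℕ) : MeasurableSet (piece M i) :=
  MeasurableSet.disjointed (fun i => (chartAt _ (center M i)).open_source.measurableSet) i

theorem disjoint_piece (M : Mfd.{u} n) : Pairwise (Function.onFun Disjoint (piece M)) :=
  disjoint_disjointed _

theorem iUnion_piece (M : Mfd.{u} n) : ⋃ i, piece M i = univ := by
  unfold piece
  rw [iUnion_disjointed]
  exact (exists_chart_cover M).choose_spec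

theorem piece_subset (M : Mfd.{u} n) (i : ℕ) :
    piece M i ⊆ (chartAt (EuclideanSpace ℝ (Fin n)) (center M i)).source :=
  disjointed_subset _ i

/-- The points of the chart domain that parametrize the piece. -/
def paramPiece (M : Mfd.{u} n) (i : ℕ) : Set (EuclideanSpace ℝ (Fin n)) :=
  paramDom M i ∩ param M i ⁻¹' piece M i

theorem measurableSet_paramPiece (M : Mfd.{u} n) (i : ℕ) : MeasurableSet (paramPiece M i) :=
  measurableSet_inter_preimage (isEmb_param M i).contMDiffOn.continuousOn
    (isEmb_param M i).isOpen.measurableSet (measurableSet_piece M i)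

theorem image_paramPiece (M : Mfd.{u} n) (i : ℕ) : param M i '' paramPiece M i = piece M i := by
  ext y
  refine ⟨?_, fun hy => ?_⟩
  · rintro ⟨x, hx, rfl⟩; exact hx.2
  · have hy' := piece_subset M i hy
    have h1 : param M i (chartAt (EuclideanSpace ℝ (Fin n)) (center M i) y) = y :=
      (chartAt _ (center M i)).left_inv hy'
    exact ⟨_, ⟨(chartAt _ (center M i)).map_source hy', by rw [mem_preimage, h1]; exact hy⟩, h1⟩

/-- The volume of the unit ball. -/
def ballVol (n : ℕ) : ℝ≥0∞ := volume (Metric.ball (0 : EuclideanSpace ℝ (Fin n)) 1)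

theorem ballVol_pos (n : ℕ) : ballVol n ≠ 0 := (Metric.measure_ball_pos volume _ one_pos).ne'

theorem ballVol_ne_top (n : ℕ) : ballVol n ≠ ⊤ := measure_ball_lt_top.ne

/-- The bridge from the Gram determinant in the definition of the volume to `dens`, which replaces
it in all later computations. -/
theorem ofReal_chartDensity (g : Metric M) (c : M) {x : EuclideanSpace ℝ (Fin n)}
    (hx : x ∈ (chartAt (EuclideanSpace ℝ (Fin n)) c).target) :
    ENNReal.ofReal (chartDensity g c x) =
      ballVol n * dens volume (pq g (chartAt (EuclideanSpace ℝ (Fin n)) c).symm x) := by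
  let φ := chartAt (EuclideanSpace ℝ (Fin n)) c
  let L : EuclideanSpace ℝ (Fin n) →L[ℝ] EuclideanSpace ℝ (Fin n) :=
    mfderiv (𝓡 n) (𝓡 n) φ.symm x
  let B : EuclideanSpace ℝ (Fin n) →L[ℝ] EuclideanSpace ℝ (Fin n) →L[ℝ] ℝ := g.inner (φ.symm x)
  let G : Matrix (Fin n) (Fin n) ℝ := Matrix.of fun i j =>
    B (L (EuclideanSpace.single i 1)) (L (EuclideanSpace.single j 1))
  have hQ : ∀ v, pq g φ.symm x v = ∑ i, ∑ j, v i * v j * G i j := by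
    intro v
    have hv : v = ∑ i, v i • EuclideanSpace.single i (1 : ℝ) := by
      ext j; simp [Finset.sum_apply, Pi.single_apply]
    have h1 : pq g φ.symm x v = B (L v) (L v) := rfl
    rw [h1]
    conv_lhs => rw [hv]
    simp only [map_sum, map_smul, FunLike.coe_sum, Finset.sum_apply, smul_apply,
      smul_eq_mul, G, Matrix.of_apply, Finset.mul_sum]
    rw [Finset.sum_comm]
    exact Finset.sum_congr rfl fun i _ => Finset.sum_congr rfl fun j _ => by ring
  have hG : G.PosDef := by
    refine Matrix.PosDef.of_dotProduct_mulVec_pos ?_ fun v hv => ?_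
    · ext i j
      simp only [G, Matrix.conjTranspose_apply, Matrix.of_apply, star_trivial]
      exact g.symm (φ.symm x) _ _
    · have h1 := hQ (WithLp.toLp 2 v)
      have h2 := (isEmb_chart_symm c).pq_pos (g := g) hx (v := WithLp.toLp 2 v) (by
        intro h; apply hv; simpa using h)
      change 0 < pq g φ.symm x _ at h2
      rw [h1] at h2
      simp only [dotProduct, Matrix.mulVec, Finset.mul_sum, star_trivial]
      refine h2.trans_eq (Finset.sum_congr rfl fun i _ => Finset.sum_congr rfl fun j _ => ?_)
      ring
  exact sqrt_det_eq_dens hG hQ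

theorem lintegral_vol (g : Metric M) {f : M → ℝ≥0∞} (hf : Measurable f) :
    ∫⁻ y, f y ∂vol g = ballVol n * ∑' i, ∫⁻ x in paramPiece M i,
      f (param M i x) * dens volume (pq g (param M i) x) := by
  have hvol : vol g = Measure.sum fun i => (chartVolume g (center M i)).restrict (piece M i) := rfl
  rw [hvol, lintegral_sum_measure, ← ENNReal.tsum_mul_left]
  congr 1; ext i
  have hcont := (isEmb_param M i).contMDiffOn.continuousOn
  have hm : MeasurableSet (paramDom M i) := (isEmb_param M i).isOpen.measurableSet
  have hdm : AEMeasurable (fun x => ENNReal.ofReal (chartDensity g (center M i) x))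
      (volume.restrict (paramDom M i)) := by
    have h1 := (aemeasurable_dens volume volume hm
      (IsEmb.continuousOn_pq g (isEmb_param M i))).const_mul (ballVol n)
    refine h1.congr ?_
    filter_upwards [ae_restrict_mem hm] with x hx
    exact (ofReal_chartDensity g (center M i) hx).symm
  have hpm : AEMeasurable (param M i) (volume.restrict (paramDom M i)) :=
    hcont.aemeasurable hm
  have hf' : Measurable ((piece M i).indicator f) := hf.indicator (measurableSet_piece M i)
  rw [← lintegral_indicator (measurableSet_piece M i)]
  have e1 : chartVolume g (center M i) = ((volume.restrict (paramDom M i)).withDensity fun x =>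
    ENNReal.ofReal (chartDensity g (center M i) x)).map (param M i) := rfl
  have hfm : AEMeasurable (fun x => (piece M i).indicator f (param M i x))
      (volume.restrict (paramDom M i)) := hf'.comp_aemeasurable hpm
  rw [e1, lintegral_map' hf'.aemeasurable (hpm.mono_ac (withDensity_absolutelyContinuous _ _)),
    lintegral_withDensity_eq_lintegral_mul₀ hdm hfm,
    ← lintegral_const_mul' _ _ (ballVol_ne_top n), ← lintegral_indicator hm,
    ← lintegral_indicator (measurableSet_paramPiece M i)]
  congr 1; ext x
  by_cases hx : x ∈ paramDom M i
  · by_cases hx' : param M i x ∈ piece M i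
    · rw [indicator_of_mem hx, indicator_of_mem (show x ∈ paramPiece M i from ⟨hx, hx'⟩),
        Pi.mul_apply, indicator_of_mem hx', ofReal_chartDensity g _ hx]
      change ballVol n * dens volume (pq g (param M i) x) * _ = _
      ring
    · rw [indicator_of_mem hx, indicator_of_notMem (show x ∉ paramPiece M i from fun h => hx' h.2),
        Pi.mul_apply, indicator_of_notMem hx', mul_zero]
  · rw [indicator_of_notMem hx, indicator_of_notMem (show x ∉ paramPiece M i from fun h => hx h.1)]

/-- The volume in a parametrization by an open set of `ℝⁿ`. -/
theorem setLIntegral_vol_image_euclidean (g : Metric M) {Ψ : EuclideanSpace ℝ (Fin n) → M}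
    {O B : Set (EuclideanSpace ℝ (Fin n))} (hΨ : IsEmb (𝓡 n) (𝓡 n) Ψ O) (hBO : B ⊆ O)
    (hB : MeasurableSet B) {f : M → ℝ≥0∞} (hf : Measurable f) :
    ∫⁻ y in Ψ '' B, f y ∂vol g = ballVol n * ∫⁻ x in B, f (Ψ x) * dens volume (pq g Ψ x) := by
  have hcont : ContinuousOn Ψ B := hΨ.contMDiffOn.continuousOn.mono hBO
  have hΨB : MeasurableSet (Ψ '' B) := hB.image_of_continuousOn_injOn hcont (hΨ.injOn.mono hBO)
  rw [← lintegral_indicator hΨB, lintegral_vol g (hf.indicator hΨB)]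
  congr 1
  -- `B` is cut according to the piece of `M` in which `Ψ` lands. On each part `T = φ ∘ Ψ` is a
  -- change of coordinates between open sets of `ℝⁿ`.
  let Bi : ℕ → Set (EuclideanSpace ℝ (Fin n)) := fun i => B ∩ Ψ ⁻¹' piece M i
  have hBi : ∀ i, MeasurableSet (Bi i) := fun i =>
    measurableSet_inter_preimage hcont hB (measurableSet_piece M i)
  have hU : B = ⋃ i, Bi i := by
    rw [← inter_iUnion, ← preimage_iUnion, iUnion_piece, preimage_univ, inter_univ]
  have hD : Pairwise (Function.onFun Disjoint Bi) := fun i j hij =>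
    ((disjoint_piece M hij).preimage Ψ).mono inter_subset_right inter_subset_right
  conv_rhs => rw [hU, lintegral_iUnion hBi hD]
  congr 1; ext i
  let φ := chartAt (EuclideanSpace ℝ (Fin n)) (center M i)
  let T : EuclideanSpace ℝ (Fin n) → EuclideanSpace ℝ (Fin n) := φ ∘ Ψ
  have hT : IsEmb (𝓡 n) (𝓡 n) T (O ∩ Ψ ⁻¹' φ.source) :=
    (isEmb_chart (center M i)).comp (hΨ.mono
      (hΨ.contMDiffOn.continuousOn.isOpen_inter_preimage hΨ.isOpen φ.open_source) inter_subset_left)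
      fun x hx => hx.2
  have hBT : Bi i ⊆ O ∩ Ψ ⁻¹' φ.source := fun x hx => ⟨hBO hx.1, piece_subset M i hx.2⟩
  let T' : EuclideanSpace ℝ (Fin n) → EuclideanSpace ℝ (Fin n) →L[ℝ] EuclideanSpace ℝ (Fin n) :=
    fun x => fderiv ℝ T x
  have hTd : ∀ x ∈ Bi i, HasFDerivAt T (T' x) x := fun x hx =>
    (mdifferentiableAt_iff_differentiableAt.1 (hT.mdifferentiableAt (hBT hx))).hasFDerivAt
  have hΨT : ∀ x ∈ Bi i, param M i (T x) = Ψ x := fun x hx => φ.left_inv (hBT hx).2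
  have key := lintegral_image_eq_lintegral_abs_det_fderiv_mul volume (hBi i)
    (fun x hx => (hTd x hx).hasFDerivWithinAt) (hT.injOn.mono hBT)
    (fun x => f (param M i x) * dens volume (pq g (param M i) x))
  have hTB : MeasurableSet (T '' Bi i) := (hBi i).image_of_continuousOn_injOn
    (hT.contMDiffOn.continuousOn.mono hBT) (hT.injOn.mono hBT)
  have e1 : ∫⁻ x in paramPiece M i, (Ψ '' B).indicator f (param M i x) *
        dens volume (pq g (param M i) x) =
      ∫⁻ x in T '' Bi i, f (param M i x) * dens volume (pq g (param M i) x) := by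
    rw [← lintegral_indicator (measurableSet_paramPiece M i), ← lintegral_indicator hTB]
    congr 1; ext x
    by_cases hx : x ∈ T '' Bi i
    · obtain ⟨x', hx', rfl⟩ := hx
      have h1 : T x' ∈ paramPiece M i := ⟨φ.map_source (hBT hx').2, by
        rw [mem_preimage, hΨT x' hx']; exact hx'.2⟩
      rw [indicator_of_mem h1, indicator_of_mem (mem_image_of_mem T hx'), indicator_of_mem]
      rw [hΨT x' hx']; exact mem_image_of_mem _ hx'.1
    · rw [indicator_of_notMem hx]
      by_cases hx1 : x ∈ paramPiece M i
      · rw [indicator_of_mem hx1, indicator_of_notMem, zero_mul]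
        rintro ⟨x', hx', e⟩
        apply hx
        refine ⟨x', ⟨hx', ?_⟩, ?_⟩
        · rw [mem_preimage, e]; exact hx1.2
        · change φ (Ψ x') = x
          rw [e]; exact φ.right_inv hx1.1
      · rw [indicator_of_notMem hx1]
  rw [e1, key]
  refine setLIntegral_congr_fun (hBi i) fun x hx => ?_
  rw [hΨT x hx, mul_left_comm]
  congr 1
  have hTx : T x ∈ paramDom M i := φ.map_source (hBT hx).2
  -- The Jacobian of `T` is exactly the factor by which `dens` changes under pullback, so the change
  -- of variables formula turns the density of `param M i` into that of `Ψ`.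
  have hdet : (T' x).det ≠ 0 := by
    have hinj : Function.Injective ((T' x : EuclideanSpace ℝ (Fin n) →L[ℝ] _) :
        EuclideanSpace ℝ (Fin n) →ₗ[ℝ] EuclideanSpace ℝ (Fin n)) := by
      rw [← LinearMap.ker_eq_bot, LinearMap.ker_eq_bot']
      intro v hv
      refine hT.mfderiv_eq_zero x (hBT hx) v ?_
      rw [mfderiv_eq_fderiv]; exact hv
    exact (LinearMap.isUnit_iff_isUnit_det _).1 ((LinearMap.isUnit_iff_ker_eq_bot _).2
      (LinearMap.ker_eq_bot.2 hinj)) |>.ne_zero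
  rw [← dens_comp volume _ hdet]
  congr 1; ext v
  have hev : param M i ∘ T =ᶠ[nhds x] Ψ := by
    filter_upwards [hT.isOpen.mem_nhds (hBT hx)] with y hy using φ.left_inv hy.2
  rw [← pq_comp g ((isEmb_param M i).mdifferentiableAt hTx) (hTd x hx) v]
  exact pq_congr g hev v

end Volume

/-! ### Volumes of images of subsets of `F × N` with `F` a vector space -/

section VolumeComparison

open Module

variable {n : ℕ} {M : Mfd.{u} n} {E : Type*} [NormedAddCommGroup E] [NormedSpace ℝ E]
  [MeasurableSpace E] [BorelSpace E] [FiniteDimensional ℝ E]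

/-- The volume in a parametrization by an open set of a vector space. -/
theorem setLIntegral_vol_image (g : Metric M) (μ : Measure E) [μ.IsAddHaarMeasure]
    (hE : finrank ℝ E = n) {Ψ : E → M} {O B : Set E} (hΨ : IsEmb 𝓘(ℝ, E) (𝓡 n) Ψ O)
    (hBO : B ⊆ O) (hB : MeasurableSet B) {f : M → ℝ≥0∞} (hf : Measurable f) :
    ∫⁻ y in Ψ '' B, f y ∂vol g = ballVol n * ∫⁻ x in B, f (Ψ x) * dens μ (pq g Ψ x) ∂μ := by
  let L : EuclideanSpace ℝ (Fin n) ≃L[ℝ] E :=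
    ContinuousLinearEquiv.ofFinrankEq (by rw [hE]; simp)
  let Lm : EuclideanSpace ℝ (Fin n) ≃ᵐ E := L.toHomeomorph.toMeasurableEquiv
  have hLemb : IsEmb (𝓡 n) 𝓘(ℝ, E) L (L ⁻¹' O) := by
    refine isEmb_of_leftInverse (g := L.symm) (O' := univ) (hΨ.isOpen.preimage L.continuous)
      isOpen_univ ?_ ?_ (fun _ _ => mem_univ _) fun y _ => L.symm_apply_apply y
    · exact L.contDiff.contMDiff.contMDiffOn
    · exact L.symm.contDiff.contMDiff.contMDiffOn
  have h1 := setLIntegral_vol_image_euclidean g (hΨ.comp hLemb fun x hx => hx)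
    (preimage_mono hBO : L ⁻¹' B ⊆ _) (hB.preimage L.continuous.measurable) hf
  have h2 : (Ψ ∘ L) '' (L ⁻¹' B) = Ψ '' B := by
    rw [image_comp, image_preimage_eq _ L.surjective]
  rw [h2] at h1
  rw [h1]
  congr 1
  -- By uniqueness of Haar measure, `μ` and the transported Lebesgue measure differ by a constant
  -- `c`. It enters the integral as `c` and the density as `c⁻¹`, and cancels.
  obtain ⟨c, hc0, hc, hcμ⟩ : ∃ c : ℝ≥0∞, c ≠ 0 ∧ c ≠ ⊤ ∧ Measure.map Lm volume = c • μ := by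
    have : (Measure.map Lm volume).IsAddHaarMeasure := L.isAddHaarMeasure_map volume
    exact ⟨_, by simpa using (Measure.addHaarScalarFactor_pos_of_isAddHaarMeasure
      (Measure.map Lm volume) μ).ne', ENNReal.coe_ne_top,
      Measure.isAddLeftInvariant_eq_smul (Measure.map Lm volume) μ⟩
  have h3 : ∀ x ∈ L ⁻¹' B, dens volume (pq g (Ψ ∘ L) x) = c⁻¹ * dens μ (pq g Ψ (L x)) := by
    intro x hx
    have hv : ∀ v, pq g (Ψ ∘ L) x v = pq g Ψ (L x) (L v) := fun v =>
      pq_comp g (hΨ.mdifferentiableAt (hBO hx)) L.hasFDerivAt v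
    unfold dens
    rw [← ENNReal.mul_inv (Or.inl hc0) (Or.inl hc), ← smul_eq_mul, ← Measure.smul_apply, ← hcμ,
      Lm.map_apply]
    congr 2
    ext v
    simp only [mem_ofPred_eq, hv, mem_preimage]
    rfl
  rw [setLIntegral_congr_fun (hB.preimage L.continuous.measurable)
    (fun x hx => congrArg (fun z => f ((Ψ ∘ L) x) * z) (h3 x hx))]
  have h4 : ∫⁻ x in L ⁻¹' B, f ((Ψ ∘ L) x) * (c⁻¹ * dens μ (pq g Ψ (L x))) =
      ∫⁻ x in B, f (Ψ x) * (c⁻¹ * dens μ (pq g Ψ x)) ∂Measure.map Lm volume := by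
    rw [Lm.restrict_map, lintegral_map_equiv]
    rfl
  rw [h4, hcμ, Measure.restrict_smul, lintegral_smul_measure, smul_eq_mul,
    ← lintegral_const_mul' _ _ hc]
  refine lintegral_congr fun x => ?_
  rw [mul_left_comm, ← mul_assoc c, ENNReal.mul_inv_cancel hc0 hc, one_mul]

variable {F : Type*} [NormedAddCommGroup F] [NormedSpace ℝ F] [MeasurableSpace F] [BorelSpace F]
  [FiniteDimensional ℝ F] {d : ℕ} {N : Mfd.{u} d}

/-- The pieces of a set `B ⊆ F × N` in the parametrizations of `N`. -/
def slicePiece (N : Mfd.{u} d) (B : Set (F × N)) (i : ℕ) : Set (F × EuclideanSpace ℝ (Fin d)) :=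
  (univ ×ˢ paramDom N i) ∩ Prod.map id (param N i) ⁻¹' (B ∩ univ ×ˢ piece N i)

theorem measurableSet_slicePiece {B : Set (F × N)} (hB : MeasurableSet B) (i : ℕ) :
    MeasurableSet (slicePiece N B i) := by
  refine measurableSet_inter_preimage ?_
    (MeasurableSet.univ.prod (isEmb_param N i).isOpen.measurableSet)
    (hB.inter (MeasurableSet.univ.prod (measurableSet_piece N i)))
  exact (continuousOn_id.prodMap (isEmb_param N i).contMDiffOn.continuousOn)

/-- The integrand on the `i`-th parametrization in the formula for the volume of the image of a
subset `B` of `F × N` under `Ψ`. -/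
def sliceFun (g : Metric M) (μ : Measure F) (Ψ : F × N → M) (B : Set (F × N)) (f : M → ℝ≥0∞)
    (i : ℕ) : F × EuclideanSpace ℝ (Fin d) → ℝ≥0∞ :=
  (slicePiece N B i).indicator fun p => f (Ψ (p.1, param N i p.2)) *
    dens (μ.prod volume) (pq g (Ψ ∘ Prod.map id (param N i)) p)

theorem image_slicePiece (Ψ : F × N → M) (B : Set (F × N)) (i : ℕ) :
    (Ψ ∘ Prod.map id (param N i)) '' slicePiece N B i = Ψ '' (B ∩ univ ×ˢ piece N i) := by
  rw [image_comp]
  congr 1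
  ext ⟨x, y⟩
  constructor
  · rintro ⟨p, hp, e⟩
    rw [← e]; exact hp.2
  · rintro ⟨h1, -, h2⟩
    rw [← image_paramPiece] at h2
    obtain ⟨w, hw, e⟩ := h2
    simp only at e
    subst e
    exact ⟨(x, w), ⟨⟨mem_univ _, hw.1⟩, h1, mem_univ _, hw.2⟩, rfl⟩

theorem isEmb_comp_prodMap_param {Ψ : F × N → M} {O : Set (F × N)}
    (hΨ : IsEmb (𝓘(ℝ, F).prod (𝓡 d)) (𝓡 n) Ψ O) (i : ℕ) :
    IsEmb 𝓘(ℝ, F × EuclideanSpace ℝ (Fin d)) (𝓡 n) (Ψ ∘ Prod.map id (param N i))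
      ((univ ×ˢ paramDom N i) ∩ Prod.map id (param N i) ⁻¹' O) := by
  have hid : IsEmb (𝓘(ℝ, F).prod (𝓡 d)) (𝓘(ℝ, F).prod (𝓡 d))
      (Prod.map (id : F → F) (param N i)) (univ ×ˢ paramDom N i) := IsEmb.id.prodMap (isEmb_param N i)
  have h1 := hΨ.comp (hid.mono (hid.contMDiffOn.continuousOn.isOpen_inter_preimage
    hid.isOpen hΨ.isOpen) inter_subset_left) (fun x hx => hx.2)
  -- The source is now regarded as the vector space `F × ℝ^d` instead of a product of manifolds, so
  -- that integration over open sets of a vector space applies.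
  rw [← modelWithCornersSelf_prod, chartedSpaceSelf_prod] at h1
  exact h1

theorem slicePiece_subset {O B : Set (F × N)} (hBO : B ⊆ O) (i : ℕ) :
    slicePiece N B i ⊆ (univ ×ˢ paramDom N i) ∩ Prod.map id (param N i) ⁻¹' O :=
  fun _ hx => ⟨hx.1, hBO hx.2.1⟩

theorem iUnion_inter_piece (B : Set (F × N)) : ⋃ i, B ∩ univ ×ˢ piece N i = B := by
  rw [← inter_iUnion, ← prod_iUnion, iUnion_piece, univ_prod_univ, inter_univ]

theorem measurableSet_image_inter_piece {Ψ : F × N → M} {O B : Set (F × N)}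
    (hΨ : IsEmb (𝓘(ℝ, F).prod (𝓡 d)) (𝓡 n) Ψ O) (hBO : B ⊆ O) (hB : MeasurableSet B) (i : ℕ) :
    MeasurableSet (Ψ '' (B ∩ univ ×ˢ piece N i)) := by
  rw [← image_slicePiece]
  have h := isEmb_comp_prodMap_param hΨ i
  exact (measurableSet_slicePiece hB i).image_of_continuousOn_injOn
    (h.contMDiffOn.continuousOn.mono (slicePiece_subset hBO i))
    (h.injOn.mono (slicePiece_subset hBO i))

theorem measurableSet_image {Ψ : F × N → M} {O B : Set (F × N)}
    (hΨ : IsEmb (𝓘(ℝ, F).prod (𝓡 d)) (𝓡 n) Ψ O) (hBO : B ⊆ O) (hB : MeasurableSet B) :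
    MeasurableSet (Ψ '' B) := by
  rw [← iUnion_inter_piece B, image_iUnion]
  exact MeasurableSet.iUnion fun i => measurableSet_image_inter_piece hΨ hBO hB i

/-- The volume of the image of a subset of `F × N`, as a sum over the parametrizations of `N`. -/
theorem setLIntegral_vol_image_prod (g : Metric M) (μ : Measure F) [μ.IsAddHaarMeasure]
    (hn : finrank ℝ F + d = n) {Ψ : F × N → M} {O B : Set (F × N)}
    (hΨ : IsEmb (𝓘(ℝ, F).prod (𝓡 d)) (𝓡 n) Ψ O) (hBO : B ⊆ O) (hB : MeasurableSet B)
    {f : M → ℝ≥0∞} (hf : Measurable f) :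
    ∫⁻ y in Ψ '' B, f y ∂vol g =
      ballVol n * ∫⁻ x, (∑' i, ∫⁻ w, sliceFun g μ Ψ B f i (x, w)) ∂μ := by
  have hfin : finrank ℝ (F × EuclideanSpace ℝ (Fin d)) = n := by
    rw [finrank_prod, finrank_euclideanSpace_fin, hn]
  have hΨi := fun i => isEmb_comp_prodMap_param hΨ i
  have hsub := fun i => slicePiece_subset (N := N) hBO i
  have hdisj : Pairwise (Function.onFun Disjoint fun i => Ψ '' (B ∩ univ ×ˢ piece N i)) := by
    intro i j hij
    rw [Function.onFun, disjoint_left]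
    rintro _ ⟨p, hp, rfl⟩ ⟨q, hq, e⟩
    have := hΨ.injOn (hBO hq.1) (hBO hp.1) e
    subst this
    exact disjoint_left.1 (disjoint_piece N hij) hp.2.2 hq.2.2
  have haem : ∀ i, AEMeasurable (sliceFun g μ Ψ B f i) (μ.prod volume) := fun i => by
    refine (aemeasurable_indicator_iff (measurableSet_slicePiece hB i)).2 (AEMeasurable.mul ?_ ?_)
    · exact hf.comp_aemeasurable (((hΨi i).contMDiffOn.continuousOn.mono (hsub i)).aemeasurable
        (measurableSet_slicePiece hB i))
    · exact aemeasurable_dens _ _ (measurableSet_slicePiece hB i)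
        ((IsEmb.continuousOn_pq g (hΨi i)).mono (prod_mono (hsub i) Subset.rfl))
  rw [lintegral_tsum fun i => (haem i).lintegral_prod_right']
  conv_lhs => rw [← iUnion_inter_piece B, image_iUnion]
  rw [lintegral_iUnion (fun i => measurableSet_image_inter_piece hΨ hBO hB i) hdisj, ← ENNReal.tsum_mul_left]
  congr 1; ext i
  rw [← image_slicePiece, setLIntegral_vol_image g (μ.prod volume) hfin (hΨi i) (hsub i)
    (measurableSet_slicePiece hB i) hf, ← lintegral_prod _ (haem i),
    ← lintegral_indicator (measurableSet_slicePiece hB i)]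
  rfl

theorem mfderiv_comp_prodMap_param {Ψ : F × N → M} {O : Set (F × N)}
    (hΨ : IsEmb (𝓘(ℝ, F).prod (𝓡 d)) (𝓡 n) Ψ O) (g : Metric M) {i : ℕ} {x : F}
    {w : EuclideanSpace ℝ (Fin d)} (hw : w ∈ paramDom N i) (hO : (x, param N i w) ∈ O) (s : F)
    (v : EuclideanSpace ℝ (Fin d)) :
    pq g (Ψ ∘ Prod.map id (param N i)) (x, w) (s, v) =
      quad g (Ψ (x, param N i w)) (mfderiv (𝓘(ℝ, F).prod (𝓡 d)) (𝓡 n) Ψ (x, param N i w)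
        ((s, mfderiv (𝓡 d) (𝓡 d) (param N i) w v) : F × EuclideanSpace ℝ (Fin d))) := by
  have h1 : MDifferentiableAt (𝓘(ℝ, F).prod (𝓡 d)) (𝓘(ℝ, F).prod (𝓡 d))
      (Prod.map (id : F → F) (param N i)) (x, w) :=
    (IsEmb.id.prodMap (isEmb_param N i)).mdifferentiableAt ⟨mem_univ _, hw⟩
  have h2 : mfderiv (𝓘(ℝ, F).prod (𝓡 d)) (𝓡 n) (Ψ ∘ Prod.map id (param N i)) (x, w) =
      (mfderiv (𝓘(ℝ, F).prod (𝓡 d)) (𝓡 n) Ψ (x, param N i w)).comp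
        (mfderiv (𝓘(ℝ, F).prod (𝓡 d)) (𝓘(ℝ, F).prod (𝓡 d))
          (Prod.map (id : F → F) (param N i)) (x, w)) :=
    mfderiv_comp (x, w) (hΨ.mdifferentiableAt (x := (x, param N i w)) hO) h1
  rw [mfderiv_prodMap (p := (x, w)) mdifferentiableAt_id ((isEmb_param N i).mdifferentiableAt hw),
    mfderiv_id, ← modelWithCornersSelf_prod, chartedSpaceSelf_prod] at h2
  unfold pq
  rw [h2, ← modelWithCornersSelf_prod]
  rfl

variable {P : F → F → ℝ} {lam : F → ℝ} {h : F → Metric N} {C : ℝ} {B : Set (F × N)}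
  {Ψ : F × N → M} {f : M → ℝ≥0∞}

/-- The slice integrals over `N` are written in the same coordinates as `sliceFun`, so that the two
integrands can be compared pointwise. -/
theorem lintegral_section_eq (hB : MeasurableSet B) (hΨ : ContinuousOn Ψ B) (hf : Measurable f)
    (x : F) : ∫⁻ y, B.indicator (fun p => f (Ψ p)) (x, y) ∂vol (h x) =
      ballVol d * ∑' i, ∫⁻ w, (slicePiece N B i).indicator (fun p => f (Ψ (p.1, param N i p.2)) *
        dens volume (pq (h p.1) (param N i) p.2)) (x, w) := by
  have hm : Measurable (B.indicator fun p => f (Ψ p)) := by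
    classical
    -- `Ψ` is controlled only on `B`; outside it is replaced by a constant, which the indicator
    -- makes irrelevant.
    have h1 : Measurable (B.piecewise Ψ fun _ => Classical.arbitrary M) :=
      hΨ.measurable_piecewise continuousOn_const hB
    convert (hf.comp h1).indicator hB using 1
    ext p
    by_cases hp : p ∈ B <;> simp [hp]
  have hm' : Measurable fun y => B.indicator (fun p => f (Ψ p)) (x, y) :=
    hm.comp measurable_prodMk_left
  rw [lintegral_vol (h x) hm']
  congr 2; ext i
  rw [← lintegral_indicator (measurableSet_paramPiece N i)]
  congr 1; ext w
  by_cases hw : w ∈ paramPiece N i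
  · rw [indicator_of_mem hw]
    by_cases hb : (x, param N i w) ∈ B
    · rw [indicator_of_mem hb, indicator_of_mem]
      exact ⟨⟨mem_univ _, hw.1⟩, hb, mem_univ _, hw.2⟩
    · rw [indicator_of_notMem hb, indicator_of_notMem, zero_mul]
      exact fun h => hb h.2.1
  · rw [indicator_of_notMem hw, indicator_of_notMem]
    exact fun h => hw ⟨h.1.2, h.2.2.2⟩

theorem IsForm.prod {P : F → ℝ} (hP : IsForm P) {Q : E → ℝ} (hQ : IsForm Q) :
    IsForm fun p : F × E => P p.1 + Q p.2 :=
  ⟨(hP.cont.comp continuous_fst).add (hQ.cont.comp continuous_snd),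
    fun v => add_nonneg (hP.nonneg _) (hQ.nonneg _), fun c v => by
      simp only [Prod.smul_fst, Prod.smul_snd, hP.smul, hQ.smul]; ring⟩

/-- Integrals over the image of a product set, from a bound for the pulled back metric. -/
theorem setLIntegral_image_le (g : Metric M) (μ : Measure F) [μ.IsAddHaarMeasure]
    (hn : finrank ℝ F + d = n) {O : Set (F × N)}
    (hΨ : IsEmb (𝓘(ℝ, F).prod (𝓡 d)) (𝓡 n) Ψ O) (hBO : B ⊆ O) (hB : MeasurableSet B)
    (hf : Measurable f) (hP : ∀ x, IsForm (P x)) (hC : 0 < C) (hlam : ∀ p ∈ B, 0 < lam p.1)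
    (hq : ∀ p ∈ B, ∀ (s : F) (v : TangentSpace (𝓡 d) p.2),
      quad g (Ψ p) (mfderiv (𝓘(ℝ, F).prod (𝓡 d)) (𝓡 n) Ψ p
        ((s, v) : F × EuclideanSpace ℝ (Fin d))) ≤
      C ^ 2 * (P p.1 s + lam p.1 ^ 2 * quad (h p.1) p.2 v)) :
    ∫⁻ y in Ψ '' B, f y ∂vol g ≤
      (ballVol n * (ballVol d)⁻¹ * (ENNReal.ofReal C ^ n * ENNReal.ofReal √2 ^ n)) *
      ∫⁻ x, dens μ (P x) * ENNReal.ofReal (lam x) ^ d *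
        ∫⁻ y, B.indicator (fun p => f (Ψ p)) (x, y) ∂vol (h x) ∂μ := by
  have hcont := hΨ.contMDiffOn.continuousOn.mono hBO
  set K := ENNReal.ofReal C ^ n * ENNReal.ofReal √2 ^ n with hK
  have hKt : K ≠ ⊤ := ENNReal.mul_ne_top (by finiteness) (by finiteness)
  have hfin : finrank ℝ (F × EuclideanSpace ℝ (Fin d)) = n := by
    rw [finrank_prod, finrank_euclideanSpace_fin, hn]
  -- Pointwise comparison of densities: `C^n` comes from scaling the bounding form by `C²`, `√2^n`
  -- from splitting a sum of forms, and `lam^d` from scaling `h` by `lam²`.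
  have hpt : ∀ i x w, sliceFun g μ Ψ B f i (x, w) ≤
      (K * (dens μ (P x) * ENNReal.ofReal (lam x) ^ d)) * (slicePiece N B i).indicator
        (fun p => f (Ψ (p.1, param N i p.2)) * dens volume (pq (h p.1) (param N i) p.2)) (x, w) := by
    intro i x w
    unfold sliceFun
    by_cases hxw : (x, w) ∈ slicePiece N B i
    · rw [indicator_of_mem hxw, indicator_of_mem hxw]
      simp only
      rw [mul_left_comm]
      refine mul_le_mul_right ?_ _
      have hxB : (x, param N i w) ∈ B := hxw.2.1
      have hl := hlam _ hxB
      have hQ : IsForm (pq (h x) (param N i) w) := isForm_pq _ _ _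
      have hQ' := hQ.const_mul (sq_nonneg (lam x))
      calc dens (μ.prod volume) (pq g (Ψ ∘ Prod.map id (param N i)) (x, w))
          ≤ dens (μ.prod volume) (fun p => C ^ 2 *
            (P x p.1 + lam x ^ 2 * pq (h x) (param N i) w p.2)) := by
            refine dens_mono fun p => ?_
            rw [mfderiv_comp_prodMap_param hΨ g hxw.1.2 (hBO hxB)]
            exact hq _ hxB p.1 _
        _ ≤ ENNReal.ofReal C ^ n * (ENNReal.ofReal √2 ^ n *
              (dens μ (P x) * dens volume (fun v => lam x ^ 2 * pq (h x) (param N i) w v))) := by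
            rw [dens_const_mul (μ.prod volume) ((hP x).prod hQ') hC, hfin]
            refine mul_le_mul_right ?_ _
            refine (dens_prod_le μ volume (hP x) hQ').trans_eq ?_
            rw [finrank_euclideanSpace_fin, hn]
        _ = _ := by
            rw [dens_const_mul volume hQ hl, finrank_euclideanSpace_fin, hK]; ring
    · rw [indicator_of_notMem hxw]; exact zero_le
  rw [setLIntegral_vol_image_prod g μ hn hΨ hBO hB hf, mul_assoc (ballVol n * (ballVol d)⁻¹),
    mul_assoc (ballVol n)]
  refine mul_le_mul_right ?_ _
  -- Only finite constants are moved through the integrals, so no measurability in `x` is required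
  -- of `P`, `lam` or `h`.
  rw [← lintegral_const_mul' _ _ hKt, ← lintegral_const_mul' _ _
    (ENNReal.inv_ne_top.2 (ballVol_pos d))]
  refine lintegral_mono fun x => ?_
  have hc : K * (dens μ (P x) * ENNReal.ofReal (lam x) ^ d) ≠ ⊤ :=
    ENNReal.mul_ne_top hKt (ENNReal.mul_ne_top
      (ENNReal.inv_ne_top.2 (measure_form_ne_zero μ (hP x))) (by finiteness))
  rw [lintegral_section_eq hB hcont hf]
  calc ∑' i, ∫⁻ w, sliceFun g μ Ψ B f i (x, w)
      ≤ ∑' i, (K * (dens μ (P x) * ENNReal.ofReal (lam x) ^ d)) *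
          ∫⁻ w, (slicePiece N B i).indicator (fun p => f (Ψ (p.1, param N i p.2)) *
            dens volume (pq (h p.1) (param N i) p.2)) (x, w) := by
        refine ENNReal.tsum_le_tsum fun i => ?_
        rw [← lintegral_const_mul' _ _ hc]
        exact lintegral_mono fun w => hpt i x w
    _ = _ := by
        rw [ENNReal.tsum_mul_left]
        have := ENNReal.inv_mul_cancel (ballVol_pos d) (ballVol_ne_top d)
        rw [mul_left_comm ((ballVol d)⁻¹), mul_left_comm ((ballVol d)⁻¹),
          ← mul_assoc ((ballVol d)⁻¹), this, one_mul, mul_assoc K]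

/-- The reverse comparison. It rests on `le_dens_prod`, which is sharp enough that no factor `√2`
appears. -/
theorem lintegral_le_setLIntegral_image (g : Metric M) (μ : Measure F) [μ.IsAddHaarMeasure]
    (hn : finrank ℝ F + d = n) {O : Set (F × N)}
    (hΨ : IsEmb (𝓘(ℝ, F).prod (𝓡 d)) (𝓡 n) Ψ O) (hBO : B ⊆ O) (hB : MeasurableSet B)
    (hf : Measurable f) (hP : ∀ x, IsForm (P x)) (hC : 0 < C) (hlam : ∀ p ∈ B, 0 < lam p.1)
    (hq : ∀ p ∈ B, ∀ (s : F) (v : TangentSpace (𝓡 d) p.2),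
      P p.1 s + lam p.1 ^ 2 * quad (h p.1) p.2 v ≤
      C ^ 2 * quad g (Ψ p) (mfderiv (𝓘(ℝ, F).prod (𝓡 d)) (𝓡 n) Ψ p
        ((s, v) : F × EuclideanSpace ℝ (Fin d)))) :
    ∫⁻ x, dens μ (P x) * ENNReal.ofReal (lam x) ^ d *
        ∫⁻ y, B.indicator (fun p => f (Ψ p)) (x, y) ∂vol (h x) ∂μ ≤
      (ballVol d * (ballVol n)⁻¹ * ENNReal.ofReal C ^ n) * ∫⁻ y in Ψ '' B, f y ∂vol g := by
  have hcont := hΨ.contMDiffOn.continuousOn.mono hBO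
  set K := ENNReal.ofReal C ^ n with hK
  have hKt : K ≠ ⊤ := by finiteness
  have hfin : finrank ℝ (F × EuclideanSpace ℝ (Fin d)) = n := by
    rw [finrank_prod, finrank_euclideanSpace_fin, hn]
  have hpt : ∀ i x w, (dens μ (P x) * ENNReal.ofReal (lam x) ^ d) * (slicePiece N B i).indicator
        (fun p => f (Ψ (p.1, param N i p.2)) * dens volume (pq (h p.1) (param N i) p.2)) (x, w) ≤
      K * sliceFun g μ Ψ B f i (x, w) := by
    intro i x w
    unfold sliceFun
    by_cases hxw : (x, w) ∈ slicePiece N B i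
    · rw [indicator_of_mem hxw, indicator_of_mem hxw]
      simp only
      rw [mul_left_comm, mul_left_comm K]
      refine mul_le_mul_right ?_ _
      have hxB : (x, param N i w) ∈ B := hxw.2.1
      have hl := hlam _ hxB
      have hQ : IsForm (pq (h x) (param N i) w) := isForm_pq _ _ _
      have hQ' := hQ.const_mul (sq_nonneg (lam x))
      calc dens μ (P x) * ENNReal.ofReal (lam x) ^ d * dens volume (pq (h x) (param N i) w)
          = dens μ (P x) * dens volume (fun v => lam x ^ 2 * pq (h x) (param N i) w v) := by
            rw [dens_const_mul volume hQ hl, finrank_euclideanSpace_fin]; ring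
        _ ≤ _ := le_dens_prod μ volume (hP x) hQ'
        _ ≤ dens (μ.prod volume) (fun p => C ^ 2 * pq g (Ψ ∘ Prod.map id (param N i)) (x, w) p) := by
            refine dens_mono fun p => ?_
            rw [mfderiv_comp_prodMap_param hΨ g hxw.1.2 (hBO hxB)]
            exact hq _ hxB p.1 _
        _ = _ := by
            rw [dens_const_mul (μ.prod volume) (isForm_pq _ _ _) hC, hfin]
    · rw [indicator_of_notMem hxw, mul_zero]; exact zero_le
  have hvol := setLIntegral_vol_image_prod g μ hn hΨ hBO hB hf
  have hvol' : (ballVol n)⁻¹ * ∫⁻ y in Ψ '' B, f y ∂vol g =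
      ∫⁻ x, (∑' i, ∫⁻ w, sliceFun g μ Ψ B f i (x, w)) ∂μ := by
    rw [hvol, ← mul_assoc, ENNReal.inv_mul_cancel (ballVol_pos n) (ballVol_ne_top n), one_mul]
  have e : ballVol d * (ballVol n)⁻¹ * K * ∫⁻ y in Ψ '' B, f y ∂vol g =
      ballVol d * (K * ((ballVol n)⁻¹ * ∫⁻ y in Ψ '' B, f y ∂vol g)) := by ring
  rw [e, hvol', ← lintegral_const_mul' _ _ hKt, ← lintegral_const_mul' _ _ (ballVol_ne_top d)]
  refine lintegral_mono fun x => ?_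
  have hc : dens μ (P x) * ENNReal.ofReal (lam x) ^ d ≠ ⊤ :=
    ENNReal.mul_ne_top (ENNReal.inv_ne_top.2 (measure_form_ne_zero μ (hP x))) (by finiteness)
  rw [lintegral_section_eq hB hcont hf, mul_left_comm]
  refine mul_le_mul_right ?_ _
  rw [← ENNReal.tsum_mul_left, ← ENNReal.tsum_mul_left]
  refine ENNReal.tsum_le_tsum fun i => ?_
  rw [← lintegral_const_mul' _ _ hc, ← lintegral_const_mul' _ _ hKt]
  exact lintegral_mono fun w => hpt i x w

end VolumeComparison

/-! ### Volumes under embeddings in equal dimension -/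

section Diffeo

open Module

variable {d : ℕ} {M N : Mfd.{u} d} {f : N → M} {O B : Set N} {φ : M → ℝ≥0∞} {C : ℝ}

/-- The trivial one point factor, used to regard a map from `N` as a map from a product. -/
theorem isEmb_comp_snd (hf : IsEmb (𝓡 d) (𝓡 d) f O) :
    IsEmb (𝓘(ℝ, EuclideanSpace ℝ (Fin 0)).prod (𝓡 d)) (𝓡 d)
      (f ∘ (Prod.snd : EuclideanSpace ℝ (Fin 0) × N → N)) (univ ×ˢ O) where
  isOpen := isOpen_univ.prod hf.isOpen
  contMDiffOn := hf.contMDiffOn.comp contMDiff_snd.contMDiffOn fun x hx => hx.2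
  injOn x hx y hy e := Prod.ext (Subsingleton.elim _ _) (hf.injOn hx.2 hy.2 e)
  mfderiv_eq_zero x hx v hv := by
    rw [mfderiv_comp x (hf.mdifferentiableAt hx.2) mdifferentiableAt_snd, mfderiv_snd] at hv
    exact Prod.ext (Subsingleton.elim (α := EuclideanSpace ℝ (Fin 0)) _ _)
      (hf.mfderiv_eq_zero _ hx.2 _ hv)

theorem mfderiv_comp_snd (g : Metric M) (hf : IsEmb (𝓡 d) (𝓡 d) f O)
    {p : EuclideanSpace ℝ (Fin 0) × N} (hp : p.2 ∈ O) (s : EuclideanSpace ℝ (Fin 0))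
    (v : EuclideanSpace ℝ (Fin d)) :
    quad g (f p.2) (mfderiv (𝓘(ℝ, EuclideanSpace ℝ (Fin 0)).prod (𝓡 d)) (𝓡 d) (f ∘ Prod.snd) p
      ((s, v) : EuclideanSpace ℝ (Fin 0) × EuclideanSpace ℝ (Fin d))) =
    quad g (f p.2) (mfderiv (𝓡 d) (𝓡 d) f p.2 v) := by
  rw [mfderiv_comp p (hf.mdifferentiableAt hp) mdifferentiableAt_snd, mfderiv_snd]
  rfl

theorem isForm_zero {E : Type*} [NormedAddCommGroup E] [NormedSpace ℝ E] :
    IsForm fun _ : E => (0 : ℝ) :=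
  ⟨continuous_const, fun _ => le_rfl, fun _ _ => by simp⟩

/-- On a one point space the zero form has density the inverse of the total mass, so integrating
over this factor changes nothing. -/
theorem lintegral_dens_zero (d : ℕ) (b : ℝ≥0∞) :
    ∫⁻ _ : EuclideanSpace ℝ (Fin 0), dens volume (fun _ : EuclideanSpace ℝ (Fin 0) => (0 : ℝ)) *
      ENNReal.ofReal 1 ^ d * b = b := by
  have h0 : ballVol 0 = volume (univ : Set (EuclideanSpace ℝ (Fin 0))) := by
    unfold ballVol
    congr 1; ext x
    simp [Subsingleton.elim x 0]
  have h1 : dens volume (fun _ : EuclideanSpace ℝ (Fin 0) => (0 : ℝ)) = (ballVol 0)⁻¹ := by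
    unfold dens
    rw [h0]; congr 2; ext x; simp
  rw [lintegral_const, ← h0, h1, ENNReal.ofReal_one, one_pow, mul_one, mul_right_comm,
    ENNReal.inv_mul_cancel (ballVol_pos 0) (ballVol_ne_top 0), one_mul]

/-- The comparison for products, with a one point first factor carrying the zero form. -/
theorem setLIntegral_le_image_of_le_quad (g : Metric M) (h : Metric N)
    (hf : IsEmb (𝓡 d) (𝓡 d) f O) (hBO : B ⊆ O) (hB : MeasurableSet B) (hφ : Measurable φ)
    (hC : 0 < C) (hq : ∀ y ∈ B, ∀ v : TangentSpace (𝓡 d) y,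
      quad h y v ≤ C ^ 2 * quad g (f y) (mfderiv (𝓡 d) (𝓡 d) f y v)) :
    ∫⁻ y in B, φ (f y) ∂vol h ≤ ENNReal.ofReal C ^ d * ∫⁻ y in f '' B, φ y ∂vol g := by
  have key := lintegral_le_setLIntegral_image (P := fun _ _ => 0) (lam := fun _ => 1)
    (h := fun _ => h) g
    volume (by simp) (isEmb_comp_snd hf) (B := univ ×ˢ B) (prod_mono Subset.rfl hBO)
    (MeasurableSet.univ.prod hB) hφ (fun _ => isForm_zero) hC (fun _ _ => one_pos)
    (fun p hp s v => by
      rw [one_pow, one_mul, zero_add]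
      exact (hq _ hp.2 v).trans_eq (congrArg _ (mfderiv_comp_snd g hf (hBO hp.2) s v).symm))
  have e1 : (f ∘ Prod.snd) '' ((univ : Set (EuclideanSpace ℝ (Fin 0))) ×ˢ B) = f '' B := by
    rw [image_comp, snd_image_prod univ_nonempty]
  have e2 : ∀ x : EuclideanSpace ℝ (Fin 0), ∫⁻ y, ((univ : Set (EuclideanSpace ℝ (Fin 0))) ×ˢ
      B).indicator (fun p => φ ((f ∘ Prod.snd) p)) (x, y) ∂vol h = ∫⁻ y in B, φ (f y) ∂vol h := by
    intro x
    rw [← lintegral_indicator hB]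
    congr 1; ext y
    by_cases hy : y ∈ B <;> simp [hy]
  simp only [e2, e1, lintegral_dens_zero d] at key
  rwa [ENNReal.mul_inv_cancel (ballVol_pos d) (ballVol_ne_top d), one_mul] at key

end Diffeo

/-! ### Volumes of images of products of two manifolds -/

section Product

open Module

variable {s d n : ℕ} {X : Mfd.{u} s} {N : Mfd.{u} d} {M : Mfd.{u} n} {Ψ : X × N → M}
  {O : Set (X × N)} {W : Set X} {T : Set N} {f : M → ℝ≥0∞} {G : N → ℝ≥0∞} {C lam : ℝ}

/-- The pieces of the product set `W × T` in the parametrizations of the first factor. -/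
def prodPiece (X : Mfd.{u} s) (W : Set X) (T : Set N) (i : ℕ) :
    Set (EuclideanSpace ℝ (Fin s) × N) :=
  (paramDom X i ∩ param X i ⁻¹' (W ∩ piece X i)) ×ˢ T

theorem vol_eq_tsum (κ : Metric X) (hW : MeasurableSet W) :
    vol κ W = ballVol s * ∑' i, ∫⁻ x in paramDom X i ∩ param X i ⁻¹' (W ∩ piece X i),
      dens volume (pq κ (param X i) x) := by
  rw [← lintegral_indicator_one hW, lintegral_vol κ (measurable_one.indicator hW)]
  congr 2; ext i
  have hm : MeasurableSet (paramDom X i ∩ param X i ⁻¹' (W ∩ piece X i)) :=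
    measurableSet_inter_preimage (isEmb_param X i).contMDiffOn.continuousOn
      (isEmb_param X i).isOpen.measurableSet (hW.inter (measurableSet_piece X i))
  rw [← lintegral_indicator hm, ← lintegral_indicator (measurableSet_paramPiece X i)]
  congr 1; ext x
  by_cases hx : x ∈ paramPiece X i
  · rw [indicator_of_mem hx]
    by_cases hw : param X i x ∈ W
    · rw [indicator_of_mem hw, indicator_of_mem, Pi.one_apply, one_mul]
      exact ⟨hx.1, hw, hx.2⟩
    · rw [indicator_of_notMem hw, indicator_of_notMem, zero_mul]
      exact fun h => hw h.2.1
  · rw [indicator_of_notMem hx, indicator_of_notMem]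
    exact fun h => hx ⟨h.1, h.2.2⟩

theorem isEmb_comp_param (hΨ : IsEmb ((𝓡 s).prod (𝓡 d)) (𝓡 n) Ψ O) (i : ℕ) :
    IsEmb (𝓘(ℝ, EuclideanSpace ℝ (Fin s)).prod (𝓡 d)) (𝓡 n) (Ψ ∘ Prod.map (param X i) id)
      ((paramDom X i ×ˢ univ) ∩ Prod.map (param X i) id ⁻¹' O) :=
  have h := (isEmb_param X i).prodMap (IsEmb.id (I₁ := 𝓡 d) (X₁ := N))
  hΨ.comp (h.mono (h.contMDiffOn.continuousOn.isOpen_inter_preimage h.isOpen hΨ.isOpen)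
    inter_subset_left) fun _ hx => hx.2

theorem mfderiv_comp_prodMap_param_left (g : Metric M)
    (hΨ : IsEmb ((𝓡 s).prod (𝓡 d)) (𝓡 n) Ψ O) {i : ℕ} {p : EuclideanSpace ℝ (Fin s) × N}
    (hp : p.1 ∈ paramDom X i) (hO : (param X i p.1, p.2) ∈ O)
    (a : EuclideanSpace ℝ (Fin s)) (v : EuclideanSpace ℝ (Fin d)) :
    quad g (Ψ (param X i p.1, p.2)) (mfderiv (𝓘(ℝ, EuclideanSpace ℝ (Fin s)).prod (𝓡 d)) (𝓡 n)
      (Ψ ∘ Prod.map (param X i) id) p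
      ((a, v) : EuclideanSpace ℝ (Fin s) × EuclideanSpace ℝ (Fin d))) =
    quad g (Ψ (param X i p.1, p.2)) (mfderiv ((𝓡 s).prod (𝓡 d)) (𝓡 n) Ψ (param X i p.1, p.2)
      ((mfderiv (𝓡 s) (𝓡 s) (param X i) p.1 a, v) :
        EuclideanSpace ℝ (Fin s) × EuclideanSpace ℝ (Fin d))) := by
  have h1 : MDifferentiableAt (𝓘(ℝ, EuclideanSpace ℝ (Fin s)).prod (𝓡 d)) ((𝓡 s).prod (𝓡 d))
      (Prod.map (param X i) (id : N → N)) p :=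
    ((isEmb_param X i).prodMap (IsEmb.id (I₁ := 𝓡 d) (X₁ := N))).mdifferentiableAt
      ⟨hp, mem_univ _⟩
  have h2 : mfderiv (𝓘(ℝ, EuclideanSpace ℝ (Fin s)).prod (𝓡 d)) (𝓡 n)
      (Ψ ∘ Prod.map (param X i) id) p = _ :=
    mfderiv_comp p (hΨ.mdifferentiableAt (x := (param X i p.1, p.2)) hO) h1
  rw [h2, mfderiv_prodMap ((isEmb_param X i).mdifferentiableAt hp) mdifferentiableAt_id, mfderiv_id]
  rfl

theorem measurableSet_prodPiece (hW : MeasurableSet W) (hT : MeasurableSet T) (i : ℕ) :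
    MeasurableSet (prodPiece X W T i) :=
  (measurableSet_inter_preimage (isEmb_param X i).contMDiffOn.continuousOn
    (isEmb_param X i).isOpen.measurableSet (hW.inter (measurableSet_piece X i))).prod hT

theorem setLIntegral_image_prod_eq_tsum (g : Metric M)
    (hΨ : IsEmb ((𝓡 s).prod (𝓡 d)) (𝓡 n) Ψ O) (hO : W ×ˢ T ⊆ O) (hW : MeasurableSet W)
    (hT : MeasurableSet T) (f : M → ℝ≥0∞) :
    ∫⁻ y in Ψ '' (W ×ˢ T), f y ∂vol g =
      ∑' i, ∫⁻ y in (Ψ ∘ Prod.map (param X i) id) '' prodPiece X W T i, f y ∂vol g := by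
  have himg : ∀ i, Prod.map (param X i) (id : N → N) '' prodPiece X W T i =
      (W ∩ piece X i) ×ˢ T := fun i => by
    unfold prodPiece
    rw [prodMap_image_prod, image_id]
    congr 1
    ext q
    constructor
    · rintro ⟨x, hx, rfl⟩; exact hx.2
    · rintro ⟨hq, hq'⟩
      rw [← image_paramPiece] at hq'
      obtain ⟨x, hx, rfl⟩ := hq'
      exact ⟨x, ⟨hx.1, hq, hx.2⟩, rfl⟩
  have hU : W ×ˢ T = ⋃ i, (W ∩ piece X i) ×ˢ T := by
    rw [← iUnion_prod_const, ← inter_iUnion, iUnion_piece, inter_univ]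
  have hD : Pairwise (Function.onFun Disjoint fun i => Ψ '' ((W ∩ piece X i) ×ˢ T)) := by
    intro i j hij
    rw [Function.onFun, disjoint_left]
    rintro _ ⟨p, hp, rfl⟩ ⟨q, hq, e⟩
    have := hΨ.injOn (hO ⟨hq.1.1, hq.2⟩) (hO ⟨hp.1.1, hp.2⟩) e
    subst this
    exact disjoint_left.1 (disjoint_piece X hij) hp.1.2 hq.1.2
  have hm : ∀ i, MeasurableSet (Ψ '' ((W ∩ piece X i) ×ˢ T)) := fun i => by
    rw [← himg, ← image_comp]
    exact measurableSet_image (isEmb_comp_param hΨ i)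
      (fun p hp => ⟨⟨hp.1.1, mem_univ _⟩, hO ⟨hp.1.2.1, hp.2⟩⟩) (measurableSet_prodPiece hW hT i)
  conv_lhs => rw [hU, image_iUnion]
  rw [lintegral_iUnion hm hD]
  congr 1; ext i
  rw [image_comp, himg]

/-- The function depends on the second variable only and the metric on `T` is fixed, so the double
integral splits into a volume in `X` and an integral over `T`. -/
theorem setLIntegral_prodPiece (κ : Metric X) (μ : Measure N) (lam : ℝ) (G : N → ℝ≥0∞)
    (hW : MeasurableSet W) (hT : MeasurableSet T) {Ψ' : EuclideanSpace ℝ (Fin s) × N → M} (i : ℕ)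
    (hG : ∀ p ∈ prodPiece X W T i, f (Ψ' p) = G p.2) :
    ∫⁻ x, dens volume (pq κ (param X i) x) * ENNReal.ofReal lam ^ d *
        (∫⁻ z, (prodPiece X W T i).indicator (fun p => f (Ψ' p)) (x, z) ∂μ) =
      ENNReal.ofReal lam ^ d * (∫⁻ z in T, G z ∂μ) *
        ∫⁻ x in paramDom X i ∩ param X i ⁻¹' (W ∩ piece X i),
          dens volume (pq κ (param X i) x) := by
  have hm : MeasurableSet (paramDom X i ∩ param X i ⁻¹' (W ∩ piece X i)) :=
    measurableSet_inter_preimage (isEmb_param X i).contMDiffOn.continuousOn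
      (isEmb_param X i).isOpen.measurableSet (hW.inter (measurableSet_piece X i))
  have haem : AEMeasurable (fun x => dens volume (pq κ (param X i) x))
      (volume.restrict (paramDom X i ∩ param X i ⁻¹' (W ∩ piece X i))) :=
    aemeasurable_dens _ _ hm ((IsEmb.continuousOn_pq κ (isEmb_param X i)).mono
      (prod_mono inter_subset_left Subset.rfl))
  rw [← lintegral_const_mul'' _ haem, ← lintegral_indicator hm]
  congr 1; ext x
  by_cases hx : x ∈ paramDom X i ∩ param X i ⁻¹' (W ∩ piece X i)
  · rw [indicator_of_mem hx]
    have : ∫⁻ z, (prodPiece X W T i).indicator (fun p => f (Ψ' p)) (x, z) ∂μ =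
        ∫⁻ z in T, G z ∂μ := by
      rw [← lintegral_indicator hT]
      congr 1; ext z
      by_cases hz : z ∈ T
      · rw [indicator_of_mem hz, indicator_of_mem (show (x, z) ∈ prodPiece X W T i from ⟨hx, hz⟩),
          hG _ ⟨hx, hz⟩]
      · rw [indicator_of_notMem hz, indicator_of_notMem fun h => hz h.2]
    rw [this]; ring
  · rw [indicator_of_notMem hx]
    have : ∀ z, (prodPiece X W T i).indicator (fun p => f (Ψ' p)) (x, z) = 0 := fun z =>
      indicator_of_notMem (fun h => hx h.1) _
    simp [this]

/-- Integrals over the image of a product of sets, for a function of the second variable and a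
metric that is dominated by a product metric. -/
theorem setLIntegral_image_prod_le (g : Metric M) (κ : Metric X) (h : Metric N) (hn : s + d = n)
    (hΨ : IsEmb ((𝓡 s).prod (𝓡 d)) (𝓡 n) Ψ O) (hO : W ×ˢ T ⊆ O) (hW : MeasurableSet W)
    (hT : MeasurableSet T) (hf : Measurable f) (hC : 0 < C) (hlam : 0 < lam)
    (hG : ∀ p ∈ W ×ˢ T, f (Ψ p) = G p.2)
    (hq : ∀ p ∈ W ×ˢ T, ∀ (a : TangentSpace (𝓡 s) p.1) (v : TangentSpace (𝓡 d) p.2),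
      quad g (Ψ p) (mfderiv ((𝓡 s).prod (𝓡 d)) (𝓡 n) Ψ p
        ((a, v) : EuclideanSpace ℝ (Fin s) × EuclideanSpace ℝ (Fin d))) ≤
      C ^ 2 * (quad κ p.1 a + lam ^ 2 * quad h p.2 v)) :
    ∫⁻ y in Ψ '' (W ×ˢ T), f y ∂vol g ≤
      (ballVol n * (ballVol d)⁻¹ * (ENNReal.ofReal C ^ n * ENNReal.ofReal √2 ^ n)) *
        (ballVol s)⁻¹ * (ENNReal.ofReal lam ^ d * vol κ W * ∫⁻ z in T, G z ∂vol h) := by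
  rw [setLIntegral_image_prod_eq_tsum g hΨ hO hW hT, vol_eq_tsum κ hW]
  -- In a chart of `X` the first factor becomes a vector space, with the pullback of `κ` as the form
  -- `P x`.
  have key : ∀ i, _ := fun i => setLIntegral_image_le (P := fun x => pq κ (param X i) x)
    (lam := fun _ => lam) (h := fun _ => h) (C := C) g volume (by simpa using hn)
    (isEmb_comp_param hΨ i) (B := prodPiece X W T i)
    (fun p hp => ⟨⟨hp.1.1, mem_univ _⟩, hO ⟨hp.1.2.1, hp.2⟩⟩)
    (measurableSet_prodPiece hW hT i) hf (fun x => isForm_pq _ _ _) hC (fun _ _ => hlam)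
    (fun p hp a v => (mfderiv_comp_prodMap_param_left g hΨ hp.1.1 (hO ⟨hp.1.2.1, hp.2⟩) a v).trans_le
      (hq (param X i p.1, p.2) ⟨hp.1.2.1, hp.2⟩ _ v))
  refine (ENNReal.tsum_le_tsum key).trans_eq ?_
  rw [ENNReal.tsum_mul_left, mul_assoc _ ((ballVol s)⁻¹)]
  congr 1
  rw [tsum_congr fun i => setLIntegral_prodPiece κ (vol h) lam G hW hT
    (Ψ' := Ψ ∘ Prod.map (param X i) id) i
    (fun p hp => hG (param X i p.1, p.2) ⟨hp.1.2.1, hp.2⟩), ENNReal.tsum_mul_left]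
  have e : ∀ A D E : ℝ≥0∞, (ballVol s)⁻¹ * (A * (ballVol s * D) * E) =
      (ballVol s)⁻¹ * ballVol s * (A * E * D) := by intros; ring
  rw [e, ENNReal.inv_mul_cancel (ballVol_pos s) (ballVol_ne_top s), one_mul]

theorem le_setLIntegral_image_prod (g : Metric M) (κ : Metric X) (h : Metric N) (hn : s + d = n)
    (hΨ : IsEmb ((𝓡 s).prod (𝓡 d)) (𝓡 n) Ψ O) (hO : W ×ˢ T ⊆ O) (hW : MeasurableSet W)
    (hT : MeasurableSet T) (hf : Measurable f) (hC : 0 < C) (hlam : 0 < lam)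
    (hG : ∀ p ∈ W ×ˢ T, f (Ψ p) = G p.2)
    (hq : ∀ p ∈ W ×ˢ T, ∀ (a : TangentSpace (𝓡 s) p.1) (v : TangentSpace (𝓡 d) p.2),
      quad κ p.1 a + lam ^ 2 * quad h p.2 v ≤
      C ^ 2 * quad g (Ψ p) (mfderiv ((𝓡 s).prod (𝓡 d)) (𝓡 n) Ψ p
        ((a, v) : EuclideanSpace ℝ (Fin s) × EuclideanSpace ℝ (Fin d)))) :
    ENNReal.ofReal lam ^ d * vol κ W * ∫⁻ z in T, G z ∂vol h ≤
      ballVol s * (ballVol d * (ballVol n)⁻¹ * ENNReal.ofReal C ^ n) *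
        ∫⁻ y in Ψ '' (W ×ˢ T), f y ∂vol g := by
  rw [setLIntegral_image_prod_eq_tsum g hΨ hO hW hT, vol_eq_tsum κ hW]
  have key : ∀ i, _ := fun i => lintegral_le_setLIntegral_image (P := fun x => pq κ (param X i) x)
    (lam := fun _ => lam) (h := fun _ => h) (C := C) g volume (by simpa using hn)
    (isEmb_comp_param hΨ i) (B := prodPiece X W T i)
    (fun p hp => ⟨⟨hp.1.1, mem_univ _⟩, hO ⟨hp.1.2.1, hp.2⟩⟩)
    (measurableSet_prodPiece hW hT i) hf (fun x => isForm_pq _ _ _) hC (fun _ _ => hlam)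
    (fun p hp a v => (hq (param X i p.1, p.2) ⟨hp.1.2.1, hp.2⟩ _ v).trans_eq (congrArg _
      (mfderiv_comp_prodMap_param_left g hΨ hp.1.1 (hO ⟨hp.1.2.1, hp.2⟩) a v).symm))
  have key' := ENNReal.tsum_le_tsum key
  rw [ENNReal.tsum_mul_left, tsum_congr fun i => setLIntegral_prodPiece κ (vol h) lam G hW hT
    (Ψ' := Ψ ∘ Prod.map (param X i) id) i
    (fun p hp => hG (param X i p.1, p.2) ⟨hp.1.2.1, hp.2⟩), ENNReal.tsum_mul_left] at key'
  rw [mul_assoc (ballVol s)]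
  refine le_trans (le_of_eq ?_) (mul_le_mul_right key' (ballVol s))
  ring

end Product

/-! ### Comparison of quadratic forms over compact sets -/

section Comparison

open Filter Topology

/-- Near a point where `Q₂` is positive definite, `Q₁` is dominated by a multiple of `Q₂`. -/
theorem exists_eventually_form_le {X : Type*} [TopologicalSpace X] {E : Type*}
    [NormedAddCommGroup E] [NormedSpace ℝ E] [FiniteDimensional ℝ E] {S : Set X} {x₀ : X}
    (hx₀ : x₀ ∈ S) {Q₁ Q₂ : X → E → ℝ}
    (hc₁ : ContinuousOn (fun p : X × E => Q₁ p.1 p.2) (S ×ˢ univ))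
    (hc₂ : ContinuousOn (fun p : X × E => Q₂ p.1 p.2) (S ×ˢ univ))
    (h₁ : ∀ x (c : ℝ) v, Q₁ x (c • v) = c ^ 2 * Q₁ x v)
    (h₂ : ∀ x (c : ℝ) v, Q₂ x (c • v) = c ^ 2 * Q₂ x v)
    (hpos : ∀ v, v ≠ 0 → 0 < Q₂ x₀ v) :
    ∃ C : ℝ, 0 < C ∧ ∀ᶠ x in 𝓝[S] x₀, ∀ v, Q₁ x v ≤ C ^ 2 * Q₂ x v := by
  have hK : IsCompact (Metric.sphere (0 : E) 1) := isCompact_sphere 0 1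
  have hne : ∀ v ∈ Metric.sphere (0 : E) 1, v ≠ 0 := fun v hv h => by
    rw [h] at hv; simp at hv
  have hs : ∀ {Q : X → E → ℝ}, ContinuousOn (fun p : X × E => Q p.1 p.2) (S ×ˢ univ) →
      Continuous (Q x₀) := fun hQ => by
    rw [← continuousOn_univ]
    exact hQ.comp (f := fun v => (x₀, v)) (by fun_prop) fun v _ => ⟨hx₀, mem_univ _⟩
  obtain ⟨C₀, hC₀⟩ : ∃ C₀, ∀ v ∈ Metric.sphere (0 : E) 1, Q₁ x₀ v / Q₂ x₀ v ≤ C₀ := by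
    obtain ⟨C₀, h⟩ := hK.bddAbove_image (f := fun v => Q₁ x₀ v / Q₂ x₀ v)
      ((hs hc₁).continuousOn.div (hs hc₂).continuousOn fun v hv => (hpos v (hne v hv)).ne')
    exact ⟨C₀, fun v hv => h (mem_image_of_mem _ hv)⟩
  -- Since `C ≥ 1`, also `C₀ < C ≤ C²`; the strict inequality on the unit sphere at `x₀` then
  -- survives small changes of `x`.
  set C := max C₀ 0 + 1 with hC
  have hC1 : 1 ≤ C := by have := le_max_right C₀ 0; linarith
  have hCC : C ≤ C ^ 2 := by nlinarith
  refine ⟨C, by linarith, ?_⟩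
  -- Compactness of the sphere makes the neighbourhood of `x₀` independent of the direction;
  -- homogeneity extends the estimate to all vectors.
  have h3 : {p : E × X | Q₁ p.2 p.1 < C ^ 2 * Q₂ p.2 p.1} ∈
      𝓝ˢ (Metric.sphere (0 : E) 1) ×ˢ 𝓝[S] x₀ := by
    refine hK.mem_nhdsSet_prod_of_forall fun v hv => ?_
    have hlt : Q₁ x₀ v < C ^ 2 * Q₂ x₀ v := by
      have hp := hpos v (hne v hv)
      have h4 := (div_le_iff₀ hp).1 (hC₀ v hv)
      have : C₀ < C ^ 2 := by have := le_max_left C₀ 0; linarith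
      nlinarith
    have h5 : ∀ᶠ p in 𝓝[S ×ˢ univ] ((x₀, v) : X × E), Q₁ p.1 p.2 < C ^ 2 * Q₂ p.1 p.2 :=
      (hc₁ (x₀, v) ⟨hx₀, mem_univ _⟩).eventually_lt
        ((hc₂ (x₀, v) ⟨hx₀, mem_univ _⟩).const_mul (C ^ 2)) hlt
    rw [nhdsWithin_prod_eq, nhdsWithin_univ] at h5
    rw [prod_comm] at h5
    exact eventually_map.1 h5
  obtain ⟨U, hU, V, hV, hUV⟩ := mem_prod_iff.1 h3
  filter_upwards [hV] with x hx v
  by_cases hv : v = 0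
  · have e1 := h₁ x 0 v
    have e2 := h₂ x 0 v
    rw [zero_smul] at e1 e2
    rw [hv, e1, e2]; simp
  · have hn : 0 < ‖v‖ := norm_pos_iff.2 hv
    have hu : ‖v‖⁻¹ • v ∈ Metric.sphere (0 : E) 1 := by
      simp [norm_smul, hn.ne']
    have h6 := hUV (mk_mem_prod (subset_of_mem_nhdsSet hU hu) hx)
    have e : v = ‖v‖ • ‖v‖⁻¹ • v := by rw [smul_smul, mul_inv_cancel₀ hn.ne', one_smul]
    rw [e, h₁, h₂]
    have h7 : Q₁ x (‖v‖⁻¹ • v) < C ^ 2 * Q₂ x (‖v‖⁻¹ • v) := h6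
    nlinarith [sq_nonneg ‖v‖]

/-- Local domination over a compact set is uniform. -/
theorem exists_forall_form_le {X : Type*} [TopologicalSpace X] {E : Type*} {K : Set X}
    (hK : IsCompact K) {Q₁ Q₂ : X → E → ℝ} (hQ₂ : ∀ x v, 0 ≤ Q₂ x v)
    (h : ∀ x ∈ K, ∃ C : ℝ, 0 < C ∧ ∀ᶠ y in 𝓝[K] x, ∀ v, Q₁ y v ≤ C ^ 2 * Q₂ y v) :
    ∃ C : ℝ, 0 < C ∧ ∀ x ∈ K, ∀ v, Q₁ x v ≤ C ^ 2 * Q₂ x v := by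
  refine hK.induction_on (p := fun s => ∃ C : ℝ, 0 < C ∧ ∀ x ∈ s, ∀ v, Q₁ x v ≤ C ^ 2 * Q₂ x v)
    ⟨1, one_pos, by simp⟩ (fun s t hst ⟨C, hC, h⟩ => ⟨C, hC, fun x hx => h x (hst hx)⟩) ?_ ?_
  · rintro s t ⟨C, hC, hs⟩ ⟨C', hC', ht⟩
    refine ⟨max C C', lt_max_of_lt_left hC, fun x hx v => ?_⟩
    rcases hx with hx | hx
    · refine (hs x hx v).trans (mul_le_mul_of_nonneg_right ?_ (hQ₂ x v))
      exact pow_le_pow_left₀ hC.le (le_max_left _ _) 2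
    · refine (ht x hx v).trans (mul_le_mul_of_nonneg_right ?_ (hQ₂ x v))
      exact pow_le_pow_left₀ hC'.le (le_max_right _ _) 2
  · intro x hx
    obtain ⟨C, hC, h'⟩ := h x hx
    exact ⟨_, h', C, hC, fun y hy => hy⟩

variable {n : ℕ} {M : Mfd.{u} n}

/-- Locally the pulled back metric and the Euclidean norm dominate each other. One direction bounds
the density above, the other encloses the unit ball of the form in a Euclidean ball and makes the
density positive. -/
theorem IsEmb.exists_dens_bounds {Ψ : EuclideanSpace ℝ (Fin n) → M}
    {O : Set (EuclideanSpace ℝ (Fin n))} (h : IsEmb (𝓡 n) (𝓡 n) Ψ O) (g : Metric M)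
    {x : EuclideanSpace ℝ (Fin n)} (hx : x ∈ O) :
    ∃ C : ℝ≥0∞, C ≠ ⊤ ∧ ∀ᶠ y in 𝓝 x, dens volume (pq g Ψ y) ≤ C ∧ 0 < dens volume (pq g Ψ y) := by
  have hn : ContinuousOn (fun p : EuclideanSpace ℝ (Fin n) × EuclideanSpace ℝ (Fin n) => ‖p.2‖ ^ 2)
      (O ×ˢ univ) := by fun_prop
  have hns : ∀ (c : ℝ) (v : EuclideanSpace ℝ (Fin n)), ‖c • v‖ ^ 2 = c ^ 2 * ‖v‖ ^ 2 := fun c v => by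
    rw [norm_smul, mul_pow, Real.norm_eq_abs, sq_abs]
  have hc := IsEmb.continuousOn_pq g h
  obtain ⟨C, hC, h1⟩ := exists_eventually_form_le (Q₁ := fun y => pq g Ψ y)
    (Q₂ := fun _ v => ‖v‖ ^ 2) hx hc hn (fun y => (isForm_pq g Ψ y).smul) (fun _ => hns) (fun v hv => by positivity)
  obtain ⟨C', hC', h2⟩ := exists_eventually_form_le (Q₁ := fun _ v => ‖v‖ ^ 2)
    (Q₂ := fun y => pq g Ψ y) hx hn hc (fun _ => hns)
    (fun y => (isForm_pq g Ψ y).smul) (fun v hv => h.pq_pos hx hv)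
  rw [h.isOpen.nhdsWithin_eq hx] at h1 h2
  refine ⟨dens volume fun v : EuclideanSpace ℝ (Fin n) => C ^ 2 * ‖v‖ ^ 2, ?_, ?_⟩
  · refine ENNReal.inv_ne_top.2 (measure_form_ne_zero volume ⟨by fun_prop, fun v => by positivity,
      fun c v => by rw [hns]; ring⟩)
  · filter_upwards [h1, h2] with y hy hy'
    refine ⟨dens_mono hy, ENNReal.inv_pos.2 ?_⟩
    refine ((measure_mono fun v hv => ?_).trans_lt
      (measure_ball_lt_top (x := (0 : EuclideanSpace ℝ (Fin n))) (r := C'))).ne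
    rw [mem_ball_zero_iff]
    have h3 := hy' v
    have h4 : pq g Ψ y v < 1 := hv
    refine lt_of_pow_lt_pow_left₀ 2 hC'.le (h3.trans_lt ?_)
    have : 0 < C' ^ 2 := by positivity
    nlinarith

theorem setLIntegral_chart_image (g : Metric M) (c : M) {B : Set (EuclideanSpace ℝ (Fin n))}
    (hB : B ⊆ (chartAt (EuclideanSpace ℝ (Fin n)) c).target) (hm : MeasurableSet B) :
    vol g ((chartAt (EuclideanSpace ℝ (Fin n)) c).symm '' B) = ballVol n *
      ∫⁻ x in B, dens volume (pq g (chartAt (EuclideanSpace ℝ (Fin n)) c).symm x) := by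
  have h := setLIntegral_vol_image_euclidean g (isEmb_chart_symm c) hB hm
    (f := fun _ => 1) measurable_const
  simpa using h

instance isLocallyFiniteMeasure_vol (g : Metric M) : IsLocallyFiniteMeasure (vol g) := by
  refine ⟨fun y => ?_⟩
  let φ := chartAt (EuclideanSpace ℝ (Fin n)) y
  have hy : φ y ∈ φ.target := mem_chart_target _ y
  obtain ⟨C, hC, h⟩ := (isEmb_chart_symm y).exists_dens_bounds g hy
  have hb := (h.and (Metric.ball_mem_nhds (φ y) one_pos)).and (φ.open_target.mem_nhds hy)
  obtain ⟨B, hB, hBo, hyB⟩ := eventually_nhds_iff.1 hb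
  have hBt : B ⊆ φ.target := fun x hx => (hB x hx).2
  refine ⟨φ.symm '' B, ?_, ?_⟩
  · have := (φ.isOpen_symm_image_iff_of_subset_target hBt).2 hBo
    exact this.mem_nhds ⟨φ y, hyB, φ.left_inv (mem_chart_source _ y)⟩
  · rw [setLIntegral_chart_image g y hBt hBo.measurableSet]
    refine ENNReal.mul_lt_top (ballVol_ne_top n).lt_top ?_
    calc _ ≤ ∫⁻ x in B, C := setLIntegral_mono' hBo.measurableSet fun x hx => (hB x hx).1.1.1
      _ = C * volume B := by simp
      _ < ⊤ := ENNReal.mul_lt_top hC.lt_top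
        ((measure_mono fun x hx => (hB x hx).1.2).trans_lt measure_ball_lt_top)

theorem vol_pos_of_mem_nhds (g : Metric M) {y : M} {U : Set M} (hU : U ∈ 𝓝 y) : 0 < vol g U := by
  let φ := chartAt (EuclideanSpace ℝ (Fin n)) y
  have hy : φ y ∈ φ.target := mem_chart_target _ y
  obtain ⟨C, hC, h⟩ := (isEmb_chart_symm y).exists_dens_bounds g hy
  have hU' : ∀ᶠ x in 𝓝 (φ y), φ.symm x ∈ U :=
    (φ.continuousAt_symm hy).eventually (by rwa [φ.left_inv (mem_chart_source _ y)])
  obtain ⟨B, hB, hBo, hyB⟩ := eventually_nhds_iff.1 ((h.and hU').and (φ.open_target.mem_nhds hy))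
  have hBt : B ⊆ φ.target := fun x hx => (hB x hx).2
  refine lt_of_lt_of_le ?_ (measure_mono (image_subset_iff.2 fun x hx => (hB x hx).1.2 :
    φ.symm '' B ⊆ U))
  rw [setLIntegral_chart_image g y hBt hBo.measurableSet]
  refine ENNReal.mul_pos (ballVol_pos n) ?_
  intro h0
  rw [lintegral_eq_zero_iff' (aemeasurable_dens _ _ hBo.measurableSet
    ((IsEmb.continuousOn_pq g (isEmb_chart_symm y)).mono (prod_mono hBt Subset.rfl)))] at h0
  have h1 : ∀ᵐ _ ∂volume.restrict B, False := by
    filter_upwards [h0, ae_restrict_mem hBo.measurableSet] with x hx hx'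
    exact (hB x hx').1.1.2.ne' hx
  rw [ae_iff] at h1
  simp only [not_false_eq_true, ofPred_true, Measure.restrict_apply_univ] at h1
  exact (hBo.measure_pos volume ⟨_, hyB⟩).ne' h1

/-- For `p` within `δ/2` of `x`, the ball `B(p, δ)` contains `B(x, δ/2)`, which has positive volume.
Compactness leaves finitely many such `x`. -/
theorem exists_le_vol_gball (g : Metric M) {K : Set M} (hK : IsCompact K) {δ : ℝ} (hδ : 0 < δ) :
    ∃ c : ℝ≥0∞, c ≠ 0 ∧ ∀ p ∈ K, c ≤ vol g (gball g p δ) := by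
  refine hK.induction_on (p := fun s => ∃ c : ℝ≥0∞, c ≠ 0 ∧ ∀ p ∈ s, c ≤ vol g (gball g p δ))
    ⟨1, one_ne_zero, by simp⟩ (fun s t hst ⟨C, hC, h⟩ => ⟨C, hC, fun x hx => h x (hst hx)⟩) ?_ ?_
  · rintro s t ⟨C, hC, hs⟩ ⟨C', hC', ht⟩
    refine ⟨min C C', (lt_min (pos_iff_ne_zero.2 hC) (pos_iff_ne_zero.2 hC')).ne', fun x hx => ?_⟩
    rcases hx with hx | hx
    · exact (min_le_left _ _).trans (hs x hx)
    · exact (min_le_right _ _).trans (ht x hx)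
  · intro x _
    have h2 : 0 < δ / 2 := by positivity
    have hmem : gball g x (δ / 2) ∈ 𝓝 x := (isOpen_gball g x _).mem_nhds (mem_gball_self g x h2)
    refine ⟨_, mem_nhdsWithin_of_mem_nhds hmem, vol g (gball g x (δ / 2)),
      (vol_pos_of_mem_nhds g hmem).ne', fun p hp => measure_mono ?_⟩
    refine gball_subset_gball g h2.le h2.le (le_of_lt ?_) (by linarith)
    rw [gdist_comm]; exact hp

end Comparison

/-! ### Continuous families of metrics -/

section Family

open Filter Topology

variable {n d : ℕ} {M : Mfd.{u} n} {N : Mfd.{u} d} {F : Type*} [NormedAddCommGroup F]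
  [NormedSpace ℝ F] [FiniteDimensional ℝ F] {K : Set ℝ}

/-- The vector `v` in the coordinates of the chart at `center N i`. -/
theorem mfderiv_param_mfderiv_chart {i : ℕ} {y : N}
    (hy : y ∈ (chartAt (EuclideanSpace ℝ (Fin d)) (center N i)).source)
    (v : TangentSpace (𝓡 d) y) :
    (mfderiv (𝓡 d) (𝓡 d) (param N i) (chartAt (EuclideanSpace ℝ (Fin d)) (center N i) y)
      (mfderiv (𝓡 d) (𝓡 d) (chartAt (EuclideanSpace ℝ (Fin d)) (center N i)) y v) :
        EuclideanSpace ℝ (Fin d)) = v := by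
  let φ := chartAt (EuclideanSpace ℝ (Fin d)) (center N i)
  exact mfderiv_leftInverse (f := φ) (g := φ.symm) φ.open_source hy (fun z hz => φ.left_inv hz)
    ((isEmb_chart _).mdifferentiableAt hy) ((isEmb_chart_symm _).mdifferentiableAt (φ.map_source hy)) v

/-- Uniform comparison, over a compact set, of two continuous families of quadratic forms on the
spaces `F × T_y N`. -/
theorem exists_forall_tangent_le [CompactSpace N] (hK : IsCompact K)
    {q₁ q₂ : ℝ → N → F × EuclideanSpace ℝ (Fin d) → ℝ}
    (hs₁ : ∀ t y (c : ℝ) v, q₁ t y (c • v) = c ^ 2 * q₁ t y v)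
    (hs₂ : ∀ t y (c : ℝ) v, q₂ t y (c • v) = c ^ 2 * q₂ t y v)
    (hnn : ∀ t y v, 0 ≤ q₂ t y v) (hpos : ∀ t ∈ K, ∀ y, ∀ v ≠ 0, 0 < q₂ t y v)
    (hc₁ : ∀ i, ContinuousOn (fun p : (ℝ × EuclideanSpace ℝ (Fin d)) × F × EuclideanSpace ℝ (Fin d) =>
      q₁ p.1.1 (param N i p.1.2) (p.2.1, mfderiv (𝓡 d) (𝓡 d) (param N i) p.1.2 p.2.2))
      ((K ×ˢ paramDom N i) ×ˢ univ))
    (hc₂ : ∀ i, ContinuousOn (fun p : (ℝ × EuclideanSpace ℝ (Fin d)) × F × EuclideanSpace ℝ (Fin d) =>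
      q₂ p.1.1 (param N i p.1.2) (p.2.1, mfderiv (𝓡 d) (𝓡 d) (param N i) p.1.2 p.2.2))
      ((K ×ˢ paramDom N i) ×ˢ univ)) :
    ∃ C : ℝ, 0 < C ∧ ∀ t ∈ K, ∀ y v, q₁ t y v ≤ C ^ 2 * q₂ t y v := by
  suffices h : ∃ C : ℝ, 0 < C ∧ ∀ x ∈ K ×ˢ (univ : Set N), ∀ v,
      (fun x : ℝ × N => q₁ x.1 x.2) x v ≤ C ^ 2 * (fun x : ℝ × N => q₂ x.1 x.2) x v by
    obtain ⟨C, hC, h⟩ := h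
    exact ⟨C, hC, fun t ht y v => h (t, y) ⟨ht, mem_univ _⟩ v⟩
  refine exists_forall_form_le (hK.prod isCompact_univ) (fun x v => hnn _ _ _) ?_
  rintro ⟨t₀, y₀⟩ ⟨ht₀, -⟩
  obtain ⟨i, hi⟩ := mem_iUnion.1 ((iUnion_piece N).symm ▸ mem_univ y₀)
  let φ := chartAt (EuclideanSpace ℝ (Fin d)) (center N i)
  have hy₀ : y₀ ∈ φ.source := piece_subset N i hi
  let L : EuclideanSpace ℝ (Fin d) → EuclideanSpace ℝ (Fin d) →L[ℝ] EuclideanSpace ℝ (Fin d) :=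
    fun w => mfderiv (𝓡 d) (𝓡 d) (param N i) w
  have hL : ∀ (w : EuclideanSpace ℝ (Fin d)) (c : ℝ) (v : F × EuclideanSpace ℝ (Fin d)),
      ((c • v).1, L w (c • v).2) = c • (v.1, L w v.2) := fun w c v => by
    ext1
    · rfl
    · exact (L w).map_smul c v.2
  -- In coordinates near `y₀` the forms live on a fixed vector space and the local comparison
  -- applies; tangent vectors are carried there by the derivative of the chart.
  obtain ⟨C, hC, h⟩ := exists_eventually_form_le (S := K ×ˢ paramDom N i) (x₀ := (t₀, φ y₀))
    (Q₁ := fun x (v : F × EuclideanSpace ℝ (Fin d)) => q₁ x.1 (param N i x.2) (v.1, L x.2 v.2))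
    (Q₂ := fun x (v : F × EuclideanSpace ℝ (Fin d)) => q₂ x.1 (param N i x.2) (v.1, L x.2 v.2))
    ⟨ht₀, φ.map_source hy₀⟩ (hc₁ i) (hc₂ i)
    (fun x c v => by simp only [hL]; rw [hs₁])
    (fun x c v => by simp only [hL]; rw [hs₂]) (fun v hv => hpos _ ht₀ _ _ fun h0 => hv (by
      have h1 := congrArg Prod.fst h0
      have h2 := (isEmb_param N i).mfderiv_eq_zero (φ y₀) (φ.map_source hy₀) v.2
        (congrArg Prod.snd h0)
      exact Prod.ext h1 h2))
  refine ⟨C, hC, ?_⟩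
  have ht : Tendsto (fun p : ℝ × N => (p.1, φ p.2)) (𝓝[K ×ˢ univ] (t₀, y₀))
      (𝓝[K ×ˢ paramDom N i] (t₀, φ y₀)) := by
    refine tendsto_nhdsWithin_iff.2 ⟨Tendsto.mono_left ?_ nhdsWithin_le_nhds, ?_⟩
    · exact (continuousAt_fst).prodMk_nhds
        ((φ.continuousAt hy₀).comp (f := Prod.snd) (x := (t₀, y₀)) continuousAt_snd)
    · filter_upwards [self_mem_nhdsWithin, mem_nhdsWithin_of_mem_nhds
        ((isOpen_univ.prod φ.open_source).mem_nhds (x := (t₀, y₀)) ⟨mem_univ _, hy₀⟩)] with p hp hp'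
      exact ⟨hp.1, φ.map_source hp'.2⟩
  filter_upwards [ht.eventually h, mem_nhdsWithin_of_mem_nhds
    ((isOpen_univ.prod φ.open_source).mem_nhds (x := (t₀, y₀)) ⟨mem_univ _, hy₀⟩)] with p hp hp' v
  have h3 : param N i (φ p.2) = p.2 := φ.left_inv hp'.2
  have h4 := hp (v.1, mfderiv (𝓡 d) (𝓡 d) φ p.2 v.2)
  have h5 : L (φ p.2) (mfderiv (𝓡 d) (𝓡 d) φ p.2 v.2) = v.2 :=
    mfderiv_param_mfderiv_chart hp'.2 v.2
  simp only [h3] at h4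
  rw [h5] at h4
  exact h4

/-- The metrics `h t` depend continuously on `t ∈ K`. -/
def ContFamily (h : ℝ → Metric N) (K : Set ℝ) : Prop :=
  ContinuousOn (fun p : ℝ × TangentBundle (𝓡 d) N => quad (h p.1) p.2.proj p.2.snd) (K ×ˢ univ)

theorem ContFamily.mono {h : ℝ → Metric N} {K' : Set ℝ} (hh : ContFamily h K) (hK : K' ⊆ K) :
    ContFamily h K' :=
  ContinuousOn.mono hh (prod_mono hK Subset.rfl)

theorem ContFamily.comp {h : ℝ → Metric N} {K' : Set ℝ} {f : ℝ → ℝ} (hh : ContFamily h K)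
    (hf : ContinuousOn f K') (hm : MapsTo f K' K) : ContFamily (h ∘ f) K' :=
  ContinuousOn.comp (f := fun p : ℝ × TangentBundle (𝓡 d) N => (f p.1, p.2)) hh
    ((hf.comp continuousOn_fst fun _ hp => hp.1).prodMk continuousOn_snd) fun _ hp => ⟨hm hp.1, hp.2⟩

theorem contFamily_const (g : Metric N) : ContFamily (fun _ => g) K :=
  ((continuous_quad g).comp continuous_snd).continuousOn

theorem ContFamily.congr {h h' : ℝ → Metric N} (hh : ContFamily h K) (H : ∀ t ∈ K, h' t = h t) :
    ContFamily h' K :=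
  ContinuousOn.congr hh fun p hp => by simp only [H p.1 hp.1]

theorem ContFamily.continuousOn_param {h : ℝ → Metric N} (hh : ContFamily h K) (i : ℕ) :
    ContinuousOn (fun p : (ℝ × EuclideanSpace ℝ (Fin d)) × F × EuclideanSpace ℝ (Fin d) =>
      quad (h p.1.1) (param N i p.1.2) (mfderiv (𝓡 d) (𝓡 d) (param N i) p.1.2 p.2.2))
      ((K ×ˢ paramDom N i) ×ˢ univ) := by
  have h1 := (isEmb_param N i).continuousOn_tangent
  have h2 : ContinuousOn (fun p : (ℝ × EuclideanSpace ℝ (Fin d)) × F × EuclideanSpace ℝ (Fin d) =>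
      (p.1.1, (⟨param N i p.1.2, mfderiv (𝓡 d) (𝓡 d) (param N i) p.1.2 p.2.2⟩ :
        TangentBundle (𝓡 d) N))) ((K ×ˢ paramDom N i) ×ˢ univ) :=
    ContinuousOn.prodMk (by fun_prop) (h1.comp (f := fun p : (ℝ × EuclideanSpace ℝ (Fin d)) ×
      F × EuclideanSpace ℝ (Fin d) => (p.1.2, p.2.2)) (by fun_prop)
      fun _ hp => ⟨hp.1.2, mem_univ _⟩)
  exact ContinuousOn.comp hh h2 fun _ hp => ⟨hp.1.1, mem_univ _⟩

/-- Two continuous families of metrics over a compact parameter set are uniformly equivalent. -/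
theorem ContFamily.exists_le [CompactSpace N] (hK : IsCompact K) {h h' : ℝ → Metric N}
    (hh : ContFamily h K) (hh' : ContFamily h' K) :
    ∃ C : ℝ, 0 < C ∧ ∀ t ∈ K, ∀ y (v : TangentSpace (𝓡 d) y),
      quad (h t) y v ≤ C ^ 2 * quad (h' t) y v := by
  -- With the zero space as extra factor, the comparison concerns `T_y N` alone.
  obtain ⟨C, hC, H⟩ := exists_forall_tangent_le (F := EuclideanSpace ℝ (Fin 0)) hK
    (q₁ := fun t y v => quad (h t) y v.2) (q₂ := fun t y v => quad (h' t) y v.2)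
    (fun t y c v => quad_smul _ _ _ _) (fun t y c v => quad_smul _ _ _ _)
    (fun t y v => quad_nonneg _ _ _) (fun t _ y v hv => quad_pos _ _ fun h0 => hv
      (Prod.ext (Subsingleton.elim _ _) h0)) hh.continuousOn_param hh'.continuousOn_param
  exact ⟨C, hC, fun t ht y v => H t ht y ((0 : EuclideanSpace ℝ (Fin 0)), v)⟩

/-- On a compact part of its domain, the pullback of a metric to `ℝ × N` is uniformly equivalent to
the warped product of continuous families. -/
theorem exists_warped_le [CompactSpace N] (hK : IsCompact K) {h : ℝ → Metric N}
    (hh : ContFamily h K) {lam : ℝ → ℝ} (hlam : ContinuousOn lam K) (hpos : ∀ t ∈ K, lam t ≠ 0)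
    (g : Metric M) {Ψ : ℝ × N → M} {O : Set (ℝ × N)} (hΨ : IsEmb (𝓘(ℝ, ℝ).prod (𝓡 d)) (𝓡 n) Ψ O)
    (hO : K ×ˢ univ ⊆ O) :
    ∃ C : ℝ, 0 < C ∧ ∀ t ∈ K, ∀ y (s : ℝ) (v : TangentSpace (𝓡 d) y),
      quad g (Ψ (t, y)) (mfderiv (𝓘(ℝ, ℝ).prod (𝓡 d)) (𝓡 n) Ψ (t, y)
        ((s, v) : ℝ × EuclideanSpace ℝ (Fin d))) ≤ C ^ 2 * (s ^ 2 + lam t ^ 2 * quad (h t) y v) ∧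
      s ^ 2 + lam t ^ 2 * quad (h t) y v ≤ C ^ 2 * quad g (Ψ (t, y))
        (mfderiv (𝓘(ℝ, ℝ).prod (𝓡 d)) (𝓡 n) Ψ (t, y)
          ((s, v) : ℝ × EuclideanSpace ℝ (Fin d))) := by
  let L : ∀ t y, ℝ × EuclideanSpace ℝ (Fin d) →L[ℝ] TangentSpace (𝓡 n) (Ψ (t, y)) :=
    fun t y => mfderiv (𝓘(ℝ, ℝ).prod (𝓡 d)) (𝓡 n) Ψ (t, y)
  have hs₁ : ∀ t y (c : ℝ) v, quad g (Ψ (t, y)) (L t y (c • v)) =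
      c ^ 2 * quad g (Ψ (t, y)) (L t y v) := fun t y c v => by rw [map_smul, quad_smul]
  have hs₂ : ∀ t (y : N) (c : ℝ) (v : ℝ × EuclideanSpace ℝ (Fin d)), (c • v).1 ^ 2 +
      lam t ^ 2 * quad (h t) y (c • v).2 = c ^ 2 * (v.1 ^ 2 + lam t ^ 2 * quad (h t) y v.2) :=
    fun t y c v => by
      have : quad (h t) y (c • v).2 = c ^ 2 * quad (h t) y v.2 := quad_smul _ _ _ _
      rw [this, Prod.smul_fst, smul_eq_mul]; ring
  have hn₂ : ∀ t (y : N) (v : ℝ × EuclideanSpace ℝ (Fin d)),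
      0 ≤ v.1 ^ 2 + lam t ^ 2 * quad (h t) y v.2 := fun t y v => by
    have := quad_nonneg (h t) y v.2
    positivity
  have hp₂ : ∀ t ∈ K, ∀ (y : N) (v : ℝ × EuclideanSpace ℝ (Fin d)), v ≠ 0 →
      0 < v.1 ^ 2 + lam t ^ 2 * quad (h t) y v.2 := fun t ht y v hv => by
    have := quad_nonneg (h t) y v.2
    have hl : 0 < lam t ^ 2 := by have := hpos t ht; positivity
    by_cases h2 : v.2 = 0
    · have h1 : v.1 ≠ 0 := fun h1 => hv (Prod.ext h1 h2)
      have : 0 < v.1 ^ 2 := by positivity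
      nlinarith
    · have := quad_pos (h t) y (v := v.2) h2
      have : 0 < lam t ^ 2 * quad (h t) y v.2 := mul_pos hl this
      nlinarith [sq_nonneg v.1]
  have hp₁ : ∀ t ∈ K, ∀ (y : N) (v : ℝ × EuclideanSpace ℝ (Fin d)), v ≠ 0 →
      0 < quad g (Ψ (t, y)) (L t y v) := fun t ht y v hv => quad_pos _ _ fun h0 => hv
        (hΨ.mfderiv_eq_zero _ (hO ⟨ht, mem_univ _⟩) v h0)
  have hc₁ : ∀ i, ContinuousOn (fun p : (ℝ × EuclideanSpace ℝ (Fin d)) × ℝ ×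
      EuclideanSpace ℝ (Fin d) => quad g (Ψ (p.1.1, param N i p.1.2)) (L p.1.1 (param N i p.1.2)
        (p.2.1, mfderiv (𝓡 d) (𝓡 d) (param N i) p.1.2 p.2.2))) ((K ×ˢ paramDom N i) ×ˢ univ) := by
    intro i
    refine ((IsEmb.continuousOn_pq g (isEmb_comp_prodMap_param hΨ i)).mono
      (prod_mono (fun x hx => ⟨⟨mem_univ _, hx.2⟩, hO ⟨hx.1, mem_univ _⟩⟩) Subset.rfl)).congr ?_
    rintro ⟨⟨t, w⟩, s, v⟩ ⟨⟨ht, hw⟩, -⟩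
    exact (mfderiv_comp_prodMap_param hΨ g hw (hO ⟨ht, mem_univ _⟩) s v).symm
  have hc₂ : ∀ i, ContinuousOn (fun p : (ℝ × EuclideanSpace ℝ (Fin d)) × ℝ ×
      EuclideanSpace ℝ (Fin d) => p.2.1 ^ 2 + lam p.1.1 ^ 2 * quad (h p.1.1) (param N i p.1.2)
        (mfderiv (𝓡 d) (𝓡 d) (param N i) p.1.2 p.2.2)) ((K ×ˢ paramDom N i) ×ˢ univ) := by
    intro i
    refine ContinuousOn.add (by fun_prop) (ContinuousOn.mul (ContinuousOn.pow ?_ 2)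
      (hh.continuousOn_param i))
    exact hlam.comp (by fun_prop) fun _ hp => hp.1.1
  obtain ⟨C, hC, h₁⟩ := exists_forall_tangent_le hK
    (q₁ := fun t y v => quad g (Ψ (t, y)) (L t y v))
    (q₂ := fun t y v => v.1 ^ 2 + lam t ^ 2 * quad (h t) y v.2) hs₁ hs₂ hn₂ hp₂ hc₁ hc₂
  obtain ⟨C', hC', h₂⟩ := exists_forall_tangent_le hK
    (q₂ := fun t y v => quad g (Ψ (t, y)) (L t y v))
    (q₁ := fun t y v => v.1 ^ 2 + lam t ^ 2 * quad (h t) y v.2) hs₂ hs₁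
    (fun t y v => quad_nonneg _ _ _) hp₁ hc₂ hc₁
  refine ⟨max C C', lt_max_of_lt_left hC, fun t ht y s v => ⟨?_, ?_⟩⟩
  · refine (h₁ t ht y (s, v)).trans (mul_le_mul_of_nonneg_right ?_ (hn₂ t y (s, v)))
    exact pow_le_pow_left₀ hC.le (le_max_left _ _) 2
  · refine (h₂ t ht y (s, v)).trans (mul_le_mul_of_nonneg_right ?_ (quad_nonneg _ _ _))
    exact pow_le_pow_left₀ hC'.le (le_max_right _ _) 2

end Family

/-! ### Geometry of the conic end -/

section Cone

open Filter Topology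

/-- The times in `[0, 1]` spent outside `U` form a compact set, whose least element is the first
exit. -/
theorem exists_first_exit {X : Type*} [TopologicalSpace X] {γ : ℝ → X} (hγ : Continuous γ)
    {U : Set X} (hU : IsOpen U) (h0 : γ 0 ∈ U) :
    (∀ τ ∈ Icc (0 : ℝ) 1, γ τ ∈ U) ∨
      ∃ τ₁ ∈ Ioc (0 : ℝ) 1, γ τ₁ ∉ U ∧ ∀ τ ∈ Ico 0 τ₁, γ τ ∈ U := by
  by_cases h : ∀ τ ∈ Icc (0 : ℝ) 1, γ τ ∈ U
  · exact Or.inl h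
  right
  push Not at h
  have hc : IsCompact (Icc (0 : ℝ) 1 ∩ γ ⁻¹' Uᶜ) :=
    isCompact_Icc.inter_right (hU.isClosed_compl.preimage hγ)
  obtain ⟨τ₁, h1, h2⟩ := hc.exists_isLeast (let ⟨τ, h1, h2⟩ := h; ⟨τ, h1, h2⟩)
  refine ⟨τ₁, ⟨lt_of_le_of_ne h1.1.1 fun e => h1.2 (e ▸ h0), h1.1.2⟩, h1.2, fun τ hτ => ?_⟩
  by_contra h3
  exact hτ.2.not_ge (h2 ⟨⟨hτ.1, hτ.2.le.trans h1.1.2⟩, h3⟩)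

/-- A map that dilates tangent vectors by at most `C` dilates distances by at most `C`. -/
theorem gdist_image_lt {n d : ℕ} {M : Mfd.{u} n} {N : Mfd.{u} d} (h : Metric N) (g : Metric M)
    {f : N → M} {O : Set N} (hO : IsOpen O) (hf : ContMDiffOn (𝓡 d) (𝓡 n) 1 f O) {C : ℝ}
    (hC : 0 < C) {x y : N} {r : ℝ}
    (hO' : ∀ z, gdist h x z < ENNReal.ofReal r → z ∈ O)
    (H : ∀ z, gdist h x z < ENNReal.ofReal r → ∀ v : TangentSpace (𝓡 d) z,
      quad g (f z) (mfderiv (𝓡 d) (𝓡 n) f z v) ≤ C ^ 2 * quad h z v)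
    (hxy : gdist h x y < ENNReal.ofReal r) :
    gdist g (f x) (f y) < ENNReal.ofReal (C * r) := by
  obtain ⟨γ, h0, h1, hγ, hl⟩ := exists_glen_lt h hxy
  -- All points of a path shorter than `r` are within `r` of its start, so the hypotheses are needed
  -- on the ball only.
  have hz : ∀ t ∈ Icc (0 : ℝ) 1, gdist h x (γ t) < ENNReal.ofReal r := fun t ht => by
    rw [← h0]
    exact ((gdist_le_glen h ht.1 hγ.contMDiffOn).trans (glen_mono h γ le_rfl ht.2)).trans_lt hl
  have h2 := gdist_comp_le h g hO hf zero_le_one hC.le (fun t _ => hγ.contMDiffAt)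
    (fun t ht => hO' _ (hz t ht)) (fun t ht => H _ (hz t ht))
  rw [h0, h1] at h2
  refine h2.trans_lt ?_
  rw [ENNReal.ofReal_mul hC.le]
  exact ENNReal.mul_lt_mul_right (ENNReal.ofReal_pos.2 hC).ne' ENNReal.ofReal_ne_top hl

variable {k n d : ℕ} {Z : QACData.{u} n} {Y : BlowupData.{u} d}
  {Φ : PartialDiffeomorph (𝓘(ℝ, ℝ).prod (𝓡 d)) (𝓡 n) (ℝ × Y.Y) Z.Z ∞} {C₀ : ℝ}

/-- `Z` is the cone over `Y` outside a compact set, by means of `Φ`, with a metric that is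
uniformly equivalent to the one of the model. -/
structure IsCone (k : ℕ) (Z : QACData.{u} n) (Y : BlowupData.{u} d)
    (Φ : PartialDiffeomorph (𝓘(ℝ, ℝ).prod (𝓡 d)) (𝓡 n) (ℝ × Y.Y) Z.Z ∞) (C₀ : ℝ) : Prop where
  one_le : 1 ≤ C₀
  subset_source : Ici 1 ×ˢ univ ⊆ Φ.source
  isCompact_core : IsCompact (Φ '' (Ioi 1 ×ˢ univ))ᶜ
  rho_core : ∀ z ∉ Φ '' (Ioi 1 ×ˢ univ), Z.ρ z = 1
  w_core : ∀ z ∉ Φ '' (Ioi 1 ×ˢ univ), ∀ j < k, Z.w j z = 1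
  rho_end : ∀ t : ℝ, 1 < t → ∀ y : Y.Y, Z.ρ (Φ (t, y)) = t
  w_end : ∀ t : ℝ, 1 < t → ∀ y : Y.Y, ∀ j < k, Z.w j (Φ (t, y)) = Y.σ (1 / t) j y
  measurable_w : ∀ j < k, Measurable (Z.w j)
  quad_le : ∀ t : ℝ, 1 ≤ t → ∀ y (s : ℝ) (v : TangentSpace (𝓡 d) y),
    quad Z.g (Φ (t, y)) (mfderiv (𝓘(ℝ, ℝ).prod (𝓡 d)) (𝓡 n) Φ (t, y)
      ((s, v) : ℝ × EuclideanSpace ℝ (Fin d))) ≤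
        C₀ ^ 2 * (s ^ 2 + t ^ 2 * quad (Y.h (1 / t)) y v)
  le_quad : ∀ t : ℝ, 1 ≤ t → ∀ y (s : ℝ) (v : TangentSpace (𝓡 d) y),
    s ^ 2 + t ^ 2 * quad (Y.h (1 / t)) y v ≤
      C₀ ^ 2 * quad Z.g (Φ (t, y)) (mfderiv (𝓘(ℝ, ℝ).prod (𝓡 d)) (𝓡 n) Φ (t, y)
        ((s, v) : ℝ × EuclideanSpace ℝ (Fin d)))

theorem one_div_mem_Ioc {t : ℝ} (ht : 1 ≤ t) : 1 / t ∈ Ioc (0 : ℝ) 1 :=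
  ⟨by positivity, (div_le_one (by linarith)).2 ht⟩

/-- Beyond some `T` the error is at most half of the model metric. On `[1, T]` both metrics are
continuous and positive definite over a compact set, hence uniformly equivalent. -/
theorem IsConicOver.exists_isCone [CompactSpace Y.Y] (hY : ContFamily Y.h (Ioc 0 1))
    (h : IsConicOver k Z Y) : ∃ Φ C₀, IsCone k Z Y Φ C₀ := by
  obtain ⟨Φ, r₀, hr₀, hsrc, hcore, hrc, hend, hw, C, ν, hν, hm⟩ := h
  have hsub : Ici (1 : ℝ) ×ˢ (univ : Set Y.Y) ⊆ Φ.source := by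
    rw [hsrc]; exact prod_mono (fun t ht => hr₀.trans_le ht) Subset.rfl
  have hlim : ∀ᶠ t : ℝ in atTop, C * t ^ (-ν) < 1 / 2 := by
    have := (tendsto_rpow_neg_atTop hν).const_mul C
    rw [mul_zero] at this
    exact this.eventually (gt_mem_nhds (by norm_num))
  obtain ⟨T, hT⟩ := eventually_atTop.1 hlim
  have hfam : ContFamily (Y.h ∘ fun t : ℝ => 1 / t) (Icc 1 T) :=
    hY.comp (continuousOn_const.div continuousOn_id fun t ht =>
      (one_pos.trans_le ht.1 : (0 : ℝ) < t).ne') fun t ht => one_div_mem_Ioc ht.1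
  obtain ⟨C₁, hC₁, h1⟩ := exists_warped_le isCompact_Icc hfam continuousOn_id
    (fun t ht => (one_pos.trans_le ht.1 : (0 : ℝ) < t).ne') Z.g
    (isEmb_partialDiffeomorph Φ) ((prod_mono (fun t ht => ht.1) Subset.rfl).trans hsub)
  have hnn : ∀ (t : ℝ) (y : Y.Y) (s : ℝ) (v : TangentSpace (𝓡 d) y),
      0 ≤ s ^ 2 + t ^ 2 * quad (Y.h (1 / t)) y v := fun t y s v => by
    have := quad_nonneg (Y.h (1 / t)) y v
    positivity
  have hCC : C₁ ^ 2 ≤ max C₁ 2 ^ 2 := pow_le_pow_left₀ hC₁.le (le_max_left _ _) 2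
  -- An error of at most half the model metric gives equivalence with factor `2` in both directions.
  have hC2 : (2 : ℝ) ≤ max C₁ 2 ^ 2 := by nlinarith [le_max_right C₁ 2]
  refine ⟨Φ, max C₁ 2, le_max_of_le_right (by norm_num), hsub, hcore, fun z hz => (hrc z hz).1,
    fun z hz => (hrc z hz).2, fun t ht y => (hend t ht y).1, fun t ht y => (hend t ht y).2, hw,
    fun t ht y s v => ?_, fun t ht y s v => ?_⟩
  · by_cases htT : t ≤ T
    · exact (h1 t ⟨ht, htT⟩ y s v).1.trans (mul_le_mul_of_nonneg_right hCC (hnn t y s v))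
    · have h2 := (abs_le.1 (hm t ht y s v)).2
      have h3 := hT t (not_le.1 htT).le
      have h4 := hnn t y s v
      nlinarith
  · by_cases htT : t ≤ T
    · exact (h1 t ⟨ht, htT⟩ y s v).2.trans (mul_le_mul_of_nonneg_right hCC (quad_nonneg _ _ _))
    · have h2 := (abs_le.1 (hm t ht y s v)).1
      have h3 := hT t (not_le.1 htT).le
      have h4 := hnn t y s v
      have h5 := quad_nonneg Z.g (Φ (t, y)) (mfderiv (𝓘(ℝ, ℝ).prod (𝓡 d)) (𝓡 n) Φ (t, y)
        ((s, v) : ℝ × EuclideanSpace ℝ (Fin d)))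
      nlinarith

namespace IsCone

variable (H : IsCone k Z Y Φ C₀)

include H

theorem pos : 0 < C₀ := one_pos.trans_le H.one_le

theorem mem_source {t : ℝ} (ht : 1 ≤ t) (y : Y.Y) : (t, y) ∈ Φ.source :=
  H.subset_source ⟨ht, mem_univ _⟩

/-- The differentials of `Φ` and of its inverse are both injective. -/
theorem finrank_eq : 1 + d = n := by
  obtain ⟨y⟩ : Nonempty Y.Y := inferInstance
  have hx := H.mem_source le_rfl y
  let A : ℝ × EuclideanSpace ℝ (Fin d) →L[ℝ] EuclideanSpace ℝ (Fin n) :=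
    mfderiv (𝓘(ℝ, ℝ).prod (𝓡 d)) (𝓡 n) Φ (1, y)
  let B : EuclideanSpace ℝ (Fin n) →L[ℝ] ℝ × EuclideanSpace ℝ (Fin d) :=
    mfderiv (𝓡 n) (𝓘(ℝ, ℝ).prod (𝓡 d)) Φ.symm (Φ (1, y))
  have h1 : LinearMap.ker (A : ℝ × EuclideanSpace ℝ (Fin d) →ₗ[ℝ] EuclideanSpace ℝ (Fin n)) = ⊥ :=
    LinearMap.ker_eq_bot'.2 fun v hv => (isEmb_partialDiffeomorph Φ).mfderiv_eq_zero _ hx v hv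
  have h2 : LinearMap.ker (B : EuclideanSpace ℝ (Fin n) →ₗ[ℝ] ℝ × EuclideanSpace ℝ (Fin d)) = ⊥ :=
    LinearMap.ker_eq_bot'.2 fun v hv =>
      (isEmb_partialDiffeomorph Φ.symm).mfderiv_eq_zero _ (Φ.map_source hx) v hv
  have h3 := LinearMap.finrank_le_finrank_of_injective (LinearMap.ker_eq_bot.1 h1)
  have h4 := LinearMap.finrank_le_finrank_of_injective (LinearMap.ker_eq_bot.1 h2)
  simp only [Module.finrank_prod, Module.finrank_self, finrank_euclideanSpace_fin] at h3 h4
  omega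

theorem isOpen_image {S : Set ℝ} (hS : IsOpen S) (h1 : S ⊆ Ici 1) :
    IsOpen (Φ '' (S ×ˢ univ)) :=
  Φ.toOpenPartialHomeomorph.isOpen_image_of_subset_source (hS.prod isOpen_univ)
    ((prod_mono h1 Subset.rfl).trans H.subset_source)

theorem isCompact_image [CompactSpace Y.Y] {S : Set ℝ} (hS : IsCompact S) (h1 : S ⊆ Ici 1) :
    IsCompact (Φ '' (S ×ˢ univ)) :=
  (hS.prod isCompact_univ).image_of_continuousOn
    ((isEmb_partialDiffeomorph Φ).contMDiffOn.continuousOn.mono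
      ((prod_mono h1 Subset.rfl).trans H.subset_source))

theorem one_le_rho (z : Z.Z) : 1 ≤ Z.ρ z := by
  by_cases hz : z ∈ Φ '' (Ioi 1 ×ˢ univ)
  · obtain ⟨⟨t, y⟩, ht, rfl⟩ := hz
    rw [H.rho_end t ht.1 y]; exact ht.1.le
  · exact (H.rho_core z hz).ge

theorem exists_of_one_lt_rho {z : Z.Z} (hz : 1 < Z.ρ z) : ∃ y, z = Φ (Z.ρ z, y) := by
  by_cases h : z ∈ Φ '' (Ioi 1 ×ˢ univ)
  · obtain ⟨⟨t, y⟩, ht, rfl⟩ := h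
    exact ⟨y, by rw [H.rho_end t ht.1 y]⟩
  · exact absurd (H.rho_core z h) hz.ne'

theorem rho_le_eq {R : ℝ} (hR : 1 ≤ R) :
    {z | Z.ρ z ≤ R} = (Φ '' (Ioi 1 ×ˢ univ))ᶜ ∪ Φ '' (Ioc 1 R ×ˢ univ) := by
  ext z
  by_cases h : z ∈ Φ '' (Ioi 1 ×ˢ univ)
  · obtain ⟨⟨t, y⟩, ht, rfl⟩ := h
    simp only [mem_ofPred_eq, H.rho_end t ht.1 y, mem_union, mem_compl_iff]
    constructor
    · exact fun h => Or.inr ⟨(t, y), ⟨⟨ht.1, h⟩, mem_univ _⟩, rfl⟩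
    · rintro (h | ⟨⟨t', y'⟩, ht', e⟩)
      · exact absurd ⟨(t, y), ht, rfl⟩ h
      · have := Φ.injOn (H.mem_source ht'.1.1.le y') (H.mem_source (le_of_lt ht.1) y) e
        have h1 : t' = t := congrArg Prod.fst this
        exact h1 ▸ ht'.1.2
  · simp only [mem_ofPred_eq, H.rho_core z h, hR, mem_union, true_iff]
    exact Or.inl h

theorem rho_le_subset [CompactSpace Y.Y] (R : ℝ) :
    ∃ K : Set Z.Z, IsCompact K ∧ {z | Z.ρ z ≤ R} ⊆ K := by
  refine ⟨(Φ '' (Ioi 1 ×ˢ univ))ᶜ ∪ Φ '' (Icc 1 (max R 1) ×ˢ univ),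
    H.isCompact_core.union (H.isCompact_image isCompact_Icc fun t ht => ht.1), ?_⟩
  have h1 : {z | Z.ρ z ≤ R} ⊆ {z | Z.ρ z ≤ max R 1} := fun z hz => le_trans (α := ℝ) hz (le_max_left R 1)
  refine h1.trans ((H.rho_le_eq (le_max_right R 1)).subset.trans
    (union_subset_union_right _ (image_mono (prod_mono Ioc_subset_Icc_self Subset.rfl))))

theorem measurable_rho : Measurable Z.ρ := by
  refine measurable_of_Iic fun R => ?_
  by_cases hR : 1 ≤ R
  · have h1 : MeasurableSet (Φ '' (Ioc 1 R ×ˢ univ)) :=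
      measurableSet_image (isEmb_partialDiffeomorph Φ)
        ((prod_mono (fun t ht => ht.1.le) Subset.rfl).trans H.subset_source)
        (measurableSet_Ioc.prod MeasurableSet.univ)
    have h2 := (H.isOpen_image isOpen_Ioi Ioi_subset_Ici_self).measurableSet.compl.union h1
    rw [← H.rho_le_eq hR] at h2
    exact h2
  · convert MeasurableSet.empty
    ext z
    simp only [mem_preimage, mem_Iic, mem_empty_iff_false, iff_false]
    exact fun h => hR ((H.one_le_rho z).trans h)

/-- The radial coordinate is Lipschitz along the end. -/
theorem mfderiv_fst_sq_le {t : ℝ} (ht : 1 ≤ t) (y : Y.Y) (v : TangentSpace (𝓡 n) (Φ (t, y))) :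
    let w : ℝ := mfderiv (𝓡 n) 𝓘(ℝ, ℝ) (fun z => (Φ.symm z).1) (Φ (t, y)) v
    w ^ 2 ≤ C₀ ^ 2 * quad Z.g (Φ (t, y)) v := by
  intro w
  have hx := H.mem_source ht y
  let u : ℝ × EuclideanSpace ℝ (Fin d) :=
    mfderiv (𝓡 n) (𝓘(ℝ, ℝ).prod (𝓡 d)) Φ.symm (Φ (t, y)) v
  have hs : Φ.symm (Φ (t, y)) = (t, y) := Φ.left_inv hx
  have hd : MDifferentiableAt (𝓡 n) (𝓘(ℝ, ℝ).prod (𝓡 d)) Φ.symm (Φ (t, y)) :=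
    (isEmb_partialDiffeomorph Φ.symm).mdifferentiableAt (Φ.map_source hx)
  have h1 : w = u.1 := by
    have := mfderiv_comp (I := 𝓡 n) (I' := 𝓘(ℝ, ℝ).prod (𝓡 d)) (I'' := 𝓘(ℝ, ℝ)) (Φ (t, y))
      (g := (Prod.fst : ℝ × Y.Y → ℝ)) mdifferentiableAt_fst hd
    have h2 : w = mfderiv (𝓡 n) 𝓘(ℝ, ℝ) ((Prod.fst : ℝ × Y.Y → ℝ) ∘ Φ.symm) (Φ (t, y)) v := rfl
    rw [h2, this, mfderiv_fst]
    rfl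
  have h2 : (mfderiv (𝓘(ℝ, ℝ).prod (𝓡 d)) (𝓡 n) Φ (t, y) u : EuclideanSpace ℝ (Fin n)) = v := by
    have := mfderiv_leftInverse (f := Φ.symm) (g := Φ) Φ.open_target (Φ.map_source hx)
      (fun z hz => Φ.right_inv hz) hd (by
        rw [hs]; exact (isEmb_partialDiffeomorph Φ).mdifferentiableAt hx) v
    rw [hs] at this
    exact this
  have h3 := H.le_quad t ht y u.1 u.2
  have h4 : quad Z.g (Φ (t, y)) (mfderiv (𝓘(ℝ, ℝ).prod (𝓡 d)) (𝓡 n) Φ (t, y)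
      ((u.1, u.2) : ℝ × EuclideanSpace ℝ (Fin d))) = quad Z.g (Φ (t, y)) v :=
    congrArg (fun z : EuclideanSpace ℝ (Fin n) => quad Z.g (Φ (t, y)) z) h2
  rw [h4] at h3
  rw [h1]
  have : 0 ≤ t ^ 2 * quad (Y.h (1 / t)) y u.2 := by
    have := quad_nonneg (Y.h (1 / t)) y u.2
    positivity
  linarith

/-- A short path that starts far out on the end stays there. -/
theorem path_stays [CompactSpace Y.Y] {γ : ℝ → Z.Z} (hγ : ContMDiff 𝓘(ℝ, ℝ) (𝓡 n) 1 γ)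
    {t₀ l : ℝ} {y₀ : Y.Y} (h0 : γ 0 = Φ (t₀, y₀)) (hl : glen Z.g γ 0 1 ≤ ENNReal.ofReal l)
    (hl0 : 0 ≤ l) (ht₀ : C₀ * l < t₀ - 1) :
    ∀ τ ∈ Icc (0 : ℝ) 1, γ τ ∈ Φ '' (Icc (t₀ - C₀ * l) (t₀ + C₀ * l) ×ˢ univ) := by
  have hC := H.pos
  have ht1 : 1 < t₀ := by have := mul_nonneg hC.le hl0; linarith
  have hU := H.isOpen_image isOpen_Ioi Ioi_subset_Ici_self
  -- As long as the path has not left the end, the radial coordinate is defined along it and has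
  -- moved by at most `C₀ l`.
  have key : ∀ τ ∈ Icc (0 : ℝ) 1, (∀ τ' ∈ Icc 0 τ, γ τ' ∈ Φ '' (Ioi 1 ×ˢ univ)) →
      γ τ ∈ Φ '' (Icc (t₀ - C₀ * l) (t₀ + C₀ * l) ×ˢ univ) := by
    intro τ hτ hin
    have h1 := abs_sub_le_glen Z.g (f := fun z => (Φ.symm z).1) (O := Φ.target) Φ.open_target
      (contMDiff_fst.comp_contMDiffOn (isEmb_partialDiffeomorph Φ.symm).contMDiffOn) hτ.1 hC.le
      (fun t _ => hγ.contMDiffAt) (fun t ht => by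
        obtain ⟨⟨s, y⟩, hs, e⟩ := hin t ht
        rw [← e]; exact Φ.map_source (H.mem_source (le_of_lt hs.1) y))
      (fun t ht => by
        obtain ⟨⟨s, y⟩, hs, e⟩ := hin t ht
        rw [← e]
        exact H.mfderiv_fst_sq_le (le_of_lt hs.1) y)
    obtain ⟨⟨s, y⟩, hs, e⟩ := hin τ ⟨hτ.1, le_rfl⟩
    have e1 : Φ.symm (γ τ) = (s, y) := by rw [← e]; exact Φ.left_inv (H.mem_source (le_of_lt hs.1) y)
    have e2 : Φ.symm (γ 0) = (t₀, y₀) := by rw [h0]; exact Φ.left_inv (H.mem_source ht1.le y₀)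
    rw [e1, e2] at h1
    have h2 : ENNReal.ofReal |s - t₀| ≤ ENNReal.ofReal (C₀ * l) := by
      rw [ENNReal.ofReal_mul hC.le]
      exact h1.trans (mul_le_mul_right ((glen_mono _ _ le_rfl hτ.2).trans hl) _)
    rw [ENNReal.ofReal_le_ofReal_iff (by positivity), abs_le] at h2
    exact ⟨(s, y), ⟨⟨by linarith, by linarith⟩, mem_univ _⟩, e⟩
  rcases exists_first_exit hγ.continuous hU (h0 ▸ ⟨(t₀, y₀), ⟨ht1, mem_univ _⟩, rfl⟩) with
    hall | ⟨τ₁, hτ₁, hout, hin⟩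
  · exact fun τ hτ => key τ hτ fun τ' hτ' => hall τ' ⟨hτ'.1, hτ'.2.trans hτ.2⟩
  · exfalso
    -- Up to a first exit time the path lies in a band that is compact and, as `t₀ - C₀ l > 1`,
    -- contained in the open end. The exit point would lie in the same band, a contradiction.
    have hsub : Icc (t₀ - C₀ * l) (t₀ + C₀ * l) ⊆ Ioi 1 := fun t ht => by
      have := ht.1; rw [mem_Ioi]; linarith
    have hcl := (H.isCompact_image isCompact_Icc (hsub.trans Ioi_subset_Ici_self)).isClosed.preimage
      hγ.continuous
    have h1 : Ico 0 τ₁ ⊆ γ ⁻¹' (Φ '' (Icc (t₀ - C₀ * l) (t₀ + C₀ * l) ×ˢ univ)) := fun τ hτ =>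
      key τ ⟨hτ.1, hτ.2.le.trans hτ₁.2⟩ fun τ' hτ' => hin τ' ⟨hτ'.1, hτ'.2.trans_lt hτ.2⟩
    have h2 := closure_minimal h1 hcl
    rw [closure_Ico hτ₁.1.ne] at h2
    exact hout (image_mono (prod_mono hsub Subset.rfl) (h2 ⟨hτ₁.1.le, le_rfl⟩))

/-- If `ρ q` were larger, a path of length less than `r` from `q` to `p` would start far enough out
to remain on the end, where the radial coordinate is `C₀`-Lipschitz. Running the path from the outer
point avoids any analysis near the core. -/
theorem rho_le_add [CompactSpace Y.Y] {p q : Z.Z} {r : ℝ} (hr : 0 ≤ r)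
    (h : gdist Z.g p q < ENNReal.ofReal r) : Z.ρ q ≤ Z.ρ p + C₀ * r := by
  have hC := H.pos
  by_contra! hlt
  have hp := H.one_le_rho p
  have h1 : C₀ * r < Z.ρ q - 1 := by linarith
  have hq1 : 1 < Z.ρ q := by have := mul_nonneg hC.le hr; linarith
  obtain ⟨y, hy⟩ := H.exists_of_one_lt_rho hq1
  rw [gdist_comm] at h
  obtain ⟨γ, h0, h1', hγ, hl⟩ := exists_glen_lt Z.g h
  obtain ⟨⟨t, y'⟩, ht, e⟩ := H.path_stays hγ (h0.trans hy) hl.le hr h1 1 ⟨zero_le_one, le_rfl⟩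
  have ht1 : 1 < t := by have := ht.1.1; linarith
  have : Z.ρ p = t := by rw [← h1', ← e, H.rho_end t ht1]
  have := ht.1.1
  linarith

theorem contMDiffAt_radial {t : ℝ} (ht : 1 ≤ t) (y : Y.Y) :
    ContMDiffAt 𝓘(ℝ, ℝ) (𝓡 n) 1 (fun τ => Φ (τ, y)) t :=
  ((isEmb_partialDiffeomorph Φ).contMDiffAt (H.mem_source ht y)).comp t
    (contMDiffAt_id.prodMk contMDiffAt_const)

theorem glen_radial_le {t t' : ℝ} (ht : 1 ≤ t) (y : Y.Y) :
    glen Z.g (fun τ => Φ (τ, y)) t t' ≤ ENNReal.ofReal (C₀ * (t' - t)) := by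
  unfold glen
  calc _ ≤ ∫⁻ _ in Icc t t', ENNReal.ofReal C₀ := setLIntegral_mono' measurableSet_Icc fun τ hτ => by
        refine ENNReal.ofReal_le_ofReal (Real.sqrt_le_iff.2 ⟨H.pos.le, ?_⟩)
        have h1 : (mfderiv 𝓘(ℝ, ℝ) (𝓡 n) (fun τ => Φ (τ, y)) τ (1 : ℝ) :
            EuclideanSpace ℝ (Fin n)) = mfderiv (𝓘(ℝ, ℝ).prod (𝓡 d)) (𝓡 n) Φ (τ, y)
              (((1 : ℝ), (0 : EuclideanSpace ℝ (Fin d))) : ℝ × EuclideanSpace ℝ (Fin d)) := by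
          have h2 := mfderiv_comp (I := 𝓘(ℝ, ℝ)) (I' := 𝓘(ℝ, ℝ).prod (𝓡 d)) (I'' := 𝓡 n) τ
            (g := Φ) (f := fun τ : ℝ => (τ, y))
            ((isEmb_partialDiffeomorph Φ).mdifferentiableAt (H.mem_source (ht.trans hτ.1) y))
            (mdifferentiableAt_id.prodMk mdifferentiableAt_const)
          rw [mfderiv_prod_left] at h2
          exact congrArg (fun L : ℝ →L[ℝ] EuclideanSpace ℝ (Fin n) => L 1) h2
        have h2 := H.quad_le τ (ht.trans hτ.1) y 1 (0 : EuclideanSpace ℝ (Fin d))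
        have h3 : quad (Y.h (1 / τ)) y (0 : EuclideanSpace ℝ (Fin d)) = 0 := quad_zero _ _
        rw [h3] at h2
        calc _ = quad Z.g (Φ (τ, y)) (mfderiv (𝓘(ℝ, ℝ).prod (𝓡 d)) (𝓡 n) Φ (τ, y)
              (((1 : ℝ), (0 : EuclideanSpace ℝ (Fin d))) : ℝ × EuclideanSpace ℝ (Fin d))) :=
              congrArg (fun z : EuclideanSpace ℝ (Fin n) => quad Z.g (Φ (τ, y)) z) h1
          _ ≤ _ := h2.trans (by simp)
    _ = _ := by
      rw [setLIntegral_const, Real.volume_Icc, ← ENNReal.ofReal_mul H.pos.le]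

theorem gdist_radial_le {t t' : ℝ} (ht : 1 ≤ t) (htt : t ≤ t') (y : Y.Y) :
    gdist Z.g (Φ (t, y)) (Φ (t', y)) ≤ ENNReal.ofReal (C₀ * (t' - t)) :=
  (gdist_le_glen Z.g (γ := fun τ => Φ (τ, y)) htt
    fun _ hτ => (H.contMDiffAt_radial (ht.trans hτ.1) y).contMDiffWithinAt).trans
      (H.glen_radial_le ht y)

theorem gdist_slice_lt {t : ℝ} (ht : 1 ≤ t) {y y' : Y.Y} {δ : ℝ}
    (h : gdist (Y.h (1 / t)) y y' < ENNReal.ofReal δ) :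
    gdist Z.g (Φ (t, y)) (Φ (t, y')) < ENNReal.ofReal (C₀ * t * δ) := by
  have ht0 : 0 < t := by linarith
  refine gdist_image_lt (Y.h (1 / t)) Z.g (f := fun y => Φ (t, y)) (O := univ) isOpen_univ
    (fun z _ => (((isEmb_partialDiffeomorph Φ).contMDiffAt (H.mem_source ht z)).comp z
      (contMDiffAt_const.prodMk contMDiffAt_id)).contMDiffWithinAt) (mul_pos H.pos ht0)
    (fun z _ => mem_univ _) (fun z _ v => ?_) h
  have h1 : (mfderiv (𝓡 d) (𝓡 n) (fun y => Φ (t, y)) z v :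
      EuclideanSpace ℝ (Fin n)) = mfderiv (𝓘(ℝ, ℝ).prod (𝓡 d)) (𝓡 n) Φ (t, z)
        (((0 : ℝ), v) : ℝ × EuclideanSpace ℝ (Fin d)) := by
    have h2 := mfderiv_comp (I := 𝓡 d) (I' := 𝓘(ℝ, ℝ).prod (𝓡 d)) (I'' := 𝓡 n) z
      (g := Φ) (f := fun y : Y.Y => (t, y))
      ((isEmb_partialDiffeomorph Φ).mdifferentiableAt (H.mem_source ht z))
      (mdifferentiableAt_const.prodMk mdifferentiableAt_id)
    rw [mfderiv_prod_right] at h2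
    exact congrArg (fun L : EuclideanSpace ℝ (Fin d) →L[ℝ] EuclideanSpace ℝ (Fin n) => L v) h2
  have h2 := H.quad_le t ht z 0 v
  calc _ = quad Z.g (Φ (t, z)) (mfderiv (𝓘(ℝ, ℝ).prod (𝓡 d)) (𝓡 n) Φ (t, z)
        (((0 : ℝ), v) : ℝ × EuclideanSpace ℝ (Fin d))) :=
        congrArg (fun x : EuclideanSpace ℝ (Fin n) => quad Z.g (Φ (t, z)) x) h1
    _ ≤ _ := h2.trans (le_of_eq (by ring))

end IsCone

end Cone

/-! ### Weighted volumes of QAC spaces -/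

section Weight

open Topology

theorem exists_le_rpow {A : ℝ} (hA : 0 < A) (B e : ℝ) :
    ∃ κ : ℝ, 0 < κ ∧ ∀ x ∈ Set.Icc A B, κ ≤ x ^ e :=
  isCompact_Icc.exists_forall_le'
    (continuousOn_id.rpow_const fun _ hx => Or.inl (hA.trans_le hx.1).ne')
    fun _ hx => Real.rpow_pos_of_pos (hA.trans_le hx.1) e

theorem exists_rpow_le {A : ℝ} (hA : 0 < A) (B e : ℝ) :
    ∃ C : ℝ, 0 < C ∧ ∀ x ∈ Set.Icc A B, x ^ e ≤ C := by
  obtain ⟨κ, hκ, h⟩ := exists_le_rpow hA B (-e)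
  refine ⟨κ⁻¹, inv_pos.2 hκ, fun x hx => ?_⟩
  have hx0 := hA.trans_le hx.1
  have := h x hx
  rw [Real.rpow_neg hx0.le] at this
  exact (le_inv_comm₀ hκ (Real.rpow_pos_of_pos hx0 e)).1 this

theorem exists_le_prod_rpow {A : ℝ} (hA : 0 < A) (B : ℝ) (k : ℕ) (b : ℕ → ℝ) :
    ∃ κ : ℝ, 0 < κ ∧ ∀ x : ℕ → ℝ, (∀ j < k, x j ∈ Set.Icc A B) → κ ≤ ∏ j ∈ Finset.range k, x j ^ b j := by
  choose κ hκ h using fun j => exists_le_rpow hA B (b j)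
  refine ⟨∏ j ∈ Finset.range k, κ j, Finset.prod_pos fun j _ => hκ j, fun x hx => ?_⟩
  exact Finset.prod_le_prod (fun j _ => (hκ j).le) fun j hj => h j _ (hx j (Finset.mem_range.1 hj))

/-- The density `ρ^a w^b`. -/
def weight {n : ℕ} (k : ℕ) (Z : QACData.{u} n) (a : ℝ) (b : ℕ → ℝ) (z : Z.Z) : ℝ≥0∞ :=
  ENNReal.ofReal (Z.ρ z ^ a * ∏ j ∈ Finset.range k, Z.w j z ^ b j)

/-- The density `σ^b`. -/
def resWeight {d : ℕ} (k : ℕ) (Y : BlowupData.{u} d) (b : ℕ → ℝ) (ε : ℝ) (y : Y.Y) : ℝ≥0∞ :=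
  ENNReal.ofReal (∏ j ∈ Finset.range k, Y.σ ε j y ^ b j)

/-- The properties of resolution blowups that control weighted volumes. -/
structure HasVolumeBounds (k : ℕ) (m : ℕ → ℕ) {d : ℕ} (Y : BlowupData.{u} d) : Prop where
  compactSpace : CompactSpace Y.Y
  contFamily : ContFamily Y.h (Ioc 0 1)
  measurable_σ : ∀ ε ∈ Ioc (0 : ℝ) 1, ∀ j < k, Measurable (Y.σ ε j)
  σ_mem : ∀ ε ∈ Ioc (0 : ℝ) 1, ∀ j < k, ∀ y, Y.σ ε j y ∈ Set.Icc ε 1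
  upper : ∀ b : ℕ → ℝ, (∀ j < k, 0 < ∑ i ∈ Finset.range (j + 1), b i + m j) →
    ∃ C : ℝ≥0∞, C ≠ ⊤ ∧ ∀ ε ∈ Ioc (0 : ℝ) 1, ∫⁻ y, resWeight k Y b ε y ∂vol (Y.h ε) ≤ C
  lower : ∀ (b : ℕ → ℝ) (δ : ℝ), 0 < δ → ∃ C : ℝ≥0∞, C ≠ 0 ∧ ∀ ε ∈ Ioc (0 : ℝ) 1, ∀ y,
    C ≤ ∫⁻ y' in gball (Y.h ε) y δ, resWeight k Y b ε y' ∂vol (Y.h ε)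

variable {k n d : ℕ} {Z : QACData.{u} n} {Y : BlowupData.{u} d} {m : ℕ → ℕ}
  {Φ : PartialDiffeomorph (𝓘(ℝ, ℝ).prod (𝓡 d)) (𝓡 n) (ℝ × Y.Y) Z.Z ∞} {C₀ : ℝ}

theorem HasVolumeBounds.measurable_resWeight (hY : HasVolumeBounds k m Y) (b : ℕ → ℝ) {ε : ℝ}
    (hε : ε ∈ Ioc (0 : ℝ) 1) : Measurable (resWeight k Y b ε) :=
  (Finset.measurable_prod _ fun j hj =>
    (hY.measurable_σ ε hε j (Finset.mem_range.1 hj)).pow_const _).ennreal_ofReal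

namespace IsCone

variable (H : IsCone k Z Y Φ C₀) (hY : HasVolumeBounds k m Y)

include H

theorem measurable_weight (a : ℝ) (b : ℕ → ℝ) : Measurable (weight k Z a b) :=
  ((H.measurable_rho.pow_const _).mul (Finset.measurable_prod _ fun j hj =>
    (H.measurable_w j (Finset.mem_range.1 hj)).pow_const _)).ennreal_ofReal

theorem weight_core (a : ℝ) (b : ℕ → ℝ) {z : Z.Z} (hz : z ∉ Φ '' (Ioi 1 ×ˢ univ)) :
    weight k Z a b z = 1 := by
  unfold weight
  rw [H.rho_core z hz, Real.one_rpow, one_mul, Finset.prod_eq_one, ENNReal.ofReal_one]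
  intro j hj
  rw [H.w_core z hz j (Finset.mem_range.1 hj), Real.one_rpow]

/-- Separation of variables on the end: the radial factor times the weight of the cross-section at
`ε = 1/t`. -/
theorem weight_end (a : ℝ) (b : ℕ → ℝ) {t : ℝ} (ht : 1 < t) (y : Y.Y) :
    weight k Z a b (Φ (t, y)) = ENNReal.ofReal (t ^ a) * resWeight k Y b (1 / t) y := by
  unfold weight resWeight
  rw [H.rho_end t ht y, ENNReal.ofReal_mul (Real.rpow_nonneg (by linarith) _)]
  congr 2
  exact Finset.prod_congr rfl fun j hj => by rw [H.w_end t ht y j (Finset.mem_range.1 hj)]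

include hY

theorem w_mem (z : Z.Z) {j : ℕ} (hj : j < k) : Z.w j z ∈ Set.Icc (1 / Z.ρ z) 1 := by
  by_cases hz : z ∈ Φ '' (Ioi 1 ×ˢ univ)
  · obtain ⟨⟨t, y⟩, ht, rfl⟩ := hz
    rw [H.rho_end t ht.1 y, H.w_end t ht.1 y j hj]
    exact hY.σ_mem _ (one_div_mem_Ioc (le_of_lt ht.1)) j hj y
  · rw [H.rho_core z hz, H.w_core z hz j hj]; simp

/-- Since `1/ρ ≤ w_j ≤ 1`, all factors lie in a compact part of `(0, ∞)` where `ρ` is bounded, so no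
sign of the exponents matters. -/
theorem exists_le_weight (a : ℝ) (b : ℕ → ℝ) (R : ℝ) :
    ∃ C : ℝ≥0∞, C ≠ 0 ∧ ∀ z, Z.ρ z ≤ R → C ≤ weight k Z a b z := by
  obtain ⟨κ, hκ, h⟩ := exists_le_rpow one_pos R a
  have hm : (0 : ℝ) < 1 / max R 1 := by positivity
  obtain ⟨κ', hκ', h'⟩ := exists_le_prod_rpow hm 1 k b
  refine ⟨ENNReal.ofReal (κ * κ'), (ENNReal.ofReal_pos.2 (mul_pos hκ hκ')).ne', fun z hz => ?_⟩
  refine ENNReal.ofReal_le_ofReal (mul_le_mul (h _ ⟨H.one_le_rho z, hz⟩) (h' _ fun j hj => ?_)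
    hκ'.le (Real.rpow_nonneg (zero_le_one.trans (H.one_le_rho z)) _))
  have h1 := H.w_mem hY z hj
  refine ⟨(one_div_le_one_div_of_le (by linarith [H.one_le_rho z]) ?_).trans h1.1, h1.2⟩
  exact hz.trans (le_max_left _ _)

/-- The weighted volume of `{ρ ≤ R}` grows at most like `R ^ (a + n)`. -/
theorem exists_setLIntegral_weight_le {a : ℝ} {b : ℕ → ℝ} (ha : 0 < a + n)
    (hb : ∀ j < k, 0 < ∑ i ∈ Finset.range (j + 1), b i + m j) :
    ∃ C : ℝ≥0∞, C ≠ ⊤ ∧ ∀ R : ℝ, 1 ≤ R →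
      ∫⁻ z in {z | Z.ρ z ≤ R}, weight k Z a b z ∂vol Z.g ≤ C * ENNReal.ofReal (R ^ (a + n)) := by
  have := hY.compactSpace
  obtain ⟨U, hU, hU'⟩ := hY.upper b hb
  have hdim : Module.finrank ℝ ℝ + d = n := by rw [Module.finrank_self]; exact H.finrank_eq
  have hn : (n : ℝ) = 1 + d := by exact_mod_cast H.finrank_eq.symm
  set A : ℝ≥0∞ := ballVol n * (ballVol d)⁻¹ * (ENNReal.ofReal C₀ ^ n * ENNReal.ofReal √2 ^ n) with hA
  have hAt : A ≠ ⊤ := ENNReal.mul_ne_top (ENNReal.mul_ne_top (ballVol_ne_top n)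
    (ENNReal.inv_ne_top.2 (ballVol_pos d))) (ENNReal.mul_ne_top
      (ENNReal.pow_ne_top ENNReal.ofReal_ne_top) (ENNReal.pow_ne_top ENNReal.ofReal_ne_top))
  set D : ℝ≥0∞ := dens volume (fun s : ℝ => s ^ 2) with hD
  have hDt : D ≠ ⊤ := ENNReal.inv_ne_top.2 (measure_form_ne_zero volume isForm_sq)
  refine ⟨vol Z.g (Φ '' (Ioi 1 ×ˢ univ))ᶜ + A * (D * U * ENNReal.ofReal (a + n)⁻¹),
    ENNReal.add_ne_top.2 ⟨H.isCompact_core.measure_lt_top.ne, ENNReal.mul_ne_top hAt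
      (ENNReal.mul_ne_top (ENNReal.mul_ne_top hDt hU) ENNReal.ofReal_ne_top)⟩, fun R hR => ?_⟩
  rw [H.rho_le_eq hR]
  refine (lintegral_union_le _ _ _).trans ?_
  rw [add_mul]
  refine add_le_add ?_ ?_
  · have h1 : ∫⁻ z in (Φ '' (Ioi 1 ×ˢ univ))ᶜ, weight k Z a b z ∂vol Z.g =
        vol Z.g (Φ '' (Ioi 1 ×ˢ univ))ᶜ := by
      rw [setLIntegral_congr_fun H.isCompact_core.measurableSet (g := fun _ => 1)
        fun z hz => H.weight_core a b hz]
      simp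
    rw [h1]
    -- The core has weight `1` and finite volume; this is absorbed because `R^(a+n) ≥ 1`.
    refine le_mul_of_one_le_right' ?_
    rw [ENNReal.one_le_ofReal]
    exact Real.one_le_rpow hR ha.le
  · have hsub : Set.Ioc 1 R ×ˢ (univ : Set Y.Y) ⊆ Φ.source :=
      (prod_mono (fun t ht => ht.1.le) Subset.rfl).trans H.subset_source
    refine (setLIntegral_image_le (P := fun _ s => s ^ 2) (lam := fun t => t)
      (h := fun t => Y.h (1 / t)) Z.g volume hdim (isEmb_partialDiffeomorph Φ) hsub
      (measurableSet_Ioc.prod MeasurableSet.univ) (H.measurable_weight a b) (fun _ => isForm_sq)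
      H.pos (fun p hp => one_pos.trans hp.1.1) (fun p hp s v => H.quad_le p.1 hp.1.1.le p.2 s v)).trans ?_
    change A * _ ≤ A * _ * _
    rw [mul_assoc A]
    refine mul_le_mul_right ?_ _
    -- The slice at radius `t` contributes `t^a` from the weight, `t^d` from the dilation of its
    -- metric, and at most `U` by the uniform bound for the cross-section.
    have h1 : ∀ t : ℝ, D * ENNReal.ofReal t ^ d * ∫⁻ y, (Set.Ioc 1 R ×ˢ (univ : Set Y.Y)).indicator
        (fun p => weight k Z a b (Φ p)) (t, y) ∂vol (Y.h (1 / t)) ≤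
        (Set.Ioc 1 R).indicator (fun t => D * U * ENNReal.ofReal (t ^ (a + d))) t := by
      intro t
      by_cases ht : t ∈ Set.Ioc 1 R
      · have ht0 : 0 < t := one_pos.trans ht.1
        have h2 : ∀ y : Y.Y, (Set.Ioc 1 R ×ˢ (univ : Set Y.Y)).indicator
            (fun p => weight k Z a b (Φ p)) (t, y) =
              ENNReal.ofReal (t ^ a) * resWeight k Y b (1 / t) y := fun y => by
          rw [indicator_of_mem (mk_mem_prod ht (mem_univ y)), H.weight_end a b ht.1]
        simp only [h2]
        rw [indicator_of_mem ht, lintegral_const_mul _ (hY.measurable_resWeight b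
          (one_div_mem_Ioc ht.1.le))]
        calc _ ≤ D * ENNReal.ofReal t ^ d * (ENNReal.ofReal (t ^ a) * U) :=
              mul_le_mul_right (mul_le_mul_right (hU' _ (one_div_mem_Ioc ht.1.le)) _) _
          _ = D * U * (ENNReal.ofReal (t ^ a) * ENNReal.ofReal t ^ d) := by ring
          _ = _ := by
            rw [← ENNReal.ofReal_pow ht0.le, ← ENNReal.ofReal_mul (by positivity),
              Real.rpow_add ht0, Real.rpow_natCast]
      · have h2 : ∀ y : Y.Y, (Set.Ioc 1 R ×ˢ (univ : Set Y.Y)).indicator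
            (fun p => weight k Z a b (Φ p)) (t, y) = 0 := fun y =>
          indicator_of_notMem (fun h => ht h.1) _
        simp [h2]
    refine (lintegral_mono h1).trans ?_
    rw [lintegral_indicator measurableSet_Ioc, lintegral_const_mul _ (by fun_prop), mul_assoc (D * U)]
    refine mul_le_mul_right ?_ _
    -- The integral of `t^(a+d)` over `(1, R]` is `(R^(a+n) - 1)/(a+n)`, because `d + 1 = n`.
    have hint : IntegrableOn (fun t : ℝ => t ^ (a + d)) (Set.Ioc 1 R) := by
      rw [← intervalIntegrable_iff_integrableOn_Ioc_of_le hR]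
      exact intervalIntegral.intervalIntegrable_rpow' (by linarith)
    rw [← ofReal_integral_eq_lintegral_ofReal hint ((ae_restrict_mem measurableSet_Ioc).mono
      fun t ht => Real.rpow_nonneg (zero_le_one.trans ht.1.le) _), ← intervalIntegral.integral_of_le hR,
      integral_rpow (Or.inl (by linarith)), ← ENNReal.ofReal_mul (inv_nonneg.2 ha.le)]
    refine ENNReal.ofReal_le_ofReal ?_
    have h3 : a + d + 1 = a + n := by rw [hn]; ring
    rw [h3, Real.one_rpow, div_eq_inv_mul]
    exact mul_le_mul_of_nonneg_left (by linarith) (inv_nonneg.2 ha.le)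

/-- From any point `p` one reaches the end within bounded distance. -/
theorem exists_gdist_end_le [ConnectedSpace Z.Z] : ∃ l : ℝ, 0 < l ∧ ∀ p : Z.Z, ∃ t y,
    1 ≤ t ∧ t ≤ Z.ρ p ∧ gdist Z.g p (Φ (t, y)) ≤ ENNReal.ofReal l := by
  obtain ⟨y₀⟩ : Nonempty Y.Y := inferInstance
  obtain ⟨l, hl, h⟩ := exists_gdist_le_of_isCompact Z.g (Φ (1, y₀)) H.isCompact_core
  refine ⟨l, hl, fun p => ?_⟩
  by_cases hp : p ∈ Φ '' (Ioi 1 ×ˢ univ)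
  · obtain ⟨⟨t, y⟩, ht, rfl⟩ := hp
    exact ⟨t, y, le_of_lt ht.1, (H.rho_end t ht.1 y).ge, by rw [gdist_self]; exact zero_le⟩
  · exact ⟨1, y₀, le_rfl, H.one_le_rho p, by rw [gdist_comm]; exact h p hp⟩

/-- Large balls have at least the expected weighted volume. -/
theorem exists_le_setLIntegral_weight_of_large [ConnectedSpace Z.Z] (a : ℝ) (b : ℕ → ℝ) {c : ℝ}
    (hc : 0 < c) : ∃ r₁ : ℝ, 0 < r₁ ∧ ∃ C : ℝ≥0∞, C ≠ 0 ∧ ∀ p r, r₁ ≤ r → c * Z.ρ p ≤ r →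
      C * ENNReal.ofReal (r ^ (a + n)) ≤ ∫⁻ z in gball Z.g p r, weight k Z a b z ∂vol Z.g := by
  have := hY.compactSpace
  have hdim : Module.finrank ℝ ℝ + d = n := by rw [Module.finrank_self]; exact H.finrank_eq
  have hn : (n : ℝ) = 1 + d := by exact_mod_cast H.finrank_eq.symm
  have hC := H.pos
  obtain ⟨l, hl, hend⟩ := H.exists_gdist_end_le hY
  -- From `p` the end is reached within `l ≤ r/4`. Going out radially by at most `2ηr` costs at most
  -- `C₀ · 2ηr = r/8`. All radii are then at most `A r`, so a move of `h`-length less than `δ` in a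
  -- slice costs at most `C₀ A r δ = r/4`. The total stays below `r`.
  set η : ℝ := 1 / (16 * C₀) with hη
  have hη0 : 0 < η := by positivity
  set A : ℝ := 1 / c + 2 * η with hA
  have hA0 : 0 < A := by positivity
  set δ : ℝ := 1 / (4 * C₀ * A) with hδ
  have hδ0 : 0 < δ := by positivity
  obtain ⟨cL, hcL, hL⟩ := hY.lower b δ hδ0
  obtain ⟨κ, hκ, hκ'⟩ := exists_le_rpow hη0 A (a + d)
  set D : ℝ≥0∞ := dens volume (fun s : ℝ => s ^ 2) with hD
  have hD0 : D ≠ 0 := by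
    refine ENNReal.inv_ne_zero.2 ((measure_mono fun s hs => ?_).trans_lt
      (measure_ball_lt_top (x := (0 : ℝ)) (r := 1))).ne
    rw [mem_ball_zero_iff, Real.norm_eq_abs]
    exact (sq_lt_one_iff_abs_lt_one s).1 hs
  set K : ℝ≥0∞ := ballVol d * (ballVol n)⁻¹ * ENNReal.ofReal C₀ ^ n with hK
  have hKt : K ≠ ⊤ := ENNReal.mul_ne_top (ENNReal.mul_ne_top (ballVol_ne_top d)
    (ENNReal.inv_ne_top.2 (ballVol_pos n))) (ENNReal.pow_ne_top ENNReal.ofReal_ne_top)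
  refine ⟨max (4 * l) (2 / η), lt_max_of_lt_left (by positivity),
    K⁻¹ * (D * cL * ENNReal.ofReal (κ * η)), ?_, fun p r hr₁ hr => ?_⟩
  · refine mul_ne_zero (ENNReal.inv_ne_zero.2 hKt) (mul_ne_zero (mul_ne_zero hD0 hcL)
      (ENNReal.ofReal_pos.2 (by positivity)).ne')
  have hr4 : 4 * l ≤ r := (le_max_left _ _).trans hr₁
  have hr2 : 2 / η ≤ r := (le_max_right _ _).trans hr₁
  have hr0 : 0 < r := by linarith
  have hηr : 2 ≤ η * r := by rwa [div_le_iff₀' hη0] at hr2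
  obtain ⟨t₁, y₁, ht1, htρ, hdist⟩ := hend p
  have ht1r : t₁ ≤ 1 / c * r := by
    rw [one_div, ← div_eq_inv_mul, le_div_iff₀' hc]
    exact (mul_le_mul_of_nonneg_left htρ hc.le).trans hr
  -- Starting `ηr ≥ 2` beyond `t₁` keeps `t > 1` and makes `t` comparable to `r` from below as well,
  -- even if `p` lies in the core.
  set I : Set ℝ := Set.Icc (t₁ + η * r) (t₁ + 2 * (η * r)) with hI
  have hI1 : ∀ t ∈ I, 1 < t ∧ η * r ≤ t ∧ t ≤ A * r := fun t ht => by
    have h1 := ht.1; have h2 := ht.2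
    refine ⟨by linarith, by linarith, ?_⟩
    rw [hA, add_mul]; linarith
  have hIs : I ×ˢ (univ : Set Y.Y) ⊆ Φ.source :=
    (prod_mono (fun t ht => (hI1 t ht).1.le) Subset.rfl).trans H.subset_source
  have hBm : MeasurableSet (I ×ˢ (univ : Set Y.Y) ∩ Φ ⁻¹' gball Z.g p r) :=
    measurableSet_inter_preimage ((isEmb_partialDiffeomorph Φ).contMDiffOn.continuousOn.mono hIs)
      (measurableSet_Icc.prod MeasurableSet.univ) (isOpen_gball Z.g p r).measurableSet
  set B : Set (ℝ × Y.Y) := I ×ˢ (univ : Set Y.Y) ∩ Φ ⁻¹' gball Z.g p r with hB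
  have hmemB : ∀ t ∈ I, ∀ y ∈ gball (Y.h (1 / t)) y₁ δ, (t, y) ∈ B := by
    intro t ht y hy
    refine ⟨⟨ht, mem_univ _⟩, ?_⟩
    have h1 := H.gdist_radial_le ht1 (by linarith [ht.1] : t₁ ≤ t) y₁
    have h2 := H.gdist_slice_lt (hI1 t ht).1.le hy
    have h3 : C₀ * (t - t₁) ≤ r / 8 := by
      have : t - t₁ ≤ 2 * (η * r) := by linarith [ht.2]
      refine (mul_le_mul_of_nonneg_left this hC.le).trans (le_of_eq ?_)
      rw [hη]; field_simp; norm_num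
    have h4 : C₀ * t * δ ≤ r / 4 := by
      refine (mul_le_mul_of_nonneg_right (mul_le_mul_of_nonneg_left (hI1 t ht).2.2 hC.le)
        hδ0.le).trans (le_of_eq ?_)
      rw [hδ]; field_simp
    change gdist Z.g p (Φ (t, y)) < ENNReal.ofReal r
    calc gdist Z.g p (Φ (t, y)) ≤ gdist Z.g p (Φ (t₁, y₁)) + (gdist Z.g (Φ (t₁, y₁)) (Φ (t, y₁)) +
          gdist Z.g (Φ (t, y₁)) (Φ (t, y))) :=
          (gdist_triangle _ _ (Φ (t₁, y₁)) _).trans (add_le_add le_rfl (gdist_triangle _ _ _ _))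
      _ ≤ ENNReal.ofReal (r / 4) + (ENNReal.ofReal (r / 8) + ENNReal.ofReal (r / 4)) :=
          add_le_add (hdist.trans (ENNReal.ofReal_le_ofReal (by linarith)))
            (add_le_add (h1.trans (ENNReal.ofReal_le_ofReal h3))
              (h2.le.trans (ENNReal.ofReal_le_ofReal h4)))
      _ = ENNReal.ofReal (r / 4 + (r / 8 + r / 4)) := by
          rw [← ENNReal.ofReal_add (by positivity) (by positivity),
            ← ENNReal.ofReal_add (by positivity) (by positivity)]
      _ < ENNReal.ofReal r := (ENNReal.ofReal_lt_ofReal_iff hr0).2 (by linarith)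
  have hlow := lintegral_le_setLIntegral_image (P := fun _ s => s ^ 2) (lam := fun t => t)
      (h := fun t => Y.h (1 / t)) Z.g volume hdim (isEmb_partialDiffeomorph Φ)
      (inter_subset_left.trans hIs) hBm (H.measurable_weight a b) (fun _ => isForm_sq)
      H.pos (fun p hp => one_pos.trans (hI1 _ hp.1.1).1)
      (fun p hp s v => H.le_quad p.1 (hI1 _ hp.1.1).1.le p.2 s v)
  have hsl : ∀ t : ℝ, I.indicator (fun _ => D * cL * ENNReal.ofReal (κ * r ^ (a + d))) t ≤
      D * ENNReal.ofReal t ^ d * ∫⁻ y, B.indicator (fun p => weight k Z a b (Φ p)) (t, y)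
        ∂vol (Y.h (1 / t)) := by
    intro t
    by_cases ht : t ∈ I
    · obtain ⟨h1, h2, h3⟩ := hI1 t ht
      have ht0 : 0 < t := one_pos.trans h1
      rw [indicator_of_mem ht]
      calc D * cL * ENNReal.ofReal (κ * r ^ (a + d)) ≤ D * cL * ENNReal.ofReal (t ^ (a + d)) := by
            refine mul_le_mul_right (ENNReal.ofReal_le_ofReal ?_) _
            -- As `t / r` ranges over `[η, A]`, the power `t^(a+d)` is at least a multiple of
            -- `r^(a+d)` for either sign of the exponent.
            have h4 := hκ' (t / r) ⟨by rwa [le_div_iff₀ hr0], by rwa [div_le_iff₀ hr0]⟩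
            rwa [Real.div_rpow ht0.le hr0.le, le_div_iff₀ (Real.rpow_pos_of_pos hr0 _)] at h4
        _ = D * ENNReal.ofReal t ^ d * (ENNReal.ofReal (t ^ a) * cL) := by
            rw [← ENNReal.ofReal_pow ht0.le, Real.rpow_add ht0, Real.rpow_natCast,
              ENNReal.ofReal_mul (by positivity)]
            ring
        _ ≤ D * ENNReal.ofReal t ^ d * (ENNReal.ofReal (t ^ a) *
              ∫⁻ y in gball (Y.h (1 / t)) y₁ δ, resWeight k Y b (1 / t) y ∂vol (Y.h (1 / t))) :=
            mul_le_mul_right (mul_le_mul_right (hL _ (one_div_mem_Ioc h1.le) y₁) _) _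
        _ ≤ _ := by
            refine mul_le_mul_right ?_ _
            rw [← lintegral_const_mul _ (hY.measurable_resWeight b (one_div_mem_Ioc h1.le)),
              ← lintegral_indicator (isOpen_gball _ _ _).measurableSet]
            refine lintegral_mono fun y => ?_
            by_cases hy : y ∈ gball (Y.h (1 / t)) y₁ δ
            · rw [indicator_of_mem hy, indicator_of_mem (hmemB t ht y hy), H.weight_end a b h1]
            · rw [indicator_of_notMem hy]; exact zero_le
    · rw [indicator_of_notMem ht]; exact zero_le
  have hfin := (lintegral_mono hsl).trans hlow
  rw [lintegral_indicator measurableSet_Icc, setLIntegral_const, Real.volume_Icc] at hfin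
  have hsub : Φ '' B ⊆ gball Z.g p r := by
    rintro _ ⟨q, hq, rfl⟩; exact hq.2
  have hfin2 := hfin.trans (mul_le_mul_right (lintegral_mono_set hsub) _)
  rw [mul_assoc, mul_comm]
  -- The length `ηr` of the radial interval supplies the last power of `r`, since `n = d + 1`.
  have h5 : D * cL * ENNReal.ofReal (κ * r ^ (a + d)) * ENNReal.ofReal (t₁ + 2 * (η * r) -
      (t₁ + η * r)) = D * cL * ENNReal.ofReal (κ * η) * ENNReal.ofReal (r ^ (a + n)) := by
    rw [mul_assoc (D * cL), mul_assoc (D * cL), ← ENNReal.ofReal_mul (by positivity),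
      ← ENNReal.ofReal_mul (by positivity)]
    congr 2
    have : r ^ (a + n) = r ^ (a + d) * r := by
      rw [hn, ← Real.rpow_add_one hr0.ne']; congr 1; ring
    rw [this]; ring
  rw [h5] at hfin2
  rw [mul_comm, ← ENNReal.div_eq_inv_mul]
  exact ENNReal.div_le_of_le_mul' hfin2

/-- Balls of radius `r ≥ c ρ(p)` have at least the expected weighted volume. -/
theorem exists_le_setLIntegral_weight [ConnectedSpace Z.Z] (a : ℝ) (b : ℕ → ℝ) {c : ℝ}
    (hc : 0 < c) : ∃ C : ℝ≥0∞, C ≠ 0 ∧ ∀ p r, c * Z.ρ p ≤ r →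
      C * ENNReal.ofReal (r ^ (a + n)) ≤ ∫⁻ z in gball Z.g p r, weight k Z a b z ∂vol Z.g := by
  have := hY.compactSpace
  obtain ⟨r₁, hr₁, C, hC, h⟩ := H.exists_le_setLIntegral_weight_of_large hY a b hc
  -- For `r < r₁` the centre lies in a compact set. Because `ρ ≥ 1`, the radius is at least `c`; so
  -- the volume is bounded below by that of a `c`-ball, and the weight by its minimum over bounded
  -- `ρ`.
  obtain ⟨K, hK, hsub⟩ := H.rho_le_subset (r₁ / c)
  obtain ⟨v, hv, hv'⟩ := exists_le_vol_gball Z.g hK hc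
  obtain ⟨θ, hθ, hθ'⟩ := H.exists_le_weight hY a b (r₁ / c + C₀ * r₁)
  obtain ⟨B, hB, hB'⟩ := exists_rpow_le hc r₁ (a + n)
  refine ⟨min C (θ * v * (ENNReal.ofReal B)⁻¹), (lt_min (pos_iff_ne_zero.2 hC) (pos_iff_ne_zero.2
    (mul_ne_zero (mul_ne_zero hθ hv) (ENNReal.inv_ne_zero.2 ENNReal.ofReal_ne_top)))).ne',
    fun p r hr => ?_⟩
  by_cases hrr : r₁ ≤ r
  · exact (mul_le_mul_left (min_le_left _ _) _).trans (h p r hrr hr)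
  · have hrr' := not_le.1 hrr
    have hcr : c ≤ r := by nlinarith [H.one_le_rho p]
    have hρ : Z.ρ p ≤ r₁ / c := by
      rw [le_div_iff₀' hc]; exact hr.trans hrr'.le
    calc _ ≤ θ * v * (ENNReal.ofReal B)⁻¹ * ENNReal.ofReal B :=
          mul_le_mul' (min_le_right _ _) (ENNReal.ofReal_le_ofReal (hB' r ⟨hcr, hrr'.le⟩))
      _ = θ * v := by
          rw [mul_assoc, ENNReal.inv_mul_cancel (ENNReal.ofReal_pos.2 hB).ne' ENNReal.ofReal_ne_top,
            mul_one]
      _ ≤ θ * vol Z.g (gball Z.g p r) :=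
          mul_le_mul_right ((hv' p (hsub hρ)).trans (measure_mono (gball_mono Z.g p hcr))) _
      _ = ∫⁻ _ in gball Z.g p r, θ ∂vol Z.g := by rw [setLIntegral_const]
      _ ≤ _ := setLIntegral_mono' (isOpen_gball _ _ _).measurableSet fun z hz => hθ' z ?_
    have h1 := H.rho_le_add (hc.le.trans hcr) hz
    have h2 : C₀ * r ≤ C₀ * r₁ := mul_le_mul_of_nonneg_left hrr'.le H.pos.le
    linarith

end IsCone

end Weight

/-! ### The part of a resolution blowup that fibres over a stratum -/

section Truncated

open Topology

variable {k d e s : ℕ} {Y : BlowupData.{u} d} {Z : QACData.{u} e} {S : Mfd.{u} s}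
  {A : Set Y.Y} {κ : Metric S} {pr : Y.Y → S} {V : Set S}
  {Φ : ℝ → PartialDiffeomorph (𝓡 d) ((𝓡 s).prod (𝓡 e)) Y.Y (S × Z.Z) ∞} {K : ℝ}

/-- `Φ ε` trivializes the part of `A` over `V`, with a metric that is uniformly equivalent to
`κ + ε² g`. -/
structure IsTruncChart (k : ℕ) (Y : BlowupData.{u} d) (Z : QACData.{u} e) (A : Set Y.Y)
    (κ : Metric S) (pr : Y.Y → S) (V : Set S)
    (Φ : ℝ → PartialDiffeomorph (𝓡 d) ((𝓡 s).prod (𝓡 e)) Y.Y (S × Z.Z) ∞) (K : ℝ) : Prop where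
  one_le : 1 ≤ K
  isOpen : IsOpen V
  subset_source : ∀ ε ∈ Ioc (0 : ℝ) 1, A ∩ pr ⁻¹' V ⊆ (Φ ε).source
  subset_target : ∀ ε ∈ Ioc (0 : ℝ) 1, V ×ˢ {z | Z.ρ z ≤ 1 / ε} ⊆ (Φ ε).target
  fst_eq : ∀ ε ∈ Ioc (0 : ℝ) 1, ∀ y ∈ A ∩ pr ⁻¹' V, (Φ ε y).1 = pr y
  rho_le : ∀ ε ∈ Ioc (0 : ℝ) 1, ∀ y ∈ A ∩ pr ⁻¹' V, Z.ρ (Φ ε y).2 ≤ 1 / ε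
  symm_mem : ∀ ε ∈ Ioc (0 : ℝ) 1, ∀ q ∈ V, ∀ z, Z.ρ z ≤ 1 / ε → (Φ ε).symm (q, z) ∈ A ∩ pr ⁻¹' V
  quad_le : ∀ ε ∈ Ioc (0 : ℝ) 1, ∀ q ∈ V, ∀ z, Z.ρ z ≤ 1 / ε →
    ∀ (a : TangentSpace (𝓡 s) q) (v : TangentSpace (𝓡 e) z),
    quad (Y.h ε) ((Φ ε).symm (q, z)) (mfderiv ((𝓡 s).prod (𝓡 e)) (𝓡 d) (Φ ε).symm (q, z)
      ((a, v) : EuclideanSpace ℝ (Fin s) × EuclideanSpace ℝ (Fin e))) ≤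
        K ^ 2 * (quad κ q a + ε ^ 2 * quad Z.g z v)
  le_quad : ∀ ε ∈ Ioc (0 : ℝ) 1, ∀ q ∈ V, ∀ z, Z.ρ z ≤ 1 / ε →
    ∀ (a : TangentSpace (𝓡 s) q) (v : TangentSpace (𝓡 e) z),
    quad κ q a + ε ^ 2 * quad Z.g z v ≤ K ^ 2 * quad (Y.h ε) ((Φ ε).symm (q, z))
      (mfderiv ((𝓡 s).prod (𝓡 e)) (𝓡 d) (Φ ε).symm (q, z)
        ((a, v) : EuclideanSpace ℝ (Fin s) × EuclideanSpace ℝ (Fin e)))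
  σ_last : ∀ ε ∈ Ioc (0 : ℝ) 1, ∀ y ∈ A ∩ pr ⁻¹' V, Y.σ ε k y = ε * Z.ρ (Φ ε y).2
  σ_lt : ∀ ε ∈ Ioc (0 : ℝ) 1, ∀ y ∈ A ∩ pr ⁻¹' V, ∀ j < k,
    Y.σ ε j y = ε * Z.ρ (Φ ε y).2 * Z.w j (Φ ε y).2

/-- On the truncation `ερ ≤ 1`, so the decaying error is at most `|C|` times the model metric, and
the constant `1 + |C|` serves all charts and all `ε`. The estimates are transferred to the inverse
of `Φ ε`, which parametrizes `Y'`. -/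
theorem IsTruncatedBundle.exists_isTruncChart (hρ : ∀ z, 1 ≤ Z.ρ z)
    (h : IsTruncatedBundle k Y A Z) : ∃ (s : ℕ) (S : Mfd.{u} s) (κ : Metric S) (pr : Y.Y → S)
      (K : ℝ), CompactSpace S ∧ ContinuousOn pr A ∧
        ∀ s₀ : S, ∃ V Φ, s₀ ∈ V ∧ IsTruncChart k Y Z A κ pr V Φ K := by
  obtain ⟨s, S, κ, pr, N, hS, -, hAN, hpr, C, ν, hν, h⟩ := h
  refine ⟨s, S, κ, pr, 1 + |C|, hS, hpr.continuousOn.mono hAN, fun s₀ => ?_⟩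
  obtain ⟨V, hV, hs₀, Φ, hΦ, -⟩ := h s₀
  have hK1 : (1 : ℝ) ≤ 1 + |C| := by have := abs_nonneg C; linarith
  have hKK : 1 + |C| ≤ (1 + |C|) ^ 2 := by nlinarith
  have hmem : ∀ ε ∈ Ioc (0 : ℝ) 1, ∀ q ∈ V, ∀ z, Z.ρ z ≤ 1 / ε →
      (Φ ε).symm (q, z) ∈ A ∩ pr ⁻¹' V ∧ Φ ε ((Φ ε).symm (q, z)) = (q, z) := by
    intro ε hε q hq z hz
    obtain ⟨-, -, h3, h4, -⟩ := hΦ ε hε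
    have ht : (q, z) ∈ (Φ ε).target := h3 ⟨hq, hz⟩
    have hs : (Φ ε).symm (q, z) ∈ (Φ ε).source := (Φ ε).map_target ht
    have hr : Φ ε ((Φ ε).symm (q, z)) = (q, z) := (Φ ε).right_inv ht
    have h5 := h4 _ hs
    rw [hr] at h5
    exact ⟨⟨h5.2.2 hz, show pr _ ∈ V from h5.1 ▸ hq⟩, hr⟩
  have hmet : ∀ ε ∈ Ioc (0 : ℝ) 1, ∀ q ∈ V, ∀ z, Z.ρ z ≤ 1 / ε →
      ∀ (a : TangentSpace (𝓡 s) q) (v : TangentSpace (𝓡 e) z),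
      let Q := quad κ q a + ε ^ 2 * quad Z.g z v
      let Q' := quad (Y.h ε) ((Φ ε).symm (q, z)) (mfderiv ((𝓡 s).prod (𝓡 e)) (𝓡 d) (Φ ε).symm (q, z)
        ((a, v) : EuclideanSpace ℝ (Fin s) × EuclideanSpace ℝ (Fin e)))
      |Q' - Q| ≤ C * (ε * Z.ρ z) ^ ν * Q ∧ Q ≤ C * Q' := by
    intro ε hε q hq z hz a v Q Q'
    obtain ⟨hy, hr⟩ := hmem ε hε q hq z hz
    obtain ⟨-, h2, h3, -, h5⟩ := hΦ ε hε
    have ht : (q, z) ∈ (Φ ε).target := h3 ⟨hq, hz⟩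
    have h6 := (h5 _ hy).1 (mfderiv ((𝓡 s).prod (𝓡 e)) (𝓡 d) (Φ ε).symm (q, z)
        ((a, v) : EuclideanSpace ℝ (Fin s) × EuclideanSpace ℝ (Fin e)))
    have h7 : (mfderiv (𝓡 d) ((𝓡 s).prod (𝓡 e)) (Φ ε) ((Φ ε).symm (q, z))
        (mfderiv ((𝓡 s).prod (𝓡 e)) (𝓡 d) (Φ ε).symm (q, z)
        ((a, v) : EuclideanSpace ℝ (Fin s) × EuclideanSpace ℝ (Fin e))) :
          EuclideanSpace ℝ (Fin s) × EuclideanSpace ℝ (Fin e)) = (a, v) :=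
      mfderiv_leftInverse (f := (Φ ε).symm) (g := Φ ε) (Φ ε).open_target ht
        (fun p hp => (Φ ε).right_inv hp)
        ((isEmb_partialDiffeomorph (Φ ε).symm).mdifferentiableAt ht)
        ((isEmb_partialDiffeomorph (Φ ε)).mdifferentiableAt (h2 hy)) _
    simp only at h6
    rw [h7] at h6
    have h8 : quad κ (Φ ε ((Φ ε).symm (q, z))).1 a = quad κ q a := quad_congr_point κ (by rw [hr]) a
    have h9 : quad Z.g (Φ ε ((Φ ε).symm (q, z))).2 v = quad Z.g z v :=
      quad_congr_point Z.g (by rw [hr]) v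
    rw [h8, h9, hr] at h6
    exact h6
  refine ⟨V, Φ, hs₀, hK1, hV, fun ε hε => (hΦ ε hε).2.1, fun ε hε => (hΦ ε hε).2.2.1,
    fun ε hε y hy => ((hΦ ε hε).2.2.2.1 y ((hΦ ε hε).2.1 hy)).1,
    fun ε hε y hy => ((hΦ ε hε).2.2.2.1 y ((hΦ ε hε).2.1 hy)).2.1 hy.1,
    fun ε hε q hq z hz => (hmem ε hε q hq z hz).1, fun ε hε q hq z hz a v => ?_,
    fun ε hε q hq z hz a v => ?_, fun ε hε y hy => ((hΦ ε hε).2.2.2.2 y hy).2.1,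
    fun ε hε y hy => ((hΦ ε hε).2.2.2.2 y hy).2.2⟩
  · have h1 := (abs_le.1 (hmet ε hε q hq z hz a v).1).2
    have h2 : 0 ≤ quad κ q a + ε ^ 2 * quad Z.g z v := by
      have := quad_nonneg κ q a
      have := quad_nonneg Z.g z v
      positivity
    have h3 : (ε * Z.ρ z) ^ ν ≤ 1 := by
      have h4 : 0 ≤ ε * Z.ρ z := mul_nonneg hε.1.le (zero_le_one.trans (hρ z))
      refine Real.rpow_le_one h4 ?_ hν.le
      rwa [le_div_iff₀' hε.1] at hz
    have h5 : 0 ≤ (ε * Z.ρ z) ^ ν :=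
      Real.rpow_nonneg (mul_nonneg hε.1.le (zero_le_one.trans (hρ z))) _
    have h4 : C * (ε * Z.ρ z) ^ ν ≤ |C| :=
      (mul_le_mul_of_nonneg_right (le_abs_self C) h5).trans (mul_le_of_le_one_right (abs_nonneg C) h3)
    have h6 := mul_le_mul_of_nonneg_right h4 h2
    have h7 := mul_le_mul_of_nonneg_right hKK h2
    linarith
  · have h1 := (hmet ε hε q hq z hz a v).2
    refine h1.trans (mul_le_mul_of_nonneg_right ?_ (quad_nonneg _ _ _))
    linarith [le_abs_self C]

namespace IsTruncChart

variable (T : IsTruncChart k Y Z A κ pr V Φ K) {ε : ℝ} (hε : ε ∈ Ioc (0 : ℝ) 1)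

include T

theorem pos : 0 < K := one_pos.trans_le T.one_le

include hε

theorem image_eq : (Φ ε).symm '' (V ×ˢ {z | Z.ρ z ≤ 1 / ε}) = A ∩ pr ⁻¹' V := by
  ext y
  constructor
  · rintro ⟨⟨q, z⟩, ⟨hq, hz⟩, rfl⟩
    exact T.symm_mem ε hε q hq z hz
  · intro hy
    refine ⟨Φ ε y, ⟨?_, T.rho_le ε hε y hy⟩, (Φ ε).left_inv (T.subset_source ε hε hy)⟩
    rw [T.fst_eq ε hε y hy]; exact hy.2

theorem right_inv {q : S} (hq : q ∈ V) {z : Z.Z} (hz : Z.ρ z ≤ 1 / ε) :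
    Φ ε ((Φ ε).symm (q, z)) = (q, z) := by
  have h : (q, z) ∈ (Φ ε).target := T.subset_target ε hε ⟨hq, hz⟩
  exact (Φ ε).right_inv h

theorem finrank_eq {q : S} (hq : q ∈ V) {z : Z.Z} (hz : Z.ρ z ≤ 1 / ε) : s + e = d := by
  have hx : (q, z) ∈ (Φ ε).target := T.subset_target ε hε ⟨hq, hz⟩
  let A : EuclideanSpace ℝ (Fin s) × EuclideanSpace ℝ (Fin e) →L[ℝ] EuclideanSpace ℝ (Fin d) :=
    mfderiv ((𝓡 s).prod (𝓡 e)) (𝓡 d) (Φ ε).symm (q, z)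
  let B : EuclideanSpace ℝ (Fin d) →L[ℝ] EuclideanSpace ℝ (Fin s) × EuclideanSpace ℝ (Fin e) :=
    mfderiv (𝓡 d) ((𝓡 s).prod (𝓡 e)) (Φ ε) ((Φ ε).symm (q, z))
  have h1 : LinearMap.ker (A : EuclideanSpace ℝ (Fin s) × EuclideanSpace ℝ (Fin e) →ₗ[ℝ]
      EuclideanSpace ℝ (Fin d)) = ⊥ :=
    LinearMap.ker_eq_bot'.2 fun v hv =>
      (isEmb_partialDiffeomorph (Φ ε).symm).mfderiv_eq_zero _ hx v hv
  have h2 : LinearMap.ker (B : EuclideanSpace ℝ (Fin d) →ₗ[ℝ]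
      EuclideanSpace ℝ (Fin s) × EuclideanSpace ℝ (Fin e)) = ⊥ :=
    LinearMap.ker_eq_bot'.2 fun v hv =>
      (isEmb_partialDiffeomorph (Φ ε)).mfderiv_eq_zero _ ((Φ ε).map_target hx) v hv
  have h3 := LinearMap.finrank_le_finrank_of_injective (LinearMap.ker_eq_bot.1 h1)
  have h4 := LinearMap.finrank_le_finrank_of_injective (LinearMap.ker_eq_bot.1 h2)
  simp only [Module.finrank_prod, finrank_euclideanSpace_fin] at h3 h4
  omega

/-- The weights of the total space in terms of those of the fibre. -/
theorem resWeight_symm (hρ : ∀ z, 1 ≤ Z.ρ z) (hw : ∀ z, ∀ j < k, 0 ≤ Z.w j z) (b : ℕ → ℝ) {q : S}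
    (hq : q ∈ V) {z : Z.Z} (hz : Z.ρ z ≤ 1 / ε) :
    resWeight (k + 1) Y b ε ((Φ ε).symm (q, z)) =
      ENNReal.ofReal (ε ^ ∑ i ∈ Finset.range (k + 1), b i) *
        weight k Z (∑ i ∈ Finset.range (k + 1), b i) b z := by
  have hy := T.symm_mem ε hε q hq z hz
  have hr := T.right_inv hε hq hz
  have hρ0 : 0 < Z.ρ z := one_pos.trans_le (hρ z)
  have hε0 := hε.1
  unfold resWeight weight
  rw [← ENNReal.ofReal_mul (Real.rpow_nonneg hε0.le _)]
  congr 1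
  -- Every resolved radial function contributes a power of `ερ`, the last one nothing else; together
  -- these powers have exponent the sum of all `b i`, and the `w j` remain.
  rw [Finset.prod_range_succ, T.σ_last ε hε _ hy, hr, ← mul_assoc, ← Real.mul_rpow hε0.le hρ0.le,
    Finset.sum_range_succ, Real.rpow_add (mul_pos hε0 hρ0),
    Real.rpow_sum_of_pos (mul_pos hε0 hρ0), mul_right_comm, ← Finset.prod_mul_distrib]
  congr 1
  refine Finset.prod_congr rfl fun j hj => ?_
  rw [T.σ_lt ε hε _ hy j (Finset.mem_range.1 hj), hr,
    Real.mul_rpow (mul_pos hε0 hρ0).le (hw z j (Finset.mem_range.1 hj))]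

theorem measurableSet_inter_σ (hA : MeasurableSet A) (hpr : ContinuousOn pr A)
    (hρ : Measurable Z.ρ) (hw : ∀ j < k, Measurable (Z.w j)) {j : ℕ} (hj : j < k + 1)
    {t : Set ℝ} (ht : MeasurableSet t) : MeasurableSet ((A ∩ pr ⁻¹' V) ∩ Y.σ ε j ⁻¹' t) := by
  have hP : MeasurableSet (A ∩ pr ⁻¹' V) :=
    measurableSet_inter_preimage hpr hA T.isOpen.measurableSet
  have hc : ContinuousOn (Φ ε) (A ∩ pr ⁻¹' V) :=
    (isEmb_partialDiffeomorph (Φ ε)).contMDiffOn.continuousOn.mono (T.subset_source ε hε)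
  obtain ⟨f, hf, hfe⟩ : ∃ f : S × Z.Z → ℝ, Measurable f ∧
      ∀ y ∈ A ∩ pr ⁻¹' V, Y.σ ε j y = f (Φ ε y) := by
    rcases (Nat.lt_succ_iff_lt_or_eq.1 hj) with hj | rfl
    · exact ⟨fun p => ε * Z.ρ p.2 * Z.w j p.2, ((hρ.comp measurable_snd).const_mul ε).mul
        ((hw j hj).comp measurable_snd), fun y hy => T.σ_lt ε hε y hy j hj⟩
    · exact ⟨fun p => ε * Z.ρ p.2, (hρ.comp measurable_snd).const_mul ε, T.σ_last ε hε⟩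
  convert measurableSet_inter_preimage hc hP (hf ht) using 1
  ext y
  refine and_congr_right fun hy => ?_
  simp only [mem_preimage, hfe y hy]

theorem mdifferentiableAt_symm {q : S} (hq : q ∈ V) {z : Z.Z} (hz : Z.ρ z ≤ 1 / ε) :
    MDifferentiableAt ((𝓡 s).prod (𝓡 e)) (𝓡 d) (Φ ε).symm (q, z) :=
  (isEmb_partialDiffeomorph (Φ ε).symm).mdifferentiableAt (T.subset_target ε hε ⟨hq, hz⟩)

/-- Metric comparison along the fibres. -/
theorem quad_fibre_le {q : S} (hq : q ∈ V) {z : Z.Z} (hz : Z.ρ z ≤ 1 / ε)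
    (v : TangentSpace (𝓡 e) z) :
    quad (Y.h ε) ((Φ ε).symm (q, z)) (mfderiv (𝓡 e) (𝓡 d) (fun z => (Φ ε).symm (q, z)) z v) ≤
      (K * ε) ^ 2 * quad Z.g z v := by
  have h1 : (mfderiv (𝓡 e) (𝓡 d) (fun z => (Φ ε).symm (q, z)) z v : EuclideanSpace ℝ (Fin d)) =
      mfderiv ((𝓡 s).prod (𝓡 e)) (𝓡 d) (Φ ε).symm (q, z)
        (((0 : EuclideanSpace ℝ (Fin s)), v) :
          EuclideanSpace ℝ (Fin s) × EuclideanSpace ℝ (Fin e)) := by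
    have h2 := mfderiv_comp (I := 𝓡 e) (I' := (𝓡 s).prod (𝓡 e)) (I'' := 𝓡 d) z
      (g := (Φ ε).symm) (f := fun z : Z.Z => (q, z)) (T.mdifferentiableAt_symm hε hq hz)
      (mdifferentiableAt_const.prodMk mdifferentiableAt_id)
    rw [mfderiv_prod_right] at h2
    exact congrArg (fun L : EuclideanSpace ℝ (Fin e) →L[ℝ] EuclideanSpace ℝ (Fin d) => L v) h2
  have h2 := T.quad_le ε hε q hq z hz (0 : EuclideanSpace ℝ (Fin s)) v
  have h3 : quad κ q (0 : EuclideanSpace ℝ (Fin s)) = 0 := quad_zero _ _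
  rw [h3] at h2
  calc _ = _ := congrArg (fun x : EuclideanSpace ℝ (Fin d) =>
        quad (Y.h ε) ((Φ ε).symm (q, z)) x) h1
    _ ≤ _ := h2.trans (le_of_eq (by ring))

/-- Metric comparison along the base. -/
theorem quad_base_le {q : S} (hq : q ∈ V) {z : Z.Z} (hz : Z.ρ z ≤ 1 / ε)
    (a : TangentSpace (𝓡 s) q) :
    quad (Y.h ε) ((Φ ε).symm (q, z)) (mfderiv (𝓡 s) (𝓡 d) (fun q => (Φ ε).symm (q, z)) q a) ≤
      K ^ 2 * quad κ q a := by
  have h1 : (mfderiv (𝓡 s) (𝓡 d) (fun q => (Φ ε).symm (q, z)) q a : EuclideanSpace ℝ (Fin d)) =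
      mfderiv ((𝓡 s).prod (𝓡 e)) (𝓡 d) (Φ ε).symm (q, z)
        ((a, (0 : EuclideanSpace ℝ (Fin e))) :
          EuclideanSpace ℝ (Fin s) × EuclideanSpace ℝ (Fin e)) := by
    have h2 := mfderiv_comp (I := 𝓡 s) (I' := (𝓡 s).prod (𝓡 e)) (I'' := 𝓡 d) q
      (g := (Φ ε).symm) (f := fun q : S => (q, z)) (T.mdifferentiableAt_symm hε hq hz)
      (mdifferentiableAt_id.prodMk mdifferentiableAt_const)
    rw [mfderiv_prod_left] at h2
    exact congrArg (fun L : EuclideanSpace ℝ (Fin s) →L[ℝ] EuclideanSpace ℝ (Fin d) => L a) h2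
  have h2 := T.quad_le ε hε q hq z hz a (0 : EuclideanSpace ℝ (Fin e))
  have h3 : quad Z.g z (0 : EuclideanSpace ℝ (Fin e)) = 0 := quad_zero _ _
  rw [h3] at h2
  calc _ = _ := congrArg (fun x : EuclideanSpace ℝ (Fin d) =>
        quad (Y.h ε) ((Φ ε).symm (q, z)) x) h1
    _ ≤ _ := h2.trans (le_of_eq (by ring))

/-- The fibre metric is shrunk by `ε`. The whole ball has to lie in the truncation, where the
metrics are comparable, because short paths are only known to stay in the ball. -/
theorem gdist_fibre_lt {q : S} (hq : q ∈ V) {z z' : Z.Z} {r : ℝ}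
    (hr : ∀ x ∈ gball Z.g z r, Z.ρ x ≤ 1 / ε) (hz : z' ∈ gball Z.g z r) :
    gdist (Y.h ε) ((Φ ε).symm (q, z)) ((Φ ε).symm (q, z')) < ENNReal.ofReal (K * ε * r) := by
  refine gdist_image_lt Z.g (Y.h ε) (f := fun z => (Φ ε).symm (q, z))
    (O := (fun z => (q, z)) ⁻¹' (Φ ε).target)
    ((Φ ε).open_target.preimage (by fun_prop)) ?_ (mul_pos T.pos hε.1)
    (fun x hx => T.subset_target ε hε ⟨hq, hr x hx⟩) (fun x hx v => T.quad_fibre_le hε hq (hr x hx) v)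
    hz
  exact (isEmb_partialDiffeomorph (Φ ε).symm).contMDiffOn.comp
    (contMDiffOn_const.prodMk contMDiffOn_id) fun x hx => hx

theorem gdist_base_lt {q q' : S} {z : Z.Z} {r : ℝ} (hz : Z.ρ z ≤ 1 / ε)
    (hr : gball κ q r ⊆ V) (hq : q' ∈ gball κ q r) :
    gdist (Y.h ε) ((Φ ε).symm (q, z)) ((Φ ε).symm (q', z)) < ENNReal.ofReal (K * r) := by
  refine gdist_image_lt κ (Y.h ε) (f := fun q => (Φ ε).symm (q, z))
    (O := (fun q => (q, z)) ⁻¹' (Φ ε).target)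
    ((Φ ε).open_target.preimage (by fun_prop)) ?_ T.pos
    (fun x hx => T.subset_target ε hε ⟨hr hx, hz⟩) (fun x hx v => T.quad_base_le hε (hr hx) hz v)
    hq
  exact (isEmb_partialDiffeomorph (Φ ε).symm).contMDiffOn.comp
    (contMDiffOn_id.prodMk contMDiffOn_const) fun x hx => hx

end IsTruncChart

end Truncated

/-! ### Weighted volumes near a stratum -/

section TruncatedVolume

open Topology

/-- Provides a point of every truncated fibre, at which dimensions can be compared. -/
theorem IsCone.exists_rho_eq_one {k n d : ℕ} {Z : QACData.{u} n} {Y : BlowupData.{u} d}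
    {Φ : PartialDiffeomorph (𝓘(ℝ, ℝ).prod (𝓡 d)) (𝓡 n) (ℝ × Y.Y) Z.Z ∞} {C₀ : ℝ}
    (H : IsCone k Z Y Φ C₀) : ∃ z, Z.ρ z = 1 := by
  obtain ⟨y⟩ : Nonempty Y.Y := inferInstance
  refine ⟨Φ (1, y), H.rho_core _ ?_⟩
  rintro ⟨⟨t, y'⟩, ht, e⟩
  have h1 : t = 1 := congrArg Prod.fst
    (Φ.injOn (H.mem_source (le_of_lt ht.1) y') (H.mem_source le_rfl y) e)
  exact (ne_of_gt ht.1) h1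

variable {k d e s l : ℕ} {m : ℕ → ℕ} {Y : BlowupData.{u} d} {Z : QACData.{u} e}
  {L : BlowupData.{u} l} {S : Mfd.{u} s}
  {A : Set Y.Y} {κ : Metric S} {pr : Y.Y → S} {V : Set S}
  {Φ : ℝ → PartialDiffeomorph (𝓡 d) ((𝓡 s).prod (𝓡 e)) Y.Y (S × Z.Z) ∞} {K : ℝ}
  {Θ : PartialDiffeomorph (𝓘(ℝ, ℝ).prod (𝓡 l)) (𝓡 e) (ℝ × L.Y) Z.Z ∞} {C₀ : ℝ}

theorem IsCone.w_nonneg (H : IsCone k Z L Θ C₀) (hL : HasVolumeBounds k m L) (z : Z.Z) :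
    ∀ j < k, 0 ≤ Z.w j z := fun _ hj =>
  (one_div_nonneg.2 (zero_le_one.trans (H.one_le_rho z))).trans (H.w_mem hL z hj).1

/-- The cancellation behind uniformity in `ε`: `ε^e` from the fibre volume and `ε^a` from the
weights compensate the growth `(β/ε)^(a+e)` in the fibre. -/
theorem ofReal_scaling {ε β a : ℝ} (hε : 0 < ε) (hβ : 0 < β) (e : ℕ) :
    ENNReal.ofReal ε ^ e * (ENNReal.ofReal (ε ^ a) * ENNReal.ofReal ((β * (1 / ε)) ^ (a + e))) =
      ENNReal.ofReal (β ^ (a + e)) := by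
  have h1 : 0 < β * (1 / ε) := by positivity
  rw [← ENNReal.ofReal_pow hε.le, ← ENNReal.ofReal_mul (by positivity),
    ← ENNReal.ofReal_mul (by positivity)]
  congr 1
  rw [← mul_assoc, ← Real.rpow_natCast, ← Real.rpow_add hε, add_comm (e : ℝ) a,
    ← Real.mul_rpow hε.le h1.le]
  congr 1
  field_simp

/-- The integral is at most a constant times `vol V`, `ε^(a+e)` and the weighted volume of `{ρ ≤
1/ε}`. The upper bound for the fibre, a QAC space of smaller depth with radial exponent the sum of
all `b i`, makes this independent of `ε`. -/
theorem IsTruncChart.exists_setLIntegral_le [CompactSpace S] (T : IsTruncChart k Y Z A κ pr V Φ K)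
    (H : IsCone k Z L Θ C₀) (hL : HasVolumeBounds k m L) {b : ℕ → ℝ}
    (ha : 0 < ∑ i ∈ Finset.range (k + 1), b i + e)
    (hb : ∀ j < k, 0 < ∑ i ∈ Finset.range (j + 1), b i + m j)
    (hmeas : ∀ ε ∈ Ioc (0 : ℝ) 1, Measurable (resWeight (k + 1) Y b ε)) :
    ∃ C : ℝ≥0∞, C ≠ ⊤ ∧ ∀ ε ∈ Ioc (0 : ℝ) 1,
      ∫⁻ y in A ∩ pr ⁻¹' V, resWeight (k + 1) Y b ε y ∂vol (Y.h ε) ≤ C := by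
  rcases V.eq_empty_or_nonempty with rfl | ⟨q₀, hq₀⟩
  · exact ⟨0, ENNReal.zero_ne_top, fun ε _ => by simp⟩
  obtain ⟨z₀, hz₀⟩ := H.exists_rho_eq_one
  obtain ⟨C, hC, hC'⟩ := H.exists_setLIntegral_weight_le hL ha hb
  set a := ∑ i ∈ Finset.range (k + 1), b i with ha_def
  refine ⟨(ballVol d * (ballVol e)⁻¹ * (ENNReal.ofReal K ^ d * ENNReal.ofReal √2 ^ d)) *
        (ballVol s)⁻¹ * (vol κ V * C), ?_, fun ε hε => ?_⟩
  · refine ENNReal.mul_ne_top (ENNReal.mul_ne_top (ENNReal.mul_ne_top (ENNReal.mul_ne_top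
      (ballVol_ne_top d) (ENNReal.inv_ne_top.2 (ballVol_pos e))) (ENNReal.mul_ne_top
      (ENNReal.pow_ne_top ENNReal.ofReal_ne_top) (ENNReal.pow_ne_top ENNReal.ofReal_ne_top)))
      (ENNReal.inv_ne_top.2 (ballVol_pos s))) (ENNReal.mul_ne_top ?_ hC)
    exact ((measure_mono (subset_univ V)).trans_lt isCompact_univ.measure_lt_top).ne
  · have hR : 1 ≤ 1 / ε := (one_le_div hε.1).2 hε.2
    have hTm : MeasurableSet {z | Z.ρ z ≤ 1 / ε} := H.measurable_rho measurableSet_Iic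
    have h1 := setLIntegral_image_prod_le (W := V) (T := {z | Z.ρ z ≤ 1 / ε}) (lam := ε)
      (f := resWeight (k + 1) Y b ε) (G := fun z => ENNReal.ofReal (ε ^ a) * weight k Z a b z)
      (Y.h ε) κ Z.g (T.finrank_eq hε hq₀ (hz₀.trans_le hR))
      (isEmb_partialDiffeomorph (Φ ε).symm) (T.subset_target ε hε) T.isOpen.measurableSet hTm
      (hmeas ε hε) T.pos hε.1
      (fun p hp => T.resWeight_symm hε H.one_le_rho (H.w_nonneg hL) b hp.1 hp.2)
      (fun p hp a v => T.quad_le ε hε p.1 hp.1 p.2 hp.2 a v)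
    rw [T.image_eq hε] at h1
    refine h1.trans (mul_le_mul_right ?_ _)
    rw [lintegral_const_mul _ (H.measurable_weight a b)]
    calc _ ≤ ENNReal.ofReal ε ^ e * vol κ V * (ENNReal.ofReal (ε ^ a) *
          (C * ENNReal.ofReal ((1 / ε) ^ (a + e)))) :=
          mul_le_mul_right (mul_le_mul_right (hC' _ hR) _) _
      _ = vol κ V * C * (ENNReal.ofReal ε ^ e * (ENNReal.ofReal (ε ^ a) *
          ENNReal.ofReal ((1 * (1 / ε)) ^ (a + e)))) := by rw [one_mul]; ring
      _ = vol κ V * C := by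
        rw [ofReal_scaling hε.1 one_pos, Real.one_rpow, ENNReal.ofReal_one, mul_one]

/-- A point of a truncated fibre can be moved a little inwards, so that a ball of size comparable to
the truncation radius around the new point stays in the truncation. -/
theorem IsTruncChart.exists_gball_subset (T : IsTruncChart k Y Z A κ pr V Φ K)
    (H : IsCone k Z L Θ C₀) [CompactSpace L.Y] {θ β : ℝ} (hθ : 0 < θ) (hθ4 : θ ≤ 1 / 4)
    (hβ : 0 < β) (hβθ : C₀ * β ≤ θ) {ε : ℝ} (hε : ε ∈ Ioc (0 : ℝ) (1 / 4)) {q : S} (hq : q ∈ V)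
    {z : Z.Z} (hz : Z.ρ z ≤ 1 / ε) :
    ∃ z', (∀ x ∈ gball Z.g z' (β * (1 / ε)), Z.ρ x ≤ 1 / ε) ∧
      gdist (Y.h ε) ((Φ ε).symm (q, z)) ((Φ ε).symm (q, z')) ≤ ENNReal.ofReal (K * C₀ * θ) := by
  have hε' : ε ∈ Ioc (0 : ℝ) 1 := ⟨hε.1, hε.2.trans (by norm_num)⟩
  have hC := H.pos
  have hεR : ε * (1 / ε) = 1 := mul_one_div_cancel hε.1.ne'
  have hR : 4 ≤ 1 / ε := by
    rw [le_div_iff₀ hε.1]; linarith [hε.2]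
  set R := 1 / ε with hR'
  have hβR : C₀ * (β * R) ≤ θ * R := by
    rw [← mul_assoc]; exact mul_le_mul_of_nonneg_right hβθ (by linarith)
  have hθR : θ * R ≤ 1 / 4 * R := mul_le_mul_of_nonneg_right hθ4 (by linarith)
  have hβ0 : 0 ≤ β * R := by positivity
  -- If `ρ z ≤ R/2` there is room already. Otherwise `z` is moved inwards by `θR` along its ray; `R
  -- ≥ 4` and `θ ≤ 1/4` keep the ray in `ρ > 1`, and the cost in `h ε` is `Kε · C₀θR = K C₀ θ`.
  by_cases h : Z.ρ z ≤ R / 2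
  · refine ⟨z, fun x hx => ?_, by rw [gdist_self]; exact zero_le⟩
    have := H.rho_le_add hβ0 hx
    linarith
  · rw [not_le] at h
    obtain ⟨y, hy⟩ := H.exists_of_one_lt_rho (z := z) (by linarith)
    set t := Z.ρ z with ht
    have ht' : 1 < t - θ * R := by linarith
    have htt : t - θ * R ≤ t := by have := mul_nonneg hθ.le (by linarith : (0:ℝ) ≤ R); linarith
    have hρ := H.rho_end _ ht' y
    refine ⟨Θ (t - θ * R, y), fun x hx => ?_, ?_⟩
    · have := H.rho_le_add hβ0 hx
      linarith
    · have hin : ∀ τ ∈ Icc (t - θ * R) t, Z.ρ (Θ (τ, y)) ≤ R := fun τ hτ => by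
        rw [H.rho_end τ (ht'.trans_le hτ.1)]; exact hτ.2.trans hz
      have h1 := gdist_comp_le Z.g (Y.h ε) (f := fun z => (Φ ε).symm (q, z))
        (O := (fun z => (q, z)) ⁻¹' (Φ ε).target) (γ := fun τ => Θ (τ, y))
        ((Φ ε).open_target.preimage (by fun_prop))
        ((isEmb_partialDiffeomorph (Φ ε).symm).contMDiffOn.comp
          (contMDiffOn_const.prodMk contMDiffOn_id) fun x hx => hx) htt (mul_pos T.pos hε.1).le
        (fun τ hτ => H.contMDiffAt_radial (ht'.le.trans hτ.1) y)
        (fun τ hτ => T.subset_target ε hε' ⟨hq, hin τ hτ⟩)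
        (fun τ hτ v => T.quad_fibre_le hε' hq (hin τ hτ) v)
      rw [← hy, gdist_comm] at h1
      refine h1.trans ((mul_le_mul_right (H.glen_radial_le ht'.le y) _).trans ?_)
      rw [← ENNReal.ofReal_mul (mul_pos T.pos hε.1).le]
      refine ENNReal.ofReal_le_ofReal (le_of_eq ?_)
      calc K * ε * (C₀ * (t - (t - θ * R))) = K * C₀ * θ * (ε * R) := by ring
        _ = _ := by rw [hεR, mul_one]

/-- After the inward move, a base ball times a fibre ball of radius `β/ε` lies in `B(y, δ)`. Its
centre satisfies `ρ ≤ 1/ε`, so the lower bound of the fibre with `c = β` applies, and the powers of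
`ε` cancel. The constant does not depend on the chart, only on `K` and `lam`. -/
theorem exists_le_setLIntegral_of_isTruncChart [CompactSpace S] [ConnectedSpace Z.Z]
    (H : IsCone k Z L Θ C₀) (hL : HasVolumeBounds k m L) (κ : Metric S) (pr : Y.Y → S) (A : Set Y.Y)
    {K lam δ : ℝ} (hK : 0 < K) (hlam : 0 < lam) (hδ : 0 < δ) (b : ℕ → ℝ)
    (hmeas : ∀ ε ∈ Ioc (0 : ℝ) 1, Measurable (resWeight (k + 1) Y b ε)) :
    ∃ C : ℝ≥0∞, C ≠ 0 ∧ ∀ V Φ, IsTruncChart k Y Z A κ pr V Φ K → ∀ ε ∈ Ioc (0 : ℝ) (1 / 4),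
      ∀ y ∈ A, gball κ (pr y) lam ⊆ V →
        C ≤ ∫⁻ y' in gball (Y.h ε) y δ, resWeight (k + 1) Y b ε y' ∂vol (Y.h ε) := by
  have hLc := hL.compactSpace
  have hC := H.pos
  -- `θ`, `β` and `lam'` are chosen so that the inward move, the move in the fibre and the move
  -- along the base each cost at most `δ/4`; `C₀ β ≤ θ` keeps the fibre ball in the truncation.
  set θ : ℝ := min (1 / 4) (δ / (4 * K * C₀)) with hθ
  have hθ0 : 0 < θ := by positivity
  have hθ4 : θ ≤ 1 / 4 := min_le_left _ _
  have hθδ : K * C₀ * θ ≤ δ / 4 := by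
    have h1 : θ ≤ δ / (4 * K * C₀) := min_le_right _ _
    refine (mul_le_mul_of_nonneg_left h1 (by positivity)).trans (le_of_eq ?_)
    field_simp
  set β : ℝ := min (θ / C₀) (δ / (4 * K)) with hβ
  have hβ0 : 0 < β := by positivity
  have hβθ : C₀ * β ≤ θ := by
    refine (mul_le_mul_of_nonneg_left (min_le_left _ _) hC.le).trans (le_of_eq ?_)
    field_simp
  have hβδ : K * β ≤ δ / 4 := by
    refine (mul_le_mul_of_nonneg_left (min_le_right _ _) hK.le).trans (le_of_eq ?_)
    field_simp
  set lam' : ℝ := min lam (δ / (4 * K)) with hlam'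
  have hlam0 : 0 < lam' := by positivity
  have hlamδ : K * lam' ≤ δ / 4 := by
    refine (mul_le_mul_of_nonneg_left (min_le_right _ _) hK.le).trans (le_of_eq ?_)
    field_simp
  obtain ⟨v, hv, hv'⟩ := exists_le_vol_gball κ isCompact_univ hlam0
  set a := ∑ i ∈ Finset.range (k + 1), b i with ha_def
  obtain ⟨C₁, hC₁, hLZ⟩ := H.exists_le_setLIntegral_weight hL a b hβ0
  set D : ℝ≥0∞ := ballVol s * (ballVol e * (ballVol d)⁻¹ * ENNReal.ofReal K ^ d) with hD
  have hDt : D ≠ ⊤ := ENNReal.mul_ne_top (ballVol_ne_top s) (ENNReal.mul_ne_top (ENNReal.mul_ne_top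
    (ballVol_ne_top e) (ENNReal.inv_ne_top.2 (ballVol_pos d)))
      (ENNReal.pow_ne_top ENNReal.ofReal_ne_top))
  refine ⟨D⁻¹ * (v * C₁ * ENNReal.ofReal (β ^ (a + e))), mul_ne_zero (ENNReal.inv_ne_zero.2 hDt)
    (mul_ne_zero (mul_ne_zero hv hC₁) (ENNReal.ofReal_pos.2 (by positivity)).ne'),
    fun V Φ T ε hε y hyA hyV => ?_⟩
  have hε' : ε ∈ Ioc (0 : ℝ) 1 := ⟨hε.1, hε.2.trans (by norm_num)⟩
  have hqV : pr y ∈ V := hyV (mem_gball_self κ _ hlam)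
  obtain ⟨⟨q, z⟩, ⟨hq, hz⟩, hyq⟩ : y ∈ (Φ ε).symm '' (V ×ˢ {z | Z.ρ z ≤ 1 / ε}) := by
    rw [T.image_eq hε']; exact ⟨hyA, hqV⟩
  have hqy : pr y = q := by
    have hy' : y ∈ A ∩ pr ⁻¹' V := ⟨hyA, hqV⟩
    rw [← T.fst_eq ε hε' y hy', ← hyq, T.right_inv hε' hq hz]
  rw [hqy] at hyV
  obtain ⟨z', hz', hdist⟩ := T.exists_gball_subset H hθ0 hθ4 hβ0 hβθ hε hq hz
  rw [hyq] at hdist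
  have hεR : ε * (1 / ε) = 1 := mul_one_div_cancel hε.1.ne'
  have hR0 : 0 < 1 / ε := one_div_pos.2 hε.1
  set R := 1 / ε with hR
  have hWV : gball κ q lam' ⊆ V := (gball_mono κ q (min_le_left _ _)).trans hyV
  have hsub : gball κ q lam' ×ˢ gball Z.g z' (β * R) ⊆ (Φ ε).target :=
    (prod_mono hWV hz').trans (T.subset_target ε hε')
  have hz'R : Z.ρ z' ≤ R := hz' z' (mem_gball_self _ _ (by positivity))
  have himg : (Φ ε).symm '' (gball κ q lam' ×ˢ gball Z.g z' (β * R)) ⊆ gball (Y.h ε) y δ := by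
    rintro _ ⟨⟨q', x⟩, ⟨hq', hx⟩, rfl⟩
    have h1 := T.gdist_fibre_lt hε' hq hz' hx
    have h2 := T.gdist_base_lt hε' (hz' x hx) hWV hq'
    have h3 : K * ε * (β * R) ≤ δ / 4 := by
      calc K * ε * (β * R) = K * β * (ε * R) := by ring
        _ ≤ δ / 4 := by rw [hεR, mul_one]; exact hβδ
    change gdist (Y.h ε) y _ < _
    calc _ ≤ gdist (Y.h ε) y ((Φ ε).symm (q, z')) +
          (gdist (Y.h ε) ((Φ ε).symm (q, z')) ((Φ ε).symm (q, x)) +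
            gdist (Y.h ε) ((Φ ε).symm (q, x)) ((Φ ε).symm (q', x))) :=
          (gdist_triangle _ _ ((Φ ε).symm (q, z')) _).trans (add_le_add le_rfl (gdist_triangle _ _ _ _))
      _ ≤ ENNReal.ofReal (δ / 4) + (ENNReal.ofReal (δ / 4) + ENNReal.ofReal (δ / 4)) :=
          add_le_add (hdist.trans (ENNReal.ofReal_le_ofReal hθδ))
            (add_le_add (h1.le.trans (ENNReal.ofReal_le_ofReal h3))
              (h2.le.trans (ENNReal.ofReal_le_ofReal hlamδ)))
      _ = ENNReal.ofReal (δ / 4 + (δ / 4 + δ / 4)) := by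
          rw [← ENNReal.ofReal_add (by positivity) (by positivity),
            ← ENNReal.ofReal_add (by positivity) (by positivity)]
      _ < ENNReal.ofReal δ := (ENNReal.ofReal_lt_ofReal_iff hδ).2 (by linarith)
  have hlow := le_setLIntegral_image_prod (W := gball κ q lam') (T := gball Z.g z' (β * R))
    (lam := ε) (f := resWeight (k + 1) Y b ε)
    (G := fun z => ENNReal.ofReal (ε ^ a) * weight k Z a b z)
    (Y.h ε) κ Z.g (T.finrank_eq hε' hq hz)
    (isEmb_partialDiffeomorph (Φ ε).symm) hsub (isOpen_gball _ _ _).measurableSet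
    (isOpen_gball _ _ _).measurableSet (hmeas ε hε') hK hε.1
    (fun p hp => T.resWeight_symm hε' H.one_le_rho (H.w_nonneg hL) b (hWV hp.1) (hz' _ hp.2))
    (fun p hp a v => T.le_quad ε hε' p.1 (hWV hp.1) p.2 (hz' _ hp.2) a v)
  rw [lintegral_const_mul _ (H.measurable_weight a b)] at hlow
  have hfin := hlow.trans (mul_le_mul_right (lintegral_mono_set himg) _)
  rw [← ENNReal.div_eq_inv_mul]
  refine ENNReal.div_le_of_le_mul' (le_trans ?_ hfin)
  calc v * C₁ * ENNReal.ofReal (β ^ (a + e)) = v * C₁ * (ENNReal.ofReal ε ^ e *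
        (ENNReal.ofReal (ε ^ a) * ENNReal.ofReal ((β * R) ^ (a + e)))) := by
        rw [hR, ofReal_scaling hε.1 hβ0]
    _ = ENNReal.ofReal ε ^ e * v * (ENNReal.ofReal (ε ^ a) *
        (C₁ * ENNReal.ofReal ((β * R) ^ (a + e)))) := by ring
    _ ≤ _ := mul_le_mul' (mul_le_mul_right (hv' q (mem_univ _)) _) (mul_le_mul_right
        (hLZ z' (β * R) (mul_le_mul_of_nonneg_left hz'R hβ0.le)) _)

end TruncatedVolume

/-! ### Volume bounds for resolution blowups -/

section Blowup

open Topology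

variable {k d : ℕ} {m : ℕ → ℕ} {Y D : BlowupData.{u} d} {A : Set Y.Y}
  {ι : PartialDiffeomorph (𝓡 d) (𝓡 d) Y.Y D.Y ∞} {ε : ℝ}

/-- `ι` identifies `Y`, outside the interior of `A`, isometrically with a part of `D`. -/
structure IsHalf (k : ℕ) (Y D : BlowupData.{u} d) (A : Set Y.Y)
    (ι : PartialDiffeomorph (𝓡 d) (𝓡 d) Y.Y D.Y ∞) : Prop where
  subset_source : (interior A)ᶜ ⊆ ι.source
  quad_eq : ∀ ε ∈ Ioc (0 : ℝ) 1, ∀ y ∈ (interior A)ᶜ, ∀ v : TangentSpace (𝓡 d) y,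
    quad (Y.h ε) y v = quad (D.h ε) (ι y) (mfderiv (𝓡 d) (𝓡 d) ι y v)
  σ_last : ∀ ε ∈ Ioc (0 : ℝ) 1, ∀ y ∉ A, Y.σ ε k y = 1
  σ_lt : ∀ ε ∈ Ioc (0 : ℝ) 1, ∀ y ∉ A, ∀ j < k, Y.σ ε j y = D.σ ε j (ι y)

theorem IsHalfOfDouble.exists_isHalf (h : IsHalfOfDouble k Y A D) : ∃ ι, IsHalf k Y D A ι := by
  obtain ⟨ι, -, h1, -, -, -, -, h⟩ := h
  exact ⟨ι, h1, fun ε hε => (h ε hε).1, fun ε hε y hy => ((h ε hε).2 y hy).1,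
    fun ε hε y hy => ((h ε hε).2 y hy).2⟩

namespace IsHalf

variable (T : IsHalf k Y D A ι) (hε : ε ∈ Ioc (0 : ℝ) 1)

include T

theorem compl_subset_source : Aᶜ ⊆ ι.source :=
  (compl_subset_compl.2 interior_subset).trans T.subset_source

include hε

theorem resWeight_eq (b : ℕ → ℝ) {y : Y.Y} (hy : y ∉ A) :
    resWeight (k + 1) Y b ε y = resWeight k D b ε (ι y) := by
  unfold resWeight
  rw [Finset.prod_range_succ, T.σ_last ε hε y hy, Real.one_rpow, mul_one]
  congr 1
  exact Finset.prod_congr rfl fun j hj => by rw [T.σ_lt ε hε y hy j (Finset.mem_range.1 hj)]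

/-- Outside `A` the new factor of the weight is `1` and `ι` is an isometric embedding into `D`. -/
theorem setLIntegral_compl_le (hA : IsClosed A) (hD : HasVolumeBounds k m D) (b : ℕ → ℝ) :
    ∫⁻ y in Aᶜ, resWeight (k + 1) Y b ε y ∂vol (Y.h ε) ≤
      ∫⁻ y, resWeight k D b ε y ∂vol (D.h ε) := by
  rw [setLIntegral_congr_fun hA.isOpen_compl.measurableSet fun y hy => T.resWeight_eq hε b hy]
  refine (setLIntegral_le_image_of_le_quad (D.h ε) (Y.h ε) (isEmb_partialDiffeomorph ι)
    T.compl_subset_source hA.isOpen_compl.measurableSet (hD.measurable_resWeight b hε) one_pos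
    fun y hy v => ?_).trans ?_
  · rw [T.quad_eq ε hε y (fun h => hy (interior_subset h)) v, one_pow, one_mul]
  · rw [ENNReal.ofReal_one, one_pow, one_mul]
    exact setLIntegral_le_lintegral _ _

theorem quad_symm {y : Y.Y} (hy : y ∈ (interior A)ᶜ) (v : TangentSpace (𝓡 d) (ι y)) :
    quad (Y.h ε) (ι.symm (ι y)) (mfderiv (𝓡 d) (𝓡 d) ι.symm (ι y) v) = quad (D.h ε) (ι y) v := by
  have hs := T.subset_source hy
  have ht : ι y ∈ ι.target := ι.map_source hs
  have h1 : ι.symm (ι y) = y := ι.left_inv hs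
  have h2 : (mfderiv (𝓡 d) (𝓡 d) ι y (mfderiv (𝓡 d) (𝓡 d) ι.symm (ι y) v) :
      EuclideanSpace ℝ (Fin d)) = v := by
    have := mfderiv_leftInverse (f := ι.symm) (g := ι) ι.open_target ht
      (fun x hx => ι.right_inv hx) ((isEmb_partialDiffeomorph ι.symm).mdifferentiableAt ht)
      (by rw [h1]; exact (isEmb_partialDiffeomorph ι).mdifferentiableAt hs) v
    rw [h1] at this
    exact this
  let w : EuclideanSpace ℝ (Fin d) := mfderiv (𝓡 d) (𝓡 d) ι.symm (ι y) v
  calc _ = quad (Y.h ε) y w := quad_congr_point _ h1 _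
    _ = _ := T.quad_eq ε hε y hy w
    _ = _ := congrArg (fun x : EuclideanSpace ℝ (Fin d) => quad (D.h ε) (ι y) x) h2

/-- A short path that starts in the image of the complement of `A` either stays there, or leads to
a point of `A` close to the starting point. -/
theorem gdist_symm_lt_or [CompactSpace Y.Y] (hA : IsClosed A) {y : Y.Y} (hy : y ∉ A) {δ : ℝ}
    {x : D.Y} (hx : x ∈ gball (D.h ε) (ι y) δ) :
    (x ∈ ι '' Aᶜ ∧ ι.symm x ∈ gball (Y.h ε) y δ) ∨ ∃ y₁ ∈ A, y₁ ∈ gball (Y.h ε) y δ := by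
  obtain ⟨γ, h0, h1, hγ, hl⟩ := exists_glen_lt (D.h ε) hx
  have hopen : IsOpen (ι '' Aᶜ) :=
    ι.toOpenPartialHomeomorph.isOpen_image_of_subset_source hA.isOpen_compl T.compl_subset_source
  have hcl : IsClosed (ι '' (interior A)ᶜ) :=
    (isOpen_interior.isClosed_compl.isCompact.image_of_continuousOn
      ((isEmb_partialDiffeomorph ι).contMDiffOn.continuousOn.mono T.subset_source)).isClosed
  have hsub : ι '' Aᶜ ⊆ ι '' (interior A)ᶜ := image_mono (compl_subset_compl.2 interior_subset)
  have key : ∀ τ ∈ Icc (0 : ℝ) 1, (∀ τ' ∈ Icc 0 τ, γ τ' ∈ ι '' (interior A)ᶜ) →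
      ι.symm (γ τ) ∈ gball (Y.h ε) y δ := by
    intro τ hτ hin
    have h2 := gdist_comp_le (D.h ε) (Y.h ε) (f := ι.symm) (O := ι.target) ι.open_target
      (isEmb_partialDiffeomorph ι.symm).contMDiffOn hτ.1 zero_le_one
      (fun t _ => hγ.contMDiffAt) (fun t ht => by
        obtain ⟨z, hz, e⟩ := hin t ht
        rw [← e]; exact ι.map_source (T.subset_source hz))
      (fun t ht v => by
        rw [one_pow, one_mul]
        obtain ⟨z, hz, e⟩ := hin t ht
        revert v
        rw [← e]
        exact fun v => (T.quad_symm hε hz v).le)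
    rw [ENNReal.ofReal_one, one_mul, h0] at h2
    have h3 : ι.symm (ι y) = y := ι.left_inv (T.compl_subset_source hy)
    rw [h3] at h2
    exact h2.trans_lt ((glen_mono _ _ le_rfl hτ.2).trans_lt hl)
  rcases exists_first_exit hγ.continuous hopen (h0 ▸ mem_image_of_mem ι hy) with
    hall | ⟨τ₁, hτ₁, hout, hin⟩
  · left
    have h4 := hall 1 ⟨zero_le_one, le_rfl⟩
    have h5 := key 1 ⟨zero_le_one, le_rfl⟩ fun τ hτ => hsub (hall τ hτ)
    rw [h1] at h4 h5
    exact ⟨h4, h5⟩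
  · right
    -- Up to and including the first exit time the path stays in the closed image of `(interior
    -- A)ᶜ`, where `ι` is still isometric. The exit point therefore comes from a point of `A`,
    -- reached within `δ`.
    have h2 := closure_minimal (fun τ hτ => hsub (hin τ hτ) : Ico 0 τ₁ ⊆ γ ⁻¹' (ι '' (interior A)ᶜ))
      (hcl.preimage hγ.continuous)
    rw [closure_Ico hτ₁.1.ne] at h2
    have h3 := key τ₁ ⟨hτ₁.1.le, hτ₁.2⟩ h2
    obtain ⟨y₁, hy₁, e⟩ := h2 ⟨hτ₁.1.le, le_rfl⟩
    have h4 : ι.symm (ι y₁) = y₁ := ι.left_inv (T.subset_source hy₁)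
    rw [← e, h4] at h3
    refine ⟨y₁, ?_, h3⟩
    by_contra h5
    exact hout (e ▸ mem_image_of_mem ι h5)

/-- A ball of `D` that comes entirely from outside `A` is carried isometrically, with its weight,
into the ball of `Y`. -/
theorem setLIntegral_gball_le (b : ℕ → ℝ)
    (hmeas : Measurable (resWeight (k + 1) Y b ε)) {y : Y.Y} {δ : ℝ}
    (h : ∀ x ∈ gball (D.h ε) (ι y) δ, x ∈ ι '' Aᶜ ∧ ι.symm x ∈ gball (Y.h ε) y δ) :
    ∫⁻ x in gball (D.h ε) (ι y) δ, resWeight k D b ε x ∂vol (D.h ε) ≤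
      ∫⁻ y' in gball (Y.h ε) y δ, resWeight (k + 1) Y b ε y' ∂vol (Y.h ε) := by
  have hm := (isOpen_gball (D.h ε) (ι y) δ).measurableSet
  have h1 : ∀ x ∈ gball (D.h ε) (ι y) δ,
      resWeight k D b ε x = resWeight (k + 1) Y b ε (ι.symm x) := by
    intro x hx
    obtain ⟨⟨z, hz, rfl⟩, -⟩ := h x hx
    have h2 : ι.symm (ι z) = z := ι.left_inv (T.compl_subset_source hz)
    rw [h2, T.resWeight_eq hε b hz]
  rw [setLIntegral_congr_fun hm h1]
  refine (setLIntegral_le_image_of_le_quad (Y.h ε) (D.h ε) (isEmb_partialDiffeomorph ι.symm)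
    (fun x hx => ?_) hm hmeas one_pos fun x hx v => ?_).trans ?_
  · obtain ⟨⟨z, hz, rfl⟩, -⟩ := h x hx
    exact ι.map_source (T.compl_subset_source hz)
  · obtain ⟨⟨z, hz, e⟩, -⟩ := h x hx
    rw [one_pow, one_mul]
    revert v
    rw [← e]
    exact fun v => (T.quad_symm hε (fun h => hz (interior_subset h)) v).ge
  · rw [ENNReal.ofReal_one, one_pow, one_mul]
    refine lintegral_mono_set ?_
    rintro _ ⟨x, hx, rfl⟩
    exact (h x hx).2

end IsHalf

theorem measurable_of_forall_inter {X : Type*} [MeasurableSpace X] {I : Type*} [Countable I]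
    {P : I → Set X} (hP : ⋃ i, P i = univ) {f : X → ℝ}
    (h : ∀ i t, MeasurableSet t → MeasurableSet (P i ∩ f ⁻¹' t)) : Measurable f := by
  intro t ht
  have : f ⁻¹' t = ⋃ i, P i ∩ f ⁻¹' t := by rw [← iUnion_inter, hP, univ_inter]
  rw [this]
  exact MeasurableSet.iUnion fun i => h i t ht

/-- A version of the Lebesgue number lemma for the geodesic distance. -/
theorem exists_forall_gball_subset {s : ℕ} {S : Mfd.{u} s} [CompactSpace S] (κ : Metric S)
    {V : S → Set S} (hV : ∀ q, V q ∈ 𝓝 q) : ∃ lam : ℝ, 0 < lam ∧ ∀ q, ∃ q₀, gball κ q lam ⊆ V q₀ := by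
  suffices h : ∃ lam : ℝ, 0 < lam ∧ ∀ q ∈ (univ : Set S), ∃ q₀, gball κ q lam ⊆ V q₀ by
    obtain ⟨lam, hlam, h⟩ := h
    exact ⟨lam, hlam, fun q => h q (mem_univ q)⟩
  refine isCompact_univ.induction_on
    (p := fun t => ∃ lam : ℝ, 0 < lam ∧ ∀ q ∈ t, ∃ q₀, gball κ q lam ⊆ V q₀)
    ⟨1, one_pos, by simp⟩ (fun s t hst ⟨l, hl, h⟩ => ⟨l, hl, fun x hx => h x (hst hx)⟩) ?_ ?_
  · rintro s t ⟨l, hl, hs⟩ ⟨l', hl', ht⟩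
    refine ⟨min l l', lt_min hl hl', fun x hx => ?_⟩
    rcases hx with hx | hx
    · obtain ⟨q₀, h⟩ := hs x hx
      exact ⟨q₀, (gball_mono κ x (min_le_left _ _)).trans h⟩
    · obtain ⟨q₀, h⟩ := ht x hx
      exact ⟨q₀, (gball_mono κ x (min_le_right _ _)).trans h⟩
  · intro q _
    obtain ⟨c, hc, hcV⟩ := exists_gdist_lt_subset κ (hV q)
    obtain ⟨l, hl0, hlc⟩ : ∃ l : ℝ, 0 < l ∧ ENNReal.ofReal l ≤ c := by
      rcases eq_or_ne c ⊤ with rfl | hct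
      · exact ⟨1, one_pos, le_top⟩
      · exact ⟨c.toReal, ENNReal.toReal_pos hc.ne' hct, (ENNReal.ofReal_toReal hct).le⟩
    have h2 : 0 < l / 2 := by positivity
    refine ⟨gball κ q (l / 2), mem_nhdsWithin_of_mem_nhds
      ((isOpen_gball κ q _).mem_nhds (mem_gball_self κ q h2)), l / 2, h2, fun x hx => ⟨q, ?_⟩⟩
    refine (gball_subset_gball κ h2.le h2.le (le_of_lt hx) (by linarith : l / 2 + l / 2 ≤ l)).trans ?_
    exact fun y hy => hcV (lt_of_lt_of_le (show gdist κ q y < ENNReal.ofReal l from hy) hlc)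

/-- The lower volume bounds for `ε` away from zero. -/
theorem exists_le_setLIntegral_of_compact [CompactSpace Y.Y] (hY : ContFamily Y.h (Ioc 0 1))
    (hσ : ∀ ε ∈ Ioc (0 : ℝ) 1, ∀ j < k, ∀ y, Y.σ ε j y ∈ Icc ε 1) (b : ℕ → ℝ)
    (hmeas : ∀ ε ∈ Ioc (0 : ℝ) 1, Measurable (resWeight k Y b ε)) {ε₀ δ : ℝ}
    (hε₀ : 0 < ε₀) (hδ : 0 < δ) : ∃ C : ℝ≥0∞, C ≠ 0 ∧ ∀ ε ∈ Icc ε₀ 1, ∀ y,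
      C ≤ ∫⁻ y' in gball (Y.h ε) y δ, resWeight k Y b ε y' ∂vol (Y.h ε) := by
  have hIcc : Icc ε₀ 1 ⊆ Ioc 0 1 := fun ε hε => ⟨hε₀.trans_le hε.1, hε.2⟩
  -- For `ε ≥ ε₀` everything is compared with the fixed metric `Y.h 1`: one direction places a fixed
  -- ball inside the moving one, the other bounds its volume below.
  obtain ⟨C₁, hC₁, h1⟩ := (hY.mono hIcc).exists_le isCompact_Icc (contFamily_const (Y.h 1))
  obtain ⟨C₂, hC₂, h2⟩ := (contFamily_const (Y.h 1)).exists_le isCompact_Icc (hY.mono hIcc)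
  obtain ⟨κ, hκ, hκ'⟩ := exists_le_prod_rpow hε₀ 1 k b
  obtain ⟨v, hv, hv'⟩ := exists_le_vol_gball (Y.h 1) isCompact_univ (div_pos hδ hC₁)
  have hD : ENNReal.ofReal C₂ ^ d ≠ ⊤ := ENNReal.pow_ne_top ENNReal.ofReal_ne_top
  have hid : ∀ (g : Metric Y.Y) (y : Y.Y) (v : TangentSpace (𝓡 d) y),
      quad g (id y) (mfderiv (𝓡 d) (𝓡 d) (id : Y.Y → Y.Y) y v) = quad g y v := fun g y v => by
    rw [mfderiv_id]; rfl
  refine ⟨(ENNReal.ofReal C₂ ^ d)⁻¹ * (ENNReal.ofReal κ * v), mul_ne_zero (ENNReal.inv_ne_zero.2 hD)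
    (mul_ne_zero (ENNReal.ofReal_pos.2 hκ).ne' hv), fun ε hε y => ?_⟩
  have hsub : gball (Y.h 1) y (δ / C₁) ⊆ gball (Y.h ε) y δ := fun x hx => by
    have := gdist_image_lt (Y.h 1) (Y.h ε) (f := id) isOpen_univ contMDiff_id.contMDiffOn hC₁
      (fun _ _ => mem_univ _) (fun z _ v => (hid _ z v).trans_le (h1 ε hε z v)) hx
    rwa [mul_div_cancel₀ _ hC₁.ne'] at this
  have hm := (isOpen_gball (Y.h 1) y (δ / C₁)).measurableSet
  have h3 := setLIntegral_le_image_of_le_quad (Y.h ε) (Y.h 1) (IsEmb.id (I₁ := 𝓡 d) (X₁ := Y.Y))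
    (subset_univ _) hm (hmeas ε (hIcc hε)) hC₂ (fun z _ v =>
      (h2 ε hε z v).trans_eq (by rw [hid]))
  rw [image_id] at h3
  rw [← ENNReal.div_eq_inv_mul]
  refine ENNReal.div_le_of_le_mul' (le_trans ?_ (h3.trans (mul_le_mul_right
    (lintegral_mono_set hsub) _)))
  calc ENNReal.ofReal κ * v ≤ ENNReal.ofReal κ * vol (Y.h 1) (gball (Y.h 1) y (δ / C₁)) :=
        mul_le_mul_right (hv' y (mem_univ _)) _
    _ = ∫⁻ _ in gball (Y.h 1) y (δ / C₁), ENNReal.ofReal κ ∂vol (Y.h 1) := by rw [setLIntegral_const]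
    _ ≤ _ := setLIntegral_mono' hm fun z _ => ENNReal.ofReal_le_ofReal (hκ' _ fun j hj => ?_)
  have := hσ ε (hIcc hε) j hj z
  exact ⟨hε.1.trans this.1, this.2⟩

theorem IsBlowup.hasVolumeBounds_zero (h : IsBlowup 0 m Y) : HasVolumeBounds 0 m Y := by
  obtain ⟨hc, hh⟩ := h
  have hw : ∀ b ε (y : Y.Y), resWeight 0 Y b ε y = 1 := fun b ε y => by simp [resWeight]
  have hcont : ContFamily Y.h (Ioc 0 1) := (contFamily_const (Y.h 1)).congr hh
  refine ⟨hc, hcont, by simp, by simp, fun b _ => ⟨vol (Y.h 1) univ,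
    isCompact_univ.measure_lt_top.ne, fun ε hε => ?_⟩, fun b δ hδ => ?_⟩
  · rw [hh ε hε]; simp [hw]
  · obtain ⟨v, hv, hv'⟩ := exists_le_vol_gball (Y.h 1) isCompact_univ hδ
    refine ⟨v, hv, fun ε hε y => ?_⟩
    rw [hh ε hε]
    simpa [hw] using hv' y (mem_univ _)

theorem SmoothFamily.contFamily (h : SmoothFamily Y) : ContFamily Y.h (Ioc 0 1) :=
  ContMDiffOn.continuousOn h

/-- The inductive step. Finitely many trivializing sets cover the stratum; the bounds on `A` come
from the fibres, those outside `A` from `D`. -/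
theorem IsBlowup.hasVolumeBounds_succ {e s l : ℕ} {Z : QACData.{u} e} {L : BlowupData.{u} l}
    {S : Mfd.{u} s} {κ : Metric S} {pr : Y.Y → S} {K C₀ : ℝ}
    {Θ : PartialDiffeomorph (𝓘(ℝ, ℝ).prod (𝓡 l)) (𝓡 e) (ℝ × L.Y) Z.Z ∞} (he : e = m k)
    [CompactSpace Y.Y] (hY : SmoothFamily Y) (hA : IsClosed A) (hD : HasVolumeBounds k m D)
    (hι : IsHalf k Y D A ι) [ConnectedSpace Z.Z] (hL : HasVolumeBounds k m L)
    (H : IsCone k Z L Θ C₀) [CompactSpace S] (hpr : ContinuousOn pr A)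
    (hT : ∀ s₀ : S, ∃ V Φ, s₀ ∈ V ∧ IsTruncChart k Y Z A κ pr V Φ K) :
    HasVolumeBounds (k + 1) m Y := by
  choose V Φ hV T using hT
  have hVn : ∀ q, V q ∈ 𝓝 q := fun q => (T q).isOpen.mem_nhds (hV q)
  obtain ⟨t, ht⟩ : ∃ t : Finset S, ∀ q, ∃ i ∈ t, q ∈ V i := by
    obtain ⟨t, -, ht⟩ := isCompact_univ.elim_nhds_subcover V fun q _ => hVn q
    refine ⟨t, fun q => ?_⟩
    simpa using ht (mem_univ q)
  have hcover : ∀ y ∈ A, ∃ i ∈ t, y ∈ A ∩ pr ⁻¹' V i := fun y hy =>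
    let ⟨i, hi, h⟩ := ht (pr y); ⟨i, hi, hy, h⟩
  have hmeasσ : ∀ ε ∈ Ioc (0 : ℝ) 1, ∀ j < k + 1, Measurable (Y.σ ε j) := by
    intro ε hε j hj
    refine measurable_of_forall_inter (I := Option t)
      (P := fun i => i.elim Aᶜ fun i => A ∩ pr ⁻¹' V i) ?_ ?_
    · refine eq_univ_of_forall fun y => ?_
      by_cases hy : y ∈ A
      · obtain ⟨i, hi, h⟩ := hcover y hy
        exact mem_iUnion.2 ⟨some ⟨i, hi⟩, h⟩
      · exact mem_iUnion.2 ⟨none, hy⟩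
    · rintro (_ | i) u hu
      · change MeasurableSet (Aᶜ ∩ Y.σ ε j ⁻¹' u)
        rcases Nat.lt_succ_iff_lt_or_eq.1 hj with hj | rfl
        · convert measurableSet_inter_preimage
            ((isEmb_partialDiffeomorph ι).contMDiffOn.continuousOn.mono hι.compl_subset_source)
            hA.isOpen_compl.measurableSet (hD.measurable_σ ε hε j hj hu) using 1
          ext y
          exact and_congr_right fun hy => by simp only [mem_preimage, hι.σ_lt ε hε y hy j hj]
        · convert hA.isOpen_compl.measurableSet.inter
            ((measurable_const : Measurable fun _ : Y.Y => (1 : ℝ)) hu) using 1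
          ext y
          exact and_congr_right fun hy => by simp only [mem_preimage, hι.σ_last ε hε y hy]
      · exact (T i).measurableSet_inter_σ hε hA.measurableSet hpr H.measurable_rho H.measurable_w
          hj hu
  -- On `A`, `1/ρ ≤ w_j ≤ 1` and `1 ≤ ρ ≤ 1/ε` give `ε ≤ ερ w_j ≤ 1`; outside `A` the bounds are
  -- those of `D`.
  have hσ : ∀ ε ∈ Ioc (0 : ℝ) 1, ∀ j < k + 1, ∀ y, Y.σ ε j y ∈ Icc ε 1 := by
    intro ε hε j hj y
    by_cases hy : y ∈ A
    · have hy' : y ∈ A ∩ pr ⁻¹' V (pr y) := ⟨hy, hV _⟩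
      have hρ := H.one_le_rho (Φ (pr y) ε y).2
      have hρ' := (T (pr y)).rho_le ε hε y hy'
      rw [le_div_iff₀' hε.1] at hρ'
      rcases Nat.lt_succ_iff_lt_or_eq.1 hj with hj | rfl
      · rw [(T (pr y)).σ_lt ε hε y hy' j hj]
        have hw := H.w_mem hL (Φ (pr y) ε y).2 hj
        have h0 : 0 < Z.ρ (Φ (pr y) ε y).2 := one_pos.trans_le hρ
        have h1 := hw.1
        rw [div_le_iff₀' h0] at h1
        have hw0 : 0 ≤ Z.w j (Φ (pr y) ε y).2 := H.w_nonneg hL _ j hj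
        refine ⟨?_, mul_le_one₀ hρ' hw0 hw.2⟩
        rw [mul_assoc]
        exact le_mul_of_one_le_right hε.1.le h1
      · rw [(T (pr y)).σ_last ε hε y hy']
        exact ⟨le_mul_of_one_le_right hε.1.le hρ, hρ'⟩
    · rcases Nat.lt_succ_iff_lt_or_eq.1 hj with hj | rfl
      · rw [hι.σ_lt ε hε y hy j hj]; exact hD.σ_mem ε hε j hj _
      · rw [hι.σ_last ε hε y hy]; exact ⟨hε.2, le_rfl⟩
  have hmeas : ∀ b, ∀ ε ∈ Ioc (0 : ℝ) 1, Measurable (resWeight (k + 1) Y b ε) := fun b ε hε =>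
    (Finset.measurable_prod _ fun j hj =>
      (hmeasσ ε hε j (Finset.mem_range.1 hj)).pow_const _).ennreal_ofReal
  refine ⟨inferInstance, hY.contFamily, hmeasσ, hσ, fun b hb => ?_, fun b δ hδ => ?_⟩
  · obtain ⟨U, hU, hU'⟩ := hD.upper b fun j hj => hb j (hj.trans k.lt_succ_self)
    -- The last positivity condition governs integrability over the new stratum, the preceding ones
    -- are inherited by `D` and by the fibre.
    have ha : 0 < ∑ i ∈ Finset.range (k + 1), b i + e := by
      rw [he]; exact hb k k.lt_succ_self
    choose C hC hC' using fun q => (T q).exists_setLIntegral_le H hL ha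
      (fun j hj => hb j (hj.trans k.lt_succ_self)) (hmeas b)
    refine ⟨U + ∑ i ∈ t, C i, ENNReal.add_ne_top.2 ⟨hU, ENNReal.sum_ne_top.2 fun i _ => hC i⟩,
      fun ε hε => ?_⟩
    rw [← lintegral_add_compl _ hA.measurableSet, add_comm]
    refine add_le_add ((hι.setLIntegral_compl_le hε hA hD b).trans (hU' ε hε)) ?_
    have hsub : A ⊆ ⋃ i : t, A ∩ pr ⁻¹' V i := fun y hy => by
      obtain ⟨i, hi, h⟩ := hcover y hy
      exact mem_iUnion.2 ⟨⟨i, hi⟩, h⟩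
    refine (lintegral_mono_set hsub).trans ((lintegral_iUnion_le _ _).trans ?_)
    rw [tsum_fintype, ← Finset.sum_coe_sort t]
    exact Finset.sum_le_sum fun i _ => hC' i ε hε
  · obtain ⟨lam, hlam, hlamV⟩ := exists_forall_gball_subset κ hVn
    have hδ2 : 0 < δ / 2 := by positivity
    have hK : 0 < K := (T (Classical.arbitrary S)).pos
    obtain ⟨C₁, hC₁, h1⟩ := exists_le_setLIntegral_of_compact hY.contFamily hσ b (hmeas b)
      (by norm_num : (0 : ℝ) < 1 / 4) hδ
    obtain ⟨C₂, hC₂, h2⟩ := exists_le_setLIntegral_of_isTruncChart H hL κ pr A hK hlam hδ2 b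
      (hmeas b)
    obtain ⟨C₃, hC₃, h3⟩ := hD.lower b (δ / 2) hδ2
    refine ⟨min C₁ (min C₂ C₃), (lt_min (pos_iff_ne_zero.2 hC₁) (lt_min (pos_iff_ne_zero.2 hC₂)
      (pos_iff_ne_zero.2 hC₃))).ne', fun ε hε y => ?_⟩
    by_cases hε4 : 1 / 4 ≤ ε
    · exact (min_le_left _ _).trans (h1 ε ⟨hε4, hε.2⟩ y)
    have hε' : ε ∈ Ioc (0 : ℝ) (1 / 4) := ⟨hε.1, (not_le.1 hε4).le⟩
    refine (min_le_right _ _).trans ?_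
    have hcaseA : ∀ y₁ ∈ A, gdist (Y.h ε) y y₁ ≤ ENNReal.ofReal (δ / 2) →
        C₂ ≤ ∫⁻ y' in gball (Y.h ε) y δ, resWeight (k + 1) Y b ε y' ∂vol (Y.h ε) := by
      intro y₁ hy₁ hd
      obtain ⟨q₀, hq₀⟩ := hlamV (pr y₁)
      refine (h2 (V q₀) (Φ q₀) (T q₀) ε hε' y₁ hy₁ hq₀).trans (lintegral_mono_set ?_)
      exact gball_subset_gball _ hδ2.le hδ2.le hd (by linarith)
    by_cases hy : y ∈ A
    · exact (min_le_left _ _).trans (hcaseA y hy (by rw [gdist_self]; exact zero_le))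
    by_cases hex : ∃ y₁ ∈ A, y₁ ∈ gball (Y.h ε) y (δ / 2)
    · obtain ⟨y₁, hy₁, hd⟩ := hex
      exact (min_le_left _ _).trans (hcaseA y₁ hy₁ (le_of_lt hd))
    · refine (min_le_right _ _).trans ((h3 ε hε (ι y)).trans ?_)
      refine (hι.setLIntegral_gball_le hε b (hmeas b ε hε) fun x hx =>
        (hι.gdist_symm_lt_or hε hA hy hx).resolve_right hex).trans (lintegral_mono_set ?_)
      exact gball_mono _ _ (by linarith)

/-- Resolution blowups satisfy the volume bounds. -/
theorem IsBlowup.hasVolumeBounds (k : ℕ) : ∀ {d : ℕ} {Y : BlowupData.{u} d}, IsBlowup k m Y →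
    HasVolumeBounds k m Y := by
  induction k with
  | zero => exact fun h => h.hasVolumeBounds_zero
  | succ k ih =>
    rintro d Y ⟨hc, hs, A, hA, ⟨D, hD, hDA⟩, Z, ⟨hZ, e, L, hL, hZL⟩, hT⟩
    have hL' := ih hL
    have := hL'.compactSpace
    obtain ⟨Θ, C₀, H⟩ := hZL.exists_isCone hL'.contFamily
    obtain ⟨ι, hι⟩ := hDA.exists_isHalf
    obtain ⟨s, S, κ, pr, K, hS, hpr, hT'⟩ := hT.exists_isTruncChart H.one_le_rho
    exact IsBlowup.hasVolumeBounds_succ rfl hs hA (ih hD) hι hL' H hpr hT'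

/-- Exponents are extended by zero to all of `ℕ`, so that one sequence serves every depth in the
induction. -/
theorem sum_Iic_eq_sum_range {k : ℕ} (b : Fin k → ℝ) (j : Fin k) :
    ∑ i ∈ Finset.Iic j, b i =
      ∑ i ∈ Finset.range (j + 1), if h : i < k then b ⟨i, h⟩ else 0 := by
  refine Finset.sum_bij (fun i _ => (i : ℕ)) (fun i hi => ?_) (fun i _ i' _ h => Fin.ext h)
    (fun i hi => ?_) (fun i _ => by simp)
  · rw [Finset.mem_range]
    have : i ≤ j := Finset.mem_Iic.1 hi
    exact Nat.lt_succ_of_le this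
  · have h : i < k := (Finset.mem_range.1 hi).trans_le j.2
    exact ⟨⟨i, h⟩, Finset.mem_Iic.2 (Nat.le_of_lt_succ (Finset.mem_range.1 hi)), rfl⟩

end Blowup

/-! ### Weighted volumes of balls in QAC spaces -/

theorem weightedVol_gball {n k : ℕ} (Z : QACData.{u} n) (a : ℝ) (b : Fin k → ℝ) (p : Z.Z) (r : ℝ) :
    weightedVol Z a b (gball Z.g p r) = ∫⁻ z in gball Z.g p r,
      weight k Z a (fun i => if h : i < k then b ⟨i, h⟩ else 0) z ∂vol Z.g := by
  rw [weightedVol, withDensity_apply _ (isOpen_gball _ _ _).measurableSet]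
  refine lintegral_congr fun z => ?_
  unfold weight
  rw [Finset.prod_range]
  simp

end QAC

end

theorem proposition4p7 {n k : ℕ} (m : ℕ → ℕ) (Z : QAC.QACData.{u} n) (hZ : QAC.IsQAC k m Z)
    (a : ℝ) (b : Fin k → ℝ) (ha : 0 < a + n)
    (hb : ∀ j : Fin k, 0 < (∑ i ∈ Finset.Iic j, b i) + m j)
    (c : ℝ) (hc : c ∈ Set.Ioo (0 : ℝ) 1) :
    ∃ C₁ C₂ : ℝ, 0 < C₁ ∧ 0 < C₂ ∧ ∀ (p : Z.Z) (r : ℝ), c * Z.ρ p ≤ r →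
      ENNReal.ofReal (C₁ * r ^ (a + n)) ≤ QAC.weightedVol Z a b (QAC.gball Z.g p r) ∧
      QAC.weightedVol Z a b (QAC.gball Z.g p r) ≤ ENNReal.ofReal (C₂ * r ^ (a + n)) := by
  obtain ⟨hconn, d, Y, hY, hcone⟩ := hZ
  have hYV := hY.hasVolumeBounds
  have := hYV.compactSpace
  obtain ⟨Φ, C₀, H⟩ := hcone.exists_isCone hYV.contFamily
  let b' : ℕ → ℝ := fun i => if h : i < k then b ⟨i, h⟩ else 0
  have hb' : ∀ j < k, 0 < ∑ i ∈ Finset.range (j + 1), b' i + m j := fun j hj => by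
    rw [← QAC.sum_Iic_eq_sum_range b ⟨j, hj⟩]; exact hb ⟨j, hj⟩
  obtain ⟨A, hA, hlow⟩ := H.exists_le_setLIntegral_weight hYV a b' hc.1
  obtain ⟨B, hB, hup⟩ := H.exists_setLIntegral_weight_le hYV ha hb'
  -- The lower constant may be infinite a priori; capping it at `1` makes it a positive real number.
  have hA1 : min A 1 ≠ ⊤ := (lt_of_le_of_lt (min_le_right _ _) ENNReal.one_lt_top).ne
  have hA0 : 0 < min A 1 := lt_min (pos_iff_ne_zero.2 hA) one_pos
  have hC := H.pos
  have hc0 := hc.1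
  have hM : 0 < 1 / c + C₀ := by positivity
  -- The upper constant comes from `B(p, r) ⊆ {ρ ≤ (1/c + C₀) r}`: `ρ p ≤ r/c`, and `ρ` grows by at
  -- most `C₀ r` within the ball. Adding `1` to `B.toReal` ensures positivity.
  refine ⟨(min A 1).toReal, (B.toReal + 1) * (1 / c + C₀) ^ (a + n), ENNReal.toReal_pos hA0.ne' hA1,
    by positivity, fun p r hr => ?_⟩
  have hr0 : 0 < r := (mul_pos hc0 (one_pos.trans_le (H.one_le_rho p))).trans_le hr
  have hρr : Z.ρ p ≤ 1 / c * r := by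
    rw [one_div, ← div_eq_inv_mul, le_div_iff₀' hc0]; exact hr
  rw [QAC.weightedVol_gball]
  constructor
  · refine le_trans ?_ (hlow p r hr)
    rw [ENNReal.ofReal_mul ENNReal.toReal_nonneg, ENNReal.ofReal_toReal hA1]
    exact mul_le_mul_left (min_le_left _ _) _
  · have hsub : QAC.gball Z.g p r ⊆ {z | Z.ρ z ≤ (1 / c + C₀) * r} := fun z hz => by
      have := H.rho_le_add hr0.le hz
      change Z.ρ z ≤ (1 / c + C₀) * r
      linarith
    have hR : 1 ≤ (1 / c + C₀) * r := by
      have := H.one_le_rho p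
      have := mul_pos hC hr0
      linarith
    refine (MeasureTheory.lintegral_mono_set hsub).trans ((hup _ hR).trans ?_)
    rw [Real.mul_rpow hM.le hr0.le, mul_assoc, ENNReal.ofReal_mul (by positivity : 0 ≤ B.toReal + 1)]
    refine mul_le_mul_left ?_ _
    rw [ENNReal.ofReal_add ENNReal.toReal_nonneg zero_le_one, ENNReal.ofReal_toReal hB]
    exact le_self_add
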